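/- Let $m,k_e,k_h,k_f\ge 0$ be integers and $n=m+k_e+k_h+2k_f$. On $\mathbb R^m\times\mathbb T^m\times\mathbb R^{2(n-m)}$, where $\mathbb T^m=\mathbb R^m/\mathbb Z^m$, with coordinates $p_i$, $q_i \bmod 1$ ($1\le i\le m$) and $(x_j,y_j)$ ($1\le j\le n-m$), consider the linear system of Williamson type $(k_e,k_h,k_f)$: the symplectic form $\omega=\sum_{i=1}^m dp_i\wedge dq_i+\sum_{j=1}^{n-m}dx_j\wedge dy_j$ and the moment map $\mathbf F=(p_1,\dots,p_m,h_1,\dots,h_{n-m})$, where $h_j=x_j^2+y_j^2$ for $1\le j\le k_e$, $h_j=x_jy_j$ for $k_e+1\le j\le k_e+k_h$, and $h_j=x_jy_{j+1}-x_{j+1}y_j$, $h_{j+1}=x_jy_j+x_{j+1}y_{j+1}$ for $j=k_e+k_h+2l-1$, $1\le l\le k_f$. A smooth map $f$ preserves the system if $f^*\omega=\omega$ and $\mathbf F\circ f=\mathbf F$. An action of a Lie group on $\mathbb R^m\times\mathbb T^m\times\mathbb R^{2(n-m)}$ is called linear if it is smooth, preserves the system, and acts componentwise: trivially on $\mathbb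 R^m$, by translations on $\mathbb T^m$, and by linear maps on $\mathbb R^{2(n-m)}$. For $\varepsilon>0$ let $D^m_\varepsilon$, $D^{2(n-m)}_\varepsilon$ be the open Euclidean balls of radius $\varepsilon$ about the origin. Theorem. Let $U$ be an open neighborhood of the torus $L=\{0\}\times\mathbb T^m\times\{0\}$ (for instance $U=D^m\times\mathbb T^m\times D^{2(n-m)}$, a product with open balls about the origin), and let $\rho$ be a smooth action of a compact Lie group $G$ on $U$ that preserves the system. Then there exist $\varepsilon>0$, a $G$-invariant open neighborhood $W\subseteq U$ of $L$, a smooth diffeomorphism $\Phi: W\to D^m_\varepsilon\times\mathbb T^m\times D^{2(n-m)}_\varepsilon$ that preserves the system and satisfies $\Phi(L)=L$, and a linear action $\sigma$ of $G$ such that $\Phi\circ\rho(g)=\sigma(g)\circ\Phi$ on $W$ for every $g\in G$. -/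

import Mathlib

open scoped Manifold ContDiff Topology

noncomputable section

/-! ### The torus `ℝᵐ / ℤᵐ` as a smooth manifold -/

/-- The torus `𝕋ᵐ`, with coordinates `(q₁ mod 1, …, q_m mod 1)`. -/
def Torus (m : ℕ) : Type := Fin m → AddCircle (1 : ℝ)

namespace Torus

instance (m : ℕ) : AddCommGroup (Torus m) :=
  inferInstanceAs (AddCommGroup (Fin m → AddCircle (1 : ℝ)))

instance (m : ℕ) : TopologicalSpace (Torus m) :=
  inferInstanceAs (TopologicalSpace (Fin m → AddCircle (1 : ℝ)))

/-- The universal covering `ℝᵐ → 𝕋ᵐ`, reduction modulo `1` of each coordinate. -/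
def proj (m : ℕ) (q : Fin m → ℝ) : Torus m := fun i => (q i : AddCircle (1 : ℝ))

theorem isLocalHomeomorph_proj (m : ℕ) : IsLocalHomeomorph (proj m) := by
  refine IsLocalHomeomorph.mk _ fun x => ?_
  have h := AddCircle.isLocalHomeomorph_coe (1 : ℝ)
  refine ⟨OpenPartialHomeomorph.pi fun i => (h.localInverseAt (x := x i)).symm, ?_, ?_⟩
  · intro i _
    exact h.self_mem_localInverseAt_target
  · intro y _
    funext i
    change _ = (h.localInverseAt (x := x i)).symm (y i)
    rw [h.localInverseAt_symm]
    rfl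

theorem proj_surjective (m : ℕ) : Function.Surjective (proj m) := fun q =>
  ⟨fun i => (QuotientAddGroup.mk_surjective (q i)).choose,
    funext fun i => (QuotientAddGroup.mk_surjective (q i)).choose_spec⟩

/-- The smooth structure of the torus: the charts are the local sections of the
covering `ℝᵐ → 𝕋ᵐ`, so that chart changes are locally translations by integer vectors. -/
instance (m : ℕ) : ChartedSpace (Fin m → ℝ) (Torus m) where
  atlas := {e | ∀ q ∈ e.source, proj m (e q) = q}
  chartAt q := (isLocalHomeomorph_proj m).localInverseAt (x := (proj_surjective m q).choose)
  mem_chart_source q := by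
    have h := (isLocalHomeomorph_proj m).apply_self_mem_localInverseAt_source
      (x := (proj_surjective m q).choose)
    rwa [(proj_surjective m q).choose_spec] at h
  chart_mem_atlas _ _ hq := (isLocalHomeomorph_proj m).apply_localInverseAt_of_mem hq

/-- Two continuous lifts of the same map differ locally by a constant vector. -/
theorem eventually_eq_add {m : ℕ} {f : (Fin m → ℝ) → (Fin m → ℝ)} {x : Fin m → ℝ}
    (hf : ContinuousAt f x) (h : ∀ᶠ y in 𝓝 x, proj m (f y) = proj m y) :
    ∀ᶠ y in 𝓝 x, f y = y + (f x - x) := by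
  have hc : ContinuousAt (fun y => (f y - y) - (f x - x)) x := by fun_prop
  have h1 : ∀ᶠ y in 𝓝 x, dist ((f y - y) - (f x - x)) 0 < 1 := by
    have := Metric.tendsto_nhds.1 hc.tendsto 1 one_pos
    simpa using this
  filter_upwards [h, h1] with y hy hy1
  funext i
  have e1 : ∃ a : ℤ, (a : ℝ) = f y i - y i := by
    have := congrFun hy i
    have h0 : ((f y i - y i : ℝ) : AddCircle (1 : ℝ)) = 0 := by
      rw [AddCircle.coe_sub, sub_eq_zero]; exact this
    simpa using (AddCircle.coe_eq_zero_iff (1 : ℝ)).1 h0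
  have e2 : ∃ a : ℤ, (a : ℝ) = f x i - x i := by
    have := congrFun h.self_of_nhds i
    have h0 : ((f x i - x i : ℝ) : AddCircle (1 : ℝ)) = 0 := by
      rw [AddCircle.coe_sub, sub_eq_zero]; exact this
    simpa using (AddCircle.coe_eq_zero_iff (1 : ℝ)).1 h0
  obtain ⟨a, ha⟩ := e1
  obtain ⟨b, hb⟩ := e2
  have h2 : |(a : ℝ) - b| < 1 := by
    have := (dist_pi_lt_iff one_pos).1 hy1 i
    simpa [Real.dist_eq, ha, hb] using this
  have h3 : a = b := by
    have h4 : |a - b| < 1 := by exact_mod_cast h2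
    have := Int.abs_lt_one_iff.1 h4
    omega
  have h5 : f y i - y i = f x i - x i := by rw [← ha, ← hb, h3]
  simp only [Pi.add_apply, Pi.sub_apply]
  linarith

instance (m : ℕ) : IsManifold 𝓘(ℝ, Fin m → ℝ) ∞ (Torus m) := by
  refine isManifold_of_contDiffOn _ _ _ fun e e' he he' => ?_
  intro x hx
  simp only [modelWithCornersSelf_coe, modelWithCornersSelf_coe_symm, Set.preimage_id,
    Set.range_id, Set.inter_univ, id_eq, Function.comp_def] at hx ⊢
  have hopen : IsOpen (e.symm ≫ₕ e').source := (e.symm ≫ₕ e').open_source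
  have hp : ∀ y ∈ (e.symm ≫ₕ e').source, proj m ((e.symm ≫ₕ e') y) = proj m y := by
    intro y hy
    have hy' := hy
    rw [OpenPartialHomeomorph.trans_source] at hy'
    have h1 := he' _ hy'.2
    have h2 := he _ (e.symm.map_source hy'.1)
    rw [OpenPartialHomeomorph.coe_trans, Function.comp_apply, h1, ← h2]
    congr 1
    exact (e.right_inv hy'.1)
  have hev := eventually_eq_add ((e.symm ≫ₕ e').continuousAt hx)
    (Filter.eventually_of_mem (hopen.mem_nhds hx) hp)
  refine ContDiffAt.contDiffWithinAt ?_
  exact (contDiffAt_id.add contDiffAt_const).congr_of_eventuallyEq hev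

/-- The covering `ℝᵐ → 𝕋ᵐ` is smooth and its derivative is the identity of `ℝᵐ`: the
tangent vectors of the torus are expressed in the basis `∂/∂q₁, …, ∂/∂q_m`. -/
theorem hasMFDerivAt_proj (m : ℕ) (x : Fin m → ℝ) :
    HasMFDerivAt 𝓘(ℝ, Fin m → ℝ) 𝓘(ℝ, Fin m → ℝ) (proj m) x
      (ContinuousLinearMap.id ℝ (Fin m → ℝ)) := by
  have hc : ContinuousAt (proj m) x := (isLocalHomeomorph_proj m).continuous.continuousAt
  refine ⟨hc, ?_⟩
  have hmem := mem_chart_source (Fin m → ℝ) (proj m x)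
  have hcomp : ContinuousAt (fun y => chartAt (Fin m → ℝ) (proj m x) (proj m y)) x :=
    ContinuousAt.comp (g := chartAt (Fin m → ℝ) (proj m x))
      ((chartAt (Fin m → ℝ) (proj m x)).continuousAt hmem) hc
  have hev := eventually_eq_add hcomp (by
    filter_upwards [hc.preimage_mem_nhds
      ((chartAt (Fin m → ℝ) (proj m x)).open_source.mem_nhds hmem)] with y hy
    exact chart_mem_atlas (Fin m → ℝ) (proj m x) _ hy)
  have hd : HasFDerivAt (fun y => chartAt (Fin m → ℝ) (proj m x) (proj m y))
      (ContinuousLinearMap.id ℝ (Fin m → ℝ)) x :=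
    ((hasFDerivAt_id x).add_const _).congr_of_eventuallyEq hev
  exact hd.hasFDerivWithinAt

end Torus

/-! ### The linear system of Williamson type `(kₑ, k_h, k_f)` -/

/-- The index set of the conjugate pairs `(x_j, y_j)`: `ke` elliptic pairs, `kh` hyperbolic
pairs, and `kf` focus-focus blocks consisting of two consecutive pairs each. Its cardinality
is `n - m = ke + kh + 2 * kf`. -/
abbrev PairIndex (ke kh kf : ℕ) : Type := Fin ke ⊕ Fin kh ⊕ (Fin kf × Fin 2)

/-- The linear coordinates `(x_j, y_j)_j` on `ℝ^{2(n-m)}`. -/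
abbrev TransverseSpace (ke kh kf : ℕ) : Type := PairIndex ke kh kf → ℝ × ℝ

/-- The phase space `ℝᵐ × 𝕋ᵐ × ℝ^{2(n-m)}` with coordinates `(p, q, (x, y))`. -/
abbrev PhaseSpace (m ke kh kf : ℕ) : Type :=
  (Fin m → ℝ) × Torus m × TransverseSpace ke kh kf

/-- The vector space on which the phase space is modelled; each of its tangent spaces is
this space, with components along `∂/∂p`, `∂/∂q`, `(∂/∂x, ∂/∂y)`. -/
abbrev PhaseVector (m ke kh kf : ℕ) : Type :=
  (Fin m → ℝ) × (Fin m → ℝ) × TransverseSpace ke kh kf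

/-- The product manifold structure of the phase space. -/
abbrev phaseModel (m ke kh kf : ℕ) :=
  (𝓘(ℝ, Fin m → ℝ)).prod ((𝓘(ℝ, Fin m → ℝ)).prod 𝓘(ℝ, TransverseSpace ke kh kf))

variable {m ke kh kf : ℕ}

/-- The standard symplectic form `∑ dpᵢ ∧ dqᵢ + ∑ dx_j ∧ dy_j`. -/
def symplecticForm (u v : PhaseVector m ke kh kf) : ℝ :=
  ∑ i, (u.1 i * v.2.1 i - v.1 i * u.2.1 i) +
    ∑ j, ((u.2.2 j).1 * (v.2.2 j).2 - (v.2.2 j).1 * (u.2.2 j).2)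

/-- The quadratic functions `h_j`: `x² + y²` for an elliptic pair, `x y` for a hyperbolic
pair, and `x₀ y₁ - x₁ y₀`, `x₀ y₀ + x₁ y₁` for a focus-focus block. -/
def quadraticMap (w : TransverseSpace ke kh kf) : PairIndex ke kh kf → ℝ
  | .inl i => (w (.inl i)).1 ^ 2 + (w (.inl i)).2 ^ 2
  | .inr (.inl i) => (w (.inr (.inl i))).1 * (w (.inr (.inl i))).2
  | .inr (.inr (i, 0)) =>
      (w (.inr (.inr (i, 0)))).1 * (w (.inr (.inr (i, 1)))).2 -
        (w (.inr (.inr (i, 1)))).1 * (w (.inr (.inr (i, 0)))).2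
  | .inr (.inr (i, 1)) =>
      (w (.inr (.inr (i, 0)))).1 * (w (.inr (.inr (i, 0)))).2 +
        (w (.inr (.inr (i, 1)))).1 * (w (.inr (.inr (i, 1)))).2

/-- The moment map `(p, h)` of the linear system. -/
def momentMap (z : PhaseSpace m ke kh kf) : (Fin m → ℝ) × (PairIndex ke kh kf → ℝ) :=
  (z.1, quadraticMap z.2.2)

/-- The orbit `L = {0} × 𝕋ᵐ × {0}`. -/
def centralTorus (m ke kh kf : ℕ) : Set (PhaseSpace m ke kh kf) :=
  {z | z.1 = 0 ∧ z.2.2 = 0}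

/-- The product `D^m × 𝕋ᵐ × D^{2(n-m)}` with open Euclidean balls of radius `ε` about `0`. -/
def tube (m ke kh kf : ℕ) (ε : ℝ) : Set (PhaseSpace m ke kh kf) :=
  {z | ∑ i, z.1 i ^ 2 < ε ^ 2 ∧ ∑ j, ((z.2.2 j).1 ^ 2 + (z.2.2 j).2 ^ 2) < ε ^ 2}

/-- The map `f` preserves the system on the open set `U`: it preserves the moment map and
the symplectic form. -/
def PreservesSystem (U : Set (PhaseSpace m ke kh kf))
    (f : PhaseSpace m ke kh kf → PhaseSpace m ke kh kf) : Prop :=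
  ∀ z ∈ U, momentMap (f z) = momentMap z ∧
    ∀ u v : PhaseVector m ke kh kf,
      symplecticForm (mfderiv (phaseModel m ke kh kf) (phaseModel m ke kh kf) f z u)
        (mfderiv (phaseModel m ke kh kf) (phaseModel m ke kh kf) f z v) = symplecticForm u v

/-- `ρ` restricts to a smooth action of the Lie group `G` on the open set `U` that preserves
the system; the values of `ρ` outside of `U` are irrelevant. -/
structure IsSystemAction {EG : Type*} [NormedAddCommGroup EG] [NormedSpace ℝ EG]
    {G : Type*} [TopologicalSpace G] [ChartedSpace EG G] [Group G]
    (U : Set (PhaseSpace m ke kh kf))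
    (ρ : G → PhaseSpace m ke kh kf → PhaseSpace m ke kh kf) : Prop where
  mapsTo : ∀ g, Set.MapsTo (ρ g) U U
  one_act : ∀ z ∈ U, ρ 1 z = z
  mul_act : ∀ g h, ∀ z ∈ U, ρ (g * h) z = ρ g (ρ h z)
  smooth : ContMDiffOn ((𝓘(ℝ, EG)).prod (phaseModel m ke kh kf)) (phaseModel m ke kh kf) ∞
    (fun a : G × PhaseSpace m ke kh kf => ρ a.1 a.2) (Set.univ ×ˢ U)
  preserves : ∀ g, PreservesSystem U (ρ g)

/-- A linear action: a system-preserving action on `ℝᵐ × 𝕋ᵐ × ℝ^{2(n-m)}` which acts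
componentwise, trivially on the first factor, by translations on the torus, and by linear
maps on the last factor. -/
def IsLinearAction {EG : Type*} [NormedAddCommGroup EG] [NormedSpace ℝ EG]
    {G : Type*} [TopologicalSpace G] [ChartedSpace EG G] [Group G]
    (σ : G → PhaseSpace m ke kh kf → PhaseSpace m ke kh kf) : Prop :=
  IsSystemAction (EG := EG) Set.univ σ ∧
    ∀ g, ∃ (t : Torus m) (A : TransverseSpace ke kh kf →ₗ[ℝ] TransverseSpace ke kh kf),
      ∀ p q w, σ g (p, q, w) = (p, q + t, A w)

end

/-!
Write `z = (p, q, w)` for the points of the phase space, `F` for the moment map and `L` for the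
central torus.

A map preserving `F` and the symplectic form preserves the Hamiltonian vector fields of the
components of `F` (`PreservesSystem.mfderiv_apply`). Hence each `ρ g` commutes with the translations
of the torus, has the form `(p, q, w) ↦ (p, q + τ(p, w), W(p, w))`, and `W` is infinitesimally
equivariant under the flows of the quadratic Hamiltonians. Since `W` also preserves these
Hamiltonians, it is a flow with point-dependent times, composed with multiplication by unit
complex numbers. To see this with smooth times, choose a leading complex coordinate in each block:
`x + i y`, `x`, or `x₀ + i x₁`. The leading coordinates of `W` are smooth multiples `u` of those of
`w` (`exists_multiplier`): in the elliptic and hyperbolic blocks equivariance makes the derivative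
of `s c(W)` along the rays `s w_j` divisible by the coordinate `c`, and in the focus-focus blocks
every point with nonzero leading coordinate flows to a slice transverse to the orbits, on which `u`
is read off. At the origin `u` and `τ` give homomorphisms to the unit complex numbers and to the
torus; these form the linear action `σ`. The logarithm of the rest of `u`, together with the lift
of the rest of `τ`, gives smooth times `a g` depending on `(p, w)`, and

`ρ g (p, q, w) = σ g (flow with times a g (p, w))`    (`IsSystemAction.exists_isFlowForm`).

Because the flows commute with each other and with `σ`, the times form an *additive* cocycle,
`a (g h) = a g ∘ ρ h + a h`. The flow with variable times `c` changes the symplectic form by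
`± ∑ dcₖ ∧ dFₖ`, which is *linear* in `c` because the components of `F` Poisson commute
(`exists_hasFDerivAt_timeMapLift`). So the Haar average `c` of the times `a g` satisfies
`c ∘ ρ h + a h = c`, and the flow `Φ` with times `c` is again symplectic
(`IsFlowForm.exists_average`). The first equation says `Φ ∘ ρ h = σ h ∘ Φ`. Finally `c` vanishes at
the origin, so the derivative of `Φ` along `L` is invertible and the inverse function theorem in the
coordinates `(p, w)` gives a diffeomorphism onto a tube (`IsFlowForm.exists_baseTimeMap`). The tube
is invariant under `σ`, since the multipliers have modulus one, and so its preimage is invariant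
under `ρ`.
-/

noncomputable section

variable {m ke kh kf : ℕ}

/-! ### Calculus on the torus and on the phase space through the universal covering -/

namespace Torus

/-- The local section of the covering `ℝᵐ → 𝕋ᵐ` through a given point of `ℝᵐ`. -/
def section_ (x : Fin m → ℝ) : OpenPartialHomeomorph (Torus m) (Fin m → ℝ) :=
  (isLocalHomeomorph_proj m).localInverseAt (x := x)

theorem mem_section_source (x : Fin m → ℝ) : proj m x ∈ (section_ x).source :=
  (isLocalHomeomorph_proj m).apply_self_mem_localInverseAt_source

theorem section_proj (x : Fin m → ℝ) : section_ x (proj m x) = x :=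
  (isLocalHomeomorph_proj m).localInverseAt_apply_self

theorem proj_section {x : Fin m → ℝ} {q : Torus m} (hq : q ∈ (section_ x).source) :
    proj m (section_ x q) = q :=
  (isLocalHomeomorph_proj m).apply_localInverseAt_of_mem hq

theorem section_mem_atlas (x : Fin m → ℝ) : section_ x ∈ atlas (Fin m → ℝ) (Torus m) :=
  fun _ hq => proj_section hq

theorem eventually_proj_section (x : Fin m → ℝ) :
    ∀ᶠ q in 𝓝 (proj m x), proj m (section_ x q) = q := by
  filter_upwards [(section_ x).open_source.mem_nhds (mem_section_source x)] with q hq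
  exact proj_section hq

theorem contMDiffAt_section {x : Fin m → ℝ} {q : Torus m} (hq : q ∈ (section_ x).source) :
    ContMDiffAt 𝓘(ℝ, Fin m → ℝ) 𝓘(ℝ, Fin m → ℝ) ∞ (section_ x) q :=
  contMDiffAt_of_mem_maximalAtlas
    (IsManifold.subset_maximalAtlas (section_mem_atlas x)) hq

theorem contMDiff_proj : ContMDiff 𝓘(ℝ, Fin m → ℝ) 𝓘(ℝ, Fin m → ℝ) ∞ (proj m) := by
  intro x
  have h := contMDiffOn_symm_of_mem_maximalAtlas (I := 𝓘(ℝ, Fin m → ℝ)) (n := ∞)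
    (IsManifold.subset_maximalAtlas (section_mem_atlas x))
  have h1 : (section_ x).symm = (proj m : (Fin m → ℝ) → Torus m) :=
    (isLocalHomeomorph_proj m).localInverseAt_symm _
  have h2 : x ∈ (section_ x).target := (isLocalHomeomorph_proj m).self_mem_localInverseAt_target
  exact h1 ▸ h.contMDiffAt ((section_ x).open_target.mem_nhds h2)

theorem continuous_proj : Continuous (proj m) := contMDiff_proj.continuous

theorem proj_add (x y : Fin m → ℝ) : proj m (x + y) = proj m x + proj m y := rfl

theorem proj_zero : proj m 0 = 0 := rfl

theorem proj_neg (x : Fin m → ℝ) : proj m (-x) = -proj m x := rfl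

/-- Two vectors with the same image in the torus and at distance less than `1` agree. -/
theorem eq_of_proj_eq {x y : Fin m → ℝ} (h : proj m x = proj m y) (hd : ‖x - y‖ < 1) :
    x = y := by
  funext i
  have h0 : ((x i - y i : ℝ) : AddCircle (1 : ℝ)) = 0 := by
    rw [AddCircle.coe_sub, sub_eq_zero]; exact congrFun h i
  obtain ⟨n, hn⟩ := (AddCircle.coe_eq_zero_iff (1 : ℝ)).1 h0
  have h1 : |x i - y i| < 1 := lt_of_le_of_lt (norm_le_pi_norm (x - y) i) hd
  simp only [zsmul_eq_mul, mul_one] at hn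
  rw [← hn] at h1
  have h2 : |n| < 1 := by exact_mod_cast h1
  have h3 : n = 0 := Int.abs_lt_one_iff.1 h2
  rw [h3] at hn
  simp at hn
  linarith

theorem hasMFDerivAt_section {x : Fin m → ℝ} {q : Torus m} (hq : q ∈ (section_ x).source) :
    HasMFDerivAt 𝓘(ℝ, Fin m → ℝ) 𝓘(ℝ, Fin m → ℝ) (section_ x) q
      (ContinuousLinearMap.id ℝ (Fin m → ℝ)) := by
  obtain ⟨y, hy, rfl⟩ : ∃ y ∈ (section_ x).target, proj m y = q :=
    ⟨section_ x q, (section_ x).map_source hq, proj_section hq⟩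
  have h2 := ((contMDiffAt_section hq).mdifferentiableAt (by simp)).hasMFDerivAt
  have h4 := HasMFDerivAt.comp (I' := 𝓘(ℝ, Fin m → ℝ)) y h2 (hasMFDerivAt_proj m y)
  have h5 : HasMFDerivAt 𝓘(ℝ, Fin m → ℝ) 𝓘(ℝ, Fin m → ℝ) (section_ x ∘ proj m) y
      (ContinuousLinearMap.id ℝ (Fin m → ℝ)) := by
    refine (hasMFDerivAt_id y).congr_of_eventuallyEq ?_
    filter_upwards [(section_ x).open_target.mem_nhds hy] with z hz
    have h7 : (section_ x).symm = (proj m : (Fin m → ℝ) → Torus m) :=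
      (isLocalHomeomorph_proj m).localInverseAt_symm _
    have := (section_ x).right_inv hz
    rw [h7] at this
    exact this
  have h9 : mfderiv 𝓘(ℝ, Fin m → ℝ) 𝓘(ℝ, Fin m → ℝ) (section_ x) (proj m y) =
      ContinuousLinearMap.id ℝ (Fin m → ℝ) := by
    have h8 := hasMFDerivAt_unique h4 h5
    exact h8
  exact h9 ▸ h2

theorem contMDiff_add : ContMDiff (𝓘(ℝ, Fin m → ℝ).prod 𝓘(ℝ, Fin m → ℝ)) 𝓘(ℝ, Fin m → ℝ) ∞
    (fun q : Torus m × Torus m => q.1 + q.2) := by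
  rintro ⟨q, q'⟩
  obtain ⟨x, rfl⟩ := proj_surjective m q
  obtain ⟨y, rfl⟩ := proj_surjective m q'
  have h1 := (contMDiffAt_section (mem_section_source x)).comp (proj m x, proj m y)
    (contMDiffAt_fst (I := 𝓘(ℝ, Fin m → ℝ)) (J := 𝓘(ℝ, Fin m → ℝ)))
  have h2 := (contMDiffAt_section (mem_section_source y)).comp (proj m x, proj m y)
    (contMDiffAt_snd (I := 𝓘(ℝ, Fin m → ℝ)) (J := 𝓘(ℝ, Fin m → ℝ)))
  have h3 := (contMDiff_proj (m := m)).contMDiffAt.comp (proj m x, proj m y) (h1.add h2)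
  refine h3.congr_of_eventuallyEq ?_
  have e1 := (continuous_fst (X := Torus m) (Y := Torus m)).continuousAt
    (x := (proj m x, proj m y)) |>.eventually (eventually_proj_section x)
  have e2 := (continuous_snd (X := Torus m) (Y := Torus m)).continuousAt
    (x := (proj m x, proj m y)) |>.eventually (eventually_proj_section y)
  filter_upwards [e1, e2] with q hq1 hq2
  simp only [Function.comp_apply, Pi.add_apply, proj_add, hq1, hq2]

theorem contMDiff_neg : ContMDiff 𝓘(ℝ, Fin m → ℝ) 𝓘(ℝ, Fin m → ℝ) ∞
    (fun q : Torus m => -q) := by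
  intro q
  obtain ⟨x, rfl⟩ := proj_surjective m q
  have h1 := contMDiffAt_section (mem_section_source x)
  have h3 := (contMDiff_proj (m := m)).contMDiffAt.comp (proj m x) h1.neg
  refine h3.congr_of_eventuallyEq ?_
  filter_upwards [eventually_proj_section x] with q hq
  simp only [Function.comp_apply, proj_neg, hq]

instance : CompactSpace (Torus m) :=
  inferInstanceAs (CompactSpace (Fin m → AddCircle (1 : ℝ)))

/-- A path in the torus with constant velocity `v` is a straight line. -/
theorem eq_add_proj_of_hasMFDerivAt {γ : ℝ → Torus m} {v : Fin m → ℝ}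
    (h : ∀ s, HasMFDerivAt 𝓘(ℝ, ℝ) 𝓘(ℝ, Fin m → ℝ) γ s
      (ContinuousLinearMap.toSpanSingleton ℝ v)) (s : ℝ) :
    γ s = γ 0 + proj m (s • v) := by
  -- Near each parameter, `γ` lifts to a path in `ℝᵐ` with velocity `v`.
  have hloc : IsLocallyConstant (fun s => γ s - proj m (s • v)) := by
    rw [IsLocallyConstant.iff_eventually_eq]
    intro s
    obtain ⟨x, hx⟩ := proj_surjective m (γ s)
    have hc : Continuous γ := continuous_iff_continuousAt.2 fun s => (h s).continuousAt
    have hmem : ∀ᶠ t in 𝓝 s, γ t ∈ (section_ x).source :=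
      hc.continuousAt.preimage_mem_nhds ((section_ x).open_source.mem_nhds
        (hx ▸ mem_section_source x))
    obtain ⟨δ, hδ, hball⟩ := Metric.eventually_nhds_iff_ball.1 hmem
    have hd : ∀ t ∈ Metric.ball s δ, HasDerivAt (fun t => section_ x (γ t) - t • v) 0 t := by
      intro t ht
      have h1 : HasDerivAt (fun t => section_ x (γ t)) v t := by
        have h2 := HasMFDerivAt.comp t (hasMFDerivAt_section (hball t ht)) (h t)
        have h3 : HasFDerivAt (fun t => section_ x (γ t))
          (ContinuousLinearMap.toSpanSingleton ℝ v) t := h2.hasFDerivAt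
        simpa using h3.hasDerivAt
      have h4 := h1.sub ((hasDerivAt_id t).smul_const v)
      rw [one_smul, sub_self] at h4
      exact h4
    filter_upwards [Metric.ball_mem_nhds s hδ] with t ht
    have hconst := Metric.isOpen_ball.is_const_of_deriv_eq_zero
      (convex_ball s δ).isPreconnected
      (fun t ht => (hd t ht).differentiableAt.differentiableWithinAt)
      (fun t ht => (hd t ht).deriv) ht (Metric.mem_ball_self hδ)
    have h2 := congrArg (proj m) hconst
    simp only [sub_eq_add_neg, proj_add, proj_neg, proj_section (hball t ht),
      proj_section (hball s (Metric.mem_ball_self hδ))] at h2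
    simpa only [sub_eq_add_neg] using h2
  have := hloc.apply_eq_of_preconnectedSpace s 0
  simp only [zero_smul, proj_zero, sub_zero] at this
  rw [← this, sub_add_cancel]

end Torus

/-- The universal covering `ℝᵐ × ℝᵐ × ℝ^{2(n-m)} → ℝᵐ × 𝕋ᵐ × ℝ^{2(n-m)}` of the phase
space. -/
def cover (x : PhaseVector m ke kh kf) : PhaseSpace m ke kh kf :=
  (x.1, Torus.proj m x.2.1, x.2.2)

theorem cover_surjective (z : PhaseSpace m ke kh kf) : ∃ x, cover x = z := by
  obtain ⟨q, hq⟩ := Torus.proj_surjective m z.2.1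
  exact ⟨(z.1, q, z.2.2), by simp [cover, hq]⟩

theorem contMDiff_cover : ContMDiff 𝓘(ℝ, PhaseVector m ke kh kf) (phaseModel m ke kh kf) ∞
    (cover : PhaseVector m ke kh kf → PhaseSpace m ke kh kf) := by
  refine ContMDiff.prodMk ?_ (ContMDiff.prodMk ?_ ?_)
  · exact contDiff_fst.contMDiff
  · exact Torus.contMDiff_proj.comp (contDiff_fst.comp contDiff_snd).contMDiff
  · exact (contDiff_snd.comp contDiff_snd).contMDiff

theorem hasMFDerivAt_cover (x : PhaseVector m ke kh kf) :
    HasMFDerivAt 𝓘(ℝ, PhaseVector m ke kh kf) (phaseModel m ke kh kf)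
      (cover : PhaseVector m ke kh kf → PhaseSpace m ke kh kf) x
      (ContinuousLinearMap.id ℝ (PhaseVector m ke kh kf)) := by
  have h1 := (hasFDerivAt_fst (𝕜 := ℝ) (p := x)).hasMFDerivAt
  have h2 := HasMFDerivAt.comp (I' := 𝓘(ℝ, Fin m → ℝ)) x (Torus.hasMFDerivAt_proj m x.2.1)
    ((hasFDerivAt_fst (𝕜 := ℝ) (p := x.2)).comp x (hasFDerivAt_snd (𝕜 := ℝ) (p := x))).hasMFDerivAt
  have h3 := ((hasFDerivAt_snd (𝕜 := ℝ) (p := x.2)).comp x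
    (hasFDerivAt_snd (𝕜 := ℝ) (p := x))).hasMFDerivAt
  exact h1.prodMk (h2.prodMk h3)

/-- The local section of the covering of the phase space through a given point. -/
def coverSection (x : PhaseVector m ke kh kf) (z : PhaseSpace m ke kh kf) :
    PhaseVector m ke kh kf :=
  (z.1, Torus.section_ x.2.1 z.2.1, z.2.2)

theorem coverSection_cover (x : PhaseVector m ke kh kf) : coverSection x (cover x) = x := by
  simp [coverSection, cover, Torus.section_proj]

theorem contMDiffAt_coverSection (x : PhaseVector m ke kh kf) :
    ContMDiffAt (phaseModel m ke kh kf) 𝓘(ℝ, PhaseVector m ke kh kf) ∞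
      (coverSection x) (cover x) := by
  have h1 : ContMDiffAt (phaseModel m ke kh kf) 𝓘(ℝ, Fin m → ℝ) ∞
      (fun z : PhaseSpace m ke kh kf => z.1) (cover x) := contMDiffAt_fst
  have h2 : ContMDiffAt (phaseModel m ke kh kf) 𝓘(ℝ, Fin m → ℝ) ∞
      (fun z : PhaseSpace m ke kh kf => Torus.section_ x.2.1 z.2.1) (cover x) :=
    ContMDiffAt.comp (I' := 𝓘(ℝ, Fin m → ℝ)) (cover x)
      (Torus.contMDiffAt_section (Torus.mem_section_source x.2.1))
      ((contMDiff_fst.comp contMDiff_snd).contMDiffAt)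
  have h3 : ContMDiffAt (phaseModel m ke kh kf) 𝓘(ℝ, TransverseSpace ke kh kf) ∞
      (fun z : PhaseSpace m ke kh kf => z.2.2) (cover x) :=
    (contMDiff_snd.comp contMDiff_snd).contMDiffAt
  exact h1.prodMk_space (h2.prodMk_space h3)

theorem eventually_cover_coverSection (x : PhaseVector m ke kh kf) :
    ∀ᶠ z in 𝓝 (cover x), cover (coverSection x z) = z := by
  have hc : ContinuousAt (fun z : PhaseSpace m ke kh kf => z.2.1) (cover x) := by fun_prop
  filter_upwards [hc.eventually (Torus.eventually_proj_section x.2.1)] with z hz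
  simp [cover, coverSection, hz]

/-- The derivative of a map of the phase space is the derivative of any local lift. -/
theorem hasMFDerivAt_of_lift {f : PhaseSpace m ke kh kf → PhaseSpace m ke kh kf}
    {F : PhaseVector m ke kh kf → PhaseVector m ke kh kf} {x : PhaseVector m ke kh kf}
    {F' : PhaseVector m ke kh kf →L[ℝ] PhaseVector m ke kh kf} (hF : HasFDerivAt F F' x)
    (h : ∀ᶠ y in 𝓝 x, f (cover y) = cover (F y)) :
    HasMFDerivAt (phaseModel m ke kh kf) (phaseModel m ke kh kf) f (cover x) F' := by
  have hs := (contMDiffAt_coverSection x).mdifferentiableAt (by simp)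
  have h1 := HasMFDerivAt.comp (cover x)
    ((coverSection_cover x).symm ▸ hasMFDerivAt_cover x) hs.hasMFDerivAt
  have h2 := hasMFDerivAt_unique h1 ((hasMFDerivAt_id (cover x)).congr_of_eventuallyEq
    (eventually_cover_coverSection x))
  have h3 : mfderiv (phaseModel m ke kh kf) 𝓘(ℝ, PhaseVector m ke kh kf)
    (coverSection x) (cover x) = ContinuousLinearMap.id ℝ (PhaseVector m ke kh kf) := h2
  have h4 := HasMFDerivAt.comp (cover x) (I' := 𝓘(ℝ, PhaseVector m ke kh kf))
    ((coverSection_cover x).symm ▸ (HasMFDerivAt.comp x (hasMFDerivAt_cover (F x))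
    hF.hasMFDerivAt)) (h3 ▸ hs.hasMFDerivAt)
  refine HasMFDerivAt.congr_of_eventuallyEq h4 ?_
  have h5 := hs.continuousAt.eventually ((coverSection_cover x).symm ▸ h)
  filter_upwards [h5, eventually_cover_coverSection x] with z hz hz'
  rw [hz'] at hz
  exact hz

/-- A map of the phase space with a smooth local lift is smooth. -/
theorem contMDiffAt_of_lift {f : PhaseSpace m ke kh kf → PhaseSpace m ke kh kf}
    {F : PhaseVector m ke kh kf → PhaseVector m ke kh kf} {x : PhaseVector m ke kh kf}
    (hF : ContDiffAt ℝ ∞ F x) (h : ∀ᶠ y in 𝓝 x, f (cover y) = cover (F y)) :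
    ContMDiffAt (phaseModel m ke kh kf) (phaseModel m ke kh kf) ∞ f (cover x) := by
  have hs := contMDiffAt_coverSection x
  have h4 := ContMDiffAt.comp (cover x) (I' := 𝓘(ℝ, PhaseVector m ke kh kf))
    (g := fun y => cover (F y))
    ((coverSection_cover x).symm ▸ (contMDiff_cover.contMDiffAt.comp x hF.contMDiffAt)) hs
  refine ContMDiffAt.congr_of_eventuallyEq h4 ?_
  have h5 := hs.continuousAt.eventually ((coverSection_cover x).symm ▸ h)
  filter_upwards [h5, eventually_cover_coverSection x] with z hz hz'
  rw [hz'] at hz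
  exact hz

/-! ### The flows of the quadratic Hamiltonians -/

/-- The index set of the Williamson blocks. -/
abbrev Block (ke kh kf : ℕ) : Type := Fin ke ⊕ Fin kh ⊕ Fin kf

/-- One complex number for each Williamson block. These serve as multipliers and as complex
times; only the imaginary part of an elliptic time and the real part of a hyperbolic time or
multiplier matter. -/
abbrev BlockVector (ke kh kf : ℕ) : Type := Block ke kh kf → ℂ

/-- Multiplication by `a` on `x + i y` in an elliptic block, by `re a` on `x` and `re b` on `y`
in a hyperbolic block, and by `a` on `x₀ + i x₁` and `b` on `y₀ + i y₁` in a focus-focus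
block. -/
def act (a b : BlockVector ke kh kf) (w : TransverseSpace ke kh kf) : TransverseSpace ke kh kf
  | .inl i =>
      ((a (.inl i)).re * (w (.inl i)).1 - (a (.inl i)).im * (w (.inl i)).2,
        (a (.inl i)).im * (w (.inl i)).1 + (a (.inl i)).re * (w (.inl i)).2)
  | .inr (.inl i) =>
      ((a (.inr (.inl i))).re * (w (.inr (.inl i))).1,
        (b (.inr (.inl i))).re * (w (.inr (.inl i))).2)
  | .inr (.inr (i, 0)) =>
      ((a (.inr (.inr i))).re * (w (.inr (.inr (i, 0)))).1 -
          (a (.inr (.inr i))).im * (w (.inr (.inr (i, 1)))).1,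
        (b (.inr (.inr i))).re * (w (.inr (.inr (i, 0)))).2 -
          (b (.inr (.inr i))).im * (w (.inr (.inr (i, 1)))).2)
  | .inr (.inr (i, 1)) =>
      ((a (.inr (.inr i))).im * (w (.inr (.inr (i, 0)))).1 +
          (a (.inr (.inr i))).re * (w (.inr (.inr (i, 1)))).1,
        (b (.inr (.inr i))).im * (w (.inr (.inr (i, 0)))).2 +
          (b (.inr (.inr i))).re * (w (.inr (.inr (i, 1)))).2)

/-- The map `act` as a continuous bilinear map. -/
def actL : (BlockVector ke kh kf × BlockVector ke kh kf) →L[ℝ]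
    TransverseSpace ke kh kf →L[ℝ] TransverseSpace ke kh kf :=
  LinearMap.toContinuousBilinearMap (LinearMap.mk₂ ℝ (fun c w => act c.1 c.2 w)
    (by
      intro c d w
      funext j
      rcases j with i | i | ⟨i, k⟩
      · ext <;> simp [act] <;> ring
      · ext <;> simp [act] <;> ring
      · fin_cases k <;> ext <;> simp [act] <;> ring)
    (by
      intro r c w
      funext j
      rcases j with i | i | ⟨i, k⟩
      · ext <;> simp [act] <;> ring
      · ext <;> simp [act] <;> ring
      · fin_cases k <;> ext <;> simp [act] <;> ring)
    (by
      intro c v w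
      funext j
      rcases j with i | i | ⟨i, k⟩
      · ext <;> simp [act] <;> ring
      · ext <;> simp [act] <;> ring
      · fin_cases k <;> ext <;> simp [act] <;> ring)
    (by
      intro r c w
      funext j
      rcases j with i | i | ⟨i, k⟩
      · ext <;> simp [act] <;> ring
      · ext <;> simp [act] <;> ring
      · fin_cases k <;> ext <;> simp [act] <;> ring))

/-- The composition rule for `act`; hyperbolic multipliers have to be real because `act`
discards their imaginary parts. -/
theorem act_act {a b a' b' : BlockVector ke kh kf}
    (h : ∀ i, (a' (.inr (.inl i))).im = 0 ∧ (b' (.inr (.inl i))).im = 0)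
    (w : TransverseSpace ke kh kf) : act a b (act a' b' w) = act (a * a') (b * b') w := by
  funext j
  rcases j with i | i | ⟨i, k⟩
  · ext <;> simp [act] <;> ring
  · ext <;> simp [act, h i] <;> ring
  · fin_cases k <;> ext <;> simp [act] <;> ring

theorem act_one (w : TransverseSpace ke kh kf) : act 1 1 w = w := by
  funext j
  rcases j with i | i | ⟨i, k⟩
  · ext <;> simp [act]
  · ext <;> simp [act]
  · fin_cases k <;> ext <;> simp [act]

/-- The projection of complex times to the imaginary axis in the elliptic blocks and to the
real axis in the hyperbolic blocks. -/
def effective : BlockVector ke kh kf →ₗ[ℝ] BlockVector ke kh kf where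
  toFun α
    | .inl i => ⟨0, (α (.inl i)).im⟩
    | .inr (.inl i) => ⟨(α (.inr (.inl i))).re, 0⟩
    | .inr (.inr i) => α (.inr (.inr i))
  map_add' α β := by funext j; rcases j with i | i | i <;> simp [Complex.ext_iff]
  map_smul' r α := by funext j; rcases j with i | i | i <;> simp [Complex.ext_iff]

@[simp] theorem effective_inl (α : BlockVector ke kh kf) (i : Fin ke) :
    effective α (.inl i) = ⟨0, (α (.inl i)).im⟩ := rfl

@[simp] theorem effective_inr_inl (α : BlockVector ke kh kf) (i : Fin kh) :
    effective α (.inr (.inl i)) = ⟨(α (.inr (.inl i))).re, 0⟩ := rfl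

@[simp] theorem effective_inr_inr (α : BlockVector ke kh kf) (i : Fin kf) :
    effective α (.inr (.inr i)) = α (.inr (.inr i)) := rfl

/-- The pair of infinitesimal multipliers of the flow. -/
def generator : BlockVector ke kh kf →ₗ[ℝ] BlockVector ke kh kf × BlockVector ke kh kf where
  toFun α := (effective α, fun k => -(starRingEnd ℂ) (effective α k))
  map_add' α β := by
    refine Prod.ext (map_add _ _ _) ?_
    funext k
    simp only [map_add, Pi.add_apply, Prod.mk_add_mk]
    ring
  map_smul' r α := by
    refine Prod.ext (map_smul _ _ _) ?_
    funext k
    simp [map_smul]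

/-- The infinitesimal flow with time `α`, a linear Hamiltonian vector field. -/
def infFlow (α : BlockVector ke kh kf) : TransverseSpace ke kh kf →L[ℝ] TransverseSpace ke kh kf :=
  actL (generator α)

theorem infFlow_apply (α : BlockVector ke kh kf) (w : TransverseSpace ke kh kf) :
    infFlow α w = act (effective α) (fun k => -(starRingEnd ℂ) (effective α k)) w := rfl

/-- The joint flow of the quadratic Hamiltonians: rotations in the elliptic blocks,
`(x, y) ↦ (eᵗ x, e⁻ᵗ y)` in the hyperbolic blocks, and
`(z₁, z₂) ↦ (exp τ • z₁, exp (-conj τ) • z₂)` in the focus-focus blocks. -/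
def flow (α : BlockVector ke kh kf) : TransverseSpace ke kh kf →L[ℝ] TransverseSpace ke kh kf :=
  actL (fun k => Complex.exp (effective α k),
    fun k => Complex.exp (-(starRingEnd ℂ) (effective α k)))

theorem flow_apply (α : BlockVector ke kh kf) (w : TransverseSpace ke kh kf) :
    flow α w = act (fun k => Complex.exp (effective α k))
      (fun k => Complex.exp (-(starRingEnd ℂ) (effective α k))) w := rfl

theorem exp_mk_zero_im (r : ℝ) : (Complex.exp ⟨r, 0⟩).im = 0 ∧
    (Complex.exp (-(starRingEnd ℂ) ⟨r, 0⟩)).im = 0 := by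
  simp [Complex.exp_im]

theorem flow_add (α β : BlockVector ke kh kf) (w : TransverseSpace ke kh kf) :
    flow (α + β) w = flow α (flow β w) := by
  rw [flow_apply, flow_apply, flow_apply, act_act fun i => exp_mk_zero_im _]
  congr 1
  · funext k
    simp [Complex.exp_add]
  · funext k
    simp [Complex.exp_add, add_comm]

theorem flow_zero (w : TransverseSpace ke kh kf) : flow 0 w = w := by
  rw [flow_apply]
  simp only [map_zero, Pi.zero_apply, neg_zero, Complex.exp_zero]
  exact act_one w

theorem infFlow_add (α β : BlockVector ke kh kf) (w : TransverseSpace ke kh kf) :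
    infFlow (α + β) w = infFlow α w + infFlow β w := by
  simp [infFlow]

theorem flow_infFlow (α β : BlockVector ke kh kf) (w : TransverseSpace ke kh kf) :
    flow α (infFlow β w) = infFlow β (flow α w) := by
  rw [flow_apply, flow_apply, infFlow_apply, infFlow_apply, act_act fun i => by simp,
    act_act fun i => exp_mk_zero_im _, mul_comm,
    mul_comm (fun k => -(starRingEnd ℂ) (effective β k))]

/-- The derivative of the flow with respect to time and space. -/
theorem hasFDerivAt_flow {E : Type*} [NormedAddCommGroup E] [NormedSpace ℝ E]
    {α : E → BlockVector ke kh kf} {W : E → TransverseSpace ke kh kf}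
    {α' : E →L[ℝ] BlockVector ke kh kf} {W' : E →L[ℝ] TransverseSpace ke kh kf} {e : E}
    (hα : HasFDerivAt α α' e) (hW : HasFDerivAt W W' e) :
    HasFDerivAt (fun e => flow (α e) (W e)) ((flow (α e)).comp
      (W' + (actL.flip (W e)).comp ((LinearMap.toContinuousLinearMap generator).comp α'))) e := by
  have heff : HasFDerivAt (fun e => effective (α e))
      ((LinearMap.toContinuousLinearMap effective).comp α') e :=
    (LinearMap.toContinuousLinearMap (effective (ke := ke) (kh := kh) (kf := kf))).hasFDerivAt.comp
      e hα
  have hk := hasFDerivAt_pi'.1 heff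
  have h1 : HasFDerivAt (fun e => fun k => Complex.exp (effective (α e) k)) _ e :=
    hasFDerivAt_pi.2 fun k => (hk k).cexp
  have h2 : HasFDerivAt
      (fun e => fun k => Complex.exp (-(starRingEnd ℂ) (effective (α e) k))) _ e :=
    hasFDerivAt_pi.2 fun k =>
      (((Complex.conjCLE : ℂ ≃L[ℝ] ℂ).toContinuousLinearMap.hasFDerivAt.comp e (hk k)).neg).cexp
  have h3 := actL.hasFDerivAt_of_bilinear (h1.prodMk h2) hW
  refine h3.congr_fderiv ?_
  refine ContinuousLinearMap.ext fun v => ?_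
  simp only [ContinuousLinearMap.comp_apply, add_apply, map_add]
  refine congrArg₂ (· + ·) rfl ?_
  change act _ _ (W e) = flow (α e) (infFlow (α' v) (W e))
  rw [flow_apply, infFlow_apply, act_act fun i => by simp]
  rfl

theorem contDiff_flow : ContDiff ℝ ∞
    (fun a : BlockVector ke kh kf × TransverseSpace ke kh kf => flow a.1 a.2) := by
  have heff : ContDiff ℝ ∞ (effective : BlockVector ke kh kf → BlockVector ke kh kf) :=
    (LinearMap.toContinuousLinearMap effective).contDiff
  have h0 : ∀ k, ContDiff ℝ ∞ (fun a : BlockVector ke kh kf × TransverseSpace ke kh kf =>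
      effective a.1 k) := fun k => contDiff_pi.1 (heff.comp contDiff_fst) k
  have h1 : ContDiff ℝ ∞ (fun a : BlockVector ke kh kf × TransverseSpace ke kh kf =>
      fun k => Complex.exp (effective a.1 k)) := contDiff_pi.2 fun k => (h0 k).cexp
  have h2 : ContDiff ℝ ∞ (fun a : BlockVector ke kh kf × TransverseSpace ke kh kf =>
      fun k => Complex.exp (-(starRingEnd ℂ) (effective a.1 k))) := contDiff_pi.2 fun k =>
    ((Complex.conjCLE : ℂ ≃L[ℝ] ℂ).contDiff.comp (h0 k)).neg.cexp
  exact (actL.contDiff.comp (h1.prodMk h2)).clm_apply contDiff_snd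

/-! ### The symplectic form in the transverse directions -/

/-- The symplectic form `∑ dx_j ∧ dy_j` of the transverse space. -/
def transverseForm : TransverseSpace ke kh kf →L[ℝ] TransverseSpace ke kh kf →L[ℝ] ℝ :=
  LinearMap.toContinuousBilinearMap (LinearMap.mk₂ ℝ
    (fun v w => ∑ j, ((v j).1 * (w j).2 - (w j).1 * (v j).2))
    (by
      intro c d w
      rw [← Finset.sum_add_distrib]
      exact Finset.sum_congr rfl fun j _ => by simp; ring)
    (by
      intro r c w
      rw [smul_eq_mul, Finset.mul_sum]
      exact Finset.sum_congr rfl fun j _ => by simp; ring)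
    (by
      intro c v w
      rw [← Finset.sum_add_distrib]
      exact Finset.sum_congr rfl fun j _ => by simp; ring)
    (by
      intro r c w
      rw [smul_eq_mul, Finset.mul_sum]
      exact Finset.sum_congr rfl fun j _ => by simp; ring))

theorem transverseForm_apply (v w : TransverseSpace ke kh kf) :
    transverseForm v w = ∑ j, ((v j).1 * (w j).2 - (w j).1 * (v j).2) := rfl

/-- The symplectic form, sorted by Williamson blocks. -/
theorem transverseForm_eq (v w : TransverseSpace ke kh kf) :
    transverseForm v w =
      ∑ i, ((v (.inl i)).1 * (w (.inl i)).2 - (w (.inl i)).1 * (v (.inl i)).2) +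
      (∑ i, ((v (.inr (.inl i))).1 * (w (.inr (.inl i))).2 -
        (w (.inr (.inl i))).1 * (v (.inr (.inl i))).2) +
      ∑ i, (((v (.inr (.inr (i, 0)))).1 * (w (.inr (.inr (i, 0)))).2 -
        (w (.inr (.inr (i, 0)))).1 * (v (.inr (.inr (i, 0)))).2) +
        ((v (.inr (.inr (i, 1)))).1 * (w (.inr (.inr (i, 1)))).2 -
        (w (.inr (.inr (i, 1)))).1 * (v (.inr (.inr (i, 1)))).2))) := by
  rw [transverseForm_apply, Fintype.sum_sum_type, Fintype.sum_sum_type, Fintype.sum_prod_type]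
  simp only [Fin.sum_univ_two]

theorem symplecticForm_eq (u v : PhaseVector m ke kh kf) :
    symplecticForm u v = ∑ i, (u.1 i * v.2.1 i - v.1 i * u.2.1 i) +
      transverseForm u.2.2 v.2.2 := rfl

/-- The multipliers `(a, b)` for which `act a b` preserves the quadratic Hamiltonians and the
symplectic form. -/
structure IsSystemMultiplier (a b : BlockVector ke kh kf) : Prop where
  elliptic : ∀ i, (a (.inl i)).re * (a (.inl i)).re + (a (.inl i)).im * (a (.inl i)).im = 1
  hyperbolic : ∀ i, (a (.inr (.inl i))).re * (b (.inr (.inl i))).re = 1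
  focus_re : ∀ i, (a (.inr (.inr i))).re * (b (.inr (.inr i))).re +
    (a (.inr (.inr i))).im * (b (.inr (.inr i))).im = 1
  focus_im : ∀ i, (a (.inr (.inr i))).re * (b (.inr (.inr i))).im -
    (a (.inr (.inr i))).im * (b (.inr (.inr i))).re = 0

theorem IsSystemMultiplier.transverseForm_act {a b : BlockVector ke kh kf}
    (h : IsSystemMultiplier a b) (v w : TransverseSpace ke kh kf) :
    transverseForm (act a b v) (act a b w) = transverseForm v w := by
  rw [transverseForm_eq, transverseForm_eq]
  refine congrArg₂ (· + ·) (Finset.sum_congr rfl fun i _ => ?_)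
    (congrArg₂ (· + ·) (Finset.sum_congr rfl fun i _ => ?_)
      (Finset.sum_congr rfl fun i _ => ?_))
  · simp only [act]
    linear_combination ((v (.inl i)).1 * (w (.inl i)).2 - (w (.inl i)).1 * (v (.inl i)).2) *
      h.elliptic i
  · simp only [act]
    linear_combination ((v (.inr (.inl i))).1 * (w (.inr (.inl i))).2 -
        (w (.inr (.inl i))).1 * (v (.inr (.inl i))).2) * h.hyperbolic i
  · simp only [act]
    linear_combination (((v (.inr (.inr (i, 0)))).1 * (w (.inr (.inr (i, 0)))).2 -
        (w (.inr (.inr (i, 0)))).1 * (v (.inr (.inr (i, 0)))).2) +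
        ((v (.inr (.inr (i, 1)))).1 * (w (.inr (.inr (i, 1)))).2 -
        (w (.inr (.inr (i, 1)))).1 * (v (.inr (.inr (i, 1)))).2)) * h.focus_re i +
      ((v (.inr (.inr (i, 1)))).1 * (w (.inr (.inr (i, 0)))).2 -
        (v (.inr (.inr (i, 0)))).1 * (w (.inr (.inr (i, 1)))).2 -
        (w (.inr (.inr (i, 1)))).1 * (v (.inr (.inr (i, 0)))).2 +
        (w (.inr (.inr (i, 0)))).1 * (v (.inr (.inr (i, 1)))).2) * h.focus_im i

theorem IsSystemMultiplier.quadraticMap_act {a b : BlockVector ke kh kf}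
    (h : IsSystemMultiplier a b) (w : TransverseSpace ke kh kf) :
    quadraticMap (act a b w) = quadraticMap w := by
  funext j
  rcases j with i | i | ⟨i, k⟩
  · simp only [act, quadraticMap]
    linear_combination ((w (.inl i)).1 ^ 2 + (w (.inl i)).2 ^ 2) * h.elliptic i
  · simp only [act, quadraticMap]
    linear_combination ((w (.inr (.inl i))).1 * (w (.inr (.inl i))).2) * h.hyperbolic i
  · fin_cases k
    · simp only [act, quadraticMap]
      linear_combination
        ((w (.inr (.inr (i, 0)))).1 * (w (.inr (.inr (i, 1)))).2 -
          (w (.inr (.inr (i, 1)))).1 * (w (.inr (.inr (i, 0)))).2) * h.focus_re i +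
        ((w (.inr (.inr (i, 0)))).1 * (w (.inr (.inr (i, 0)))).2 +
          (w (.inr (.inr (i, 1)))).1 * (w (.inr (.inr (i, 1)))).2) * h.focus_im i
    · simp only [act, quadraticMap]
      linear_combination
        ((w (.inr (.inr (i, 0)))).1 * (w (.inr (.inr (i, 0)))).2 +
          (w (.inr (.inr (i, 1)))).1 * (w (.inr (.inr (i, 1)))).2) * h.focus_re i -
        ((w (.inr (.inr (i, 0)))).1 * (w (.inr (.inr (i, 1)))).2 -
          (w (.inr (.inr (i, 1)))).1 * (w (.inr (.inr (i, 0)))).2) * h.focus_im i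

theorem isSystemMultiplier_flow (α : BlockVector ke kh kf) :
    IsSystemMultiplier (fun k => Complex.exp (effective α k))
      (fun k => Complex.exp (-(starRingEnd ℂ) (effective α k))) := by
  have hE : ∀ x : ℝ, Real.exp x * Real.exp (-x) = 1 := fun x => by
    rw [← Real.exp_add, add_neg_cancel, Real.exp_zero]
  refine ⟨fun i => ?_, fun i => ?_, fun i => ?_, fun i => ?_⟩
  · simp only [effective_inl, Complex.exp_re, Complex.exp_im, Real.exp_zero]
    linear_combination Real.sin_sq_add_cos_sq (α (.inl i)).im
  · simp [Complex.exp_re, hE]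
  · simp only [effective_inr_inr, Complex.exp_re, Complex.exp_im, Complex.neg_re, Complex.neg_im,
      Complex.conj_re, Complex.conj_im, neg_neg]
    linear_combination Real.sin_sq_add_cos_sq (α (.inr (.inr i))).im *
      (Real.exp (α (.inr (.inr i))).re * Real.exp (-(α (.inr (.inr i))).re)) +
      hE (α (.inr (.inr i))).re
  · simp only [effective_inr_inr, Complex.exp_re, Complex.exp_im, Complex.neg_re, Complex.neg_im,
      Complex.conj_re, Complex.conj_im, neg_neg]
    ring

/-- Unit multipliers, real in the hyperbolic blocks, preserve the system. -/
theorem isSystemMultiplier_of_norm {u : BlockVector ke kh kf} (h : ∀ k, ‖u k‖ = 1)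
    (hr : ∀ i, (u (.inr (.inl i))).im = 0) : IsSystemMultiplier u u := by
  have h1 : ∀ k, (u k).re * (u k).re + (u k).im * (u k).im = 1 := fun k => by
    rw [← Complex.normSq_apply, Complex.normSq_eq_norm_sq, h k, one_pow]
  refine ⟨fun i => h1 _, fun i => ?_, fun i => h1 _, fun i => by ring⟩
  have := h1 (.inr (.inl i))
  rw [hr i] at this
  linarith

theorem transverseForm_flow (α : BlockVector ke kh kf) (v w : TransverseSpace ke kh kf) :
    transverseForm (flow α v) (flow α w) = transverseForm v w :=
  (isSystemMultiplier_flow α).transverseForm_act v w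

theorem quadraticMap_flow (α : BlockVector ke kh kf) (w : TransverseSpace ke kh kf) :
    quadraticMap (flow α w) = quadraticMap w :=
  (isSystemMultiplier_flow α).quadraticMap_act w

/-- The quadratic Hamiltonians Poisson commute. -/
theorem transverseForm_infFlow_infFlow (α β : BlockVector ke kh kf)
    (w : TransverseSpace ke kh kf) : transverseForm (infFlow α w) (infFlow β w) = 0 := by
  rw [transverseForm_eq, infFlow_apply, infFlow_apply]
  rw [Finset.sum_eq_zero, Finset.sum_eq_zero, Finset.sum_eq_zero, add_zero, add_zero]
  all_goals
    intro i _
    simp [act]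
    try ring

/-- The infinitesimal flow is Hamiltonian: `Ω(X_α v, w)` is symmetric in `v` and `w`. -/
theorem transverseForm_infFlow_comm (α : BlockVector ke kh kf)
    (v w : TransverseSpace ke kh kf) :
    transverseForm (infFlow α v) w = transverseForm (infFlow α w) v := by
  rw [transverseForm_eq, transverseForm_eq, infFlow_apply, infFlow_apply]
  refine congrArg₂ (· + ·) (Finset.sum_congr rfl fun i _ => ?_)
    (congrArg₂ (· + ·) (Finset.sum_congr rfl fun i _ => ?_)
      (Finset.sum_congr rfl fun i _ => ?_))
  all_goals
    simp [act]
    ring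

/-- The Hamiltonian of the infinitesimal flow is a function of the quadratic Hamiltonians. -/
theorem transverseForm_infFlow_self_congr (α : BlockVector ke kh kf)
    {v w : TransverseSpace ke kh kf} (h : quadraticMap v = quadraticMap w) :
    transverseForm (infFlow α v) v = transverseForm (infFlow α w) w := by
  rw [transverseForm_eq, transverseForm_eq, infFlow_apply, infFlow_apply]
  refine congrArg₂ (· + ·) (Finset.sum_congr rfl fun i _ => ?_)
    (congrArg₂ (· + ·) (Finset.sum_congr rfl fun i _ => ?_)
      (Finset.sum_congr rfl fun i _ => ?_))
  · have h1 := congrFun h (.inl i)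
    simp only [quadraticMap] at h1
    simp [act]
    linear_combination -(α (.inl i)).im * h1
  · have h1 := congrFun h (.inr (.inl i))
    simp only [quadraticMap] at h1
    simp [act]
    linear_combination 2 * (α (.inr (.inl i))).re * h1
  · have h1 := congrFun h (.inr (.inr (i, 0)))
    have h2 := congrFun h (.inr (.inr (i, 1)))
    simp only [quadraticMap] at h1 h2
    simp [act]
    linear_combination 2 * (α (.inr (.inr i))).im * h1 + 2 * (α (.inr (.inr i))).re * h2

/-- The origin is the only common zero of the infinitesimal flows. -/
theorem eq_zero_of_infFlow_eq_zero {w : TransverseSpace ke kh kf}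
    (h : ∀ α : BlockVector ke kh kf, infFlow α w = 0) : w = 0 := by
  have h1 := h (fun k => match k with | .inl _ => Complex.I | .inr _ => 1)
  rw [infFlow_apply] at h1
  funext j
  have h2 := congrFun h1 j
  rcases j with i | i | ⟨i, k⟩
  · simp [act, Prod.ext_iff] at h2
    exact Prod.ext h2.2 h2.1
  · simp [act, Prod.ext_iff] at h2
    exact Prod.ext h2.1 h2.2
  · fin_cases k <;> simp [act, Prod.ext_iff] at h2 <;> exact Prod.ext h2.1 h2.2

theorem symplecticForm_nondegenerate {u : PhaseVector m ke kh kf}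
    (h : ∀ v, symplecticForm u v = 0) : u = 0 := by
  refine Prod.ext ?_ (Prod.ext ?_ ?_)
  · funext i
    simpa [symplecticForm, Pi.single_apply, Finset.sum_sub_distrib] using
      h (0, Pi.single i 1, 0)
  · funext i
    simpa [symplecticForm, Pi.single_apply, Finset.sum_sub_distrib] using
      h (Pi.single i 1, 0, 0)
  · funext j
    refine Prod.ext ?_ ?_
    · have := h (0, 0, Pi.single j (0, 1))
      simp [symplecticForm, Pi.single_apply, apply_ite Prod.fst, apply_ite Prod.snd] at this
      simpa using this
    · have := h (0, 0, Pi.single j (1, 0))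
      simp [symplecticForm, Pi.single_apply, apply_ite Prod.fst, apply_ite Prod.snd] at this
      simpa using this

/-! ### Smooth families of maps and their integrals -/

section Family

open MeasureTheory

variable {EX : Type*} [NormedAddCommGroup EX] [NormedSpace ℝ EX]
  {X : Type*} [TopologicalSpace X] [ChartedSpace EX X]
  {E : Type*} [NormedAddCommGroup E] [NormedSpace ℝ E]
  {F : Type*} [NormedAddCommGroup F] [NormedSpace ℝ F]

/-- A family of maps `f x : E → F`, parametrized by a manifold `X`, which is jointly smooth at
`(x, e)` for all `x ∈ K` and `e ∈ D`. -/
def SmoothFamilyOn (EX : Type*) [NormedAddCommGroup EX] [NormedSpace ℝ EX]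
    {X : Type*} [TopologicalSpace X] [ChartedSpace EX X]
    {E : Type*} [NormedAddCommGroup E] [NormedSpace ℝ E]
    {F : Type*} [NormedAddCommGroup F] [NormedSpace ℝ F]
    (f : X → E → F) (K : Set X) (D : Set E) : Prop :=
  ∀ x ∈ K, ∀ e ∈ D, ContMDiffAt (𝓘(ℝ, EX).prod 𝓘(ℝ, E)) 𝓘(ℝ, F) ∞
    (fun a : X × E => f a.1 a.2) (x, e)

theorem contMDiffAt_prod_self_iff {E' : Type*} [NormedAddCommGroup E'] [NormedSpace ℝ E']
    {f : E' × E → F} {a : E' × E} :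
    ContMDiffAt (𝓘(ℝ, E').prod 𝓘(ℝ, E)) 𝓘(ℝ, F) ∞ f a ↔ ContDiffAt ℝ ∞ f a := by
  rw [← contMDiffAt_iff_contDiffAt, modelWithCornersSelf_prod, ← chartedSpaceSelf_prod]

theorem contDiffAt_chart_of_contMDiffAt [IsManifold 𝓘(ℝ, EX) ∞ X] {f : X → E → F} (x₀ : X)
    {ξ : EX} {e : E} (hξ : ξ ∈ (chartAt EX x₀).target)
    (h : ContMDiffAt (𝓘(ℝ, EX).prod 𝓘(ℝ, E)) 𝓘(ℝ, F) ∞ (fun a : X × E => f a.1 a.2)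
      ((chartAt EX x₀).symm ξ, e)) :
    ContDiffAt ℝ ∞ (fun a : EX × E => f ((chartAt EX x₀).symm a.1) a.2) (ξ, e) := by
  rw [← contMDiffAt_prod_self_iff]
  have h1 : ContMDiffAt 𝓘(ℝ, EX) 𝓘(ℝ, EX) ∞ (chartAt EX x₀).symm ξ :=
    contMDiffOn_chart_symm.contMDiffAt ((chartAt EX x₀).open_target.mem_nhds hξ)
  have h2 : ContMDiffAt (𝓘(ℝ, EX).prod 𝓘(ℝ, E)) (𝓘(ℝ, EX).prod 𝓘(ℝ, E)) ∞
      (fun a : EX × E => ((chartAt EX x₀).symm a.1, a.2)) (ξ, e) :=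
    (ContMDiffAt.comp (I' := 𝓘(ℝ, EX)) (ξ, e) h1 contMDiffAt_fst).prodMk contMDiffAt_snd
  exact ContMDiffAt.comp (g := fun a : X × E => f a.1 a.2) (ξ, e) h h2

theorem contMDiffAt_of_contDiffAt_chart [IsManifold 𝓘(ℝ, EX) ∞ X] {f : X → E → F} {x : X} {e : E}
    (h : ContDiffAt ℝ ∞ (fun a : EX × E => f ((chartAt EX x).symm a.1) a.2)
      (chartAt EX x x, e)) :
    ContMDiffAt (𝓘(ℝ, EX).prod 𝓘(ℝ, E)) 𝓘(ℝ, F) ∞ (fun a : X × E => f a.1 a.2) (x, e) := by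
  rw [← contMDiffAt_prod_self_iff] at h
  have h1 : ContMDiffAt 𝓘(ℝ, EX) 𝓘(ℝ, EX) ∞ (chartAt EX x) x :=
    contMDiffOn_chart.contMDiffAt ((chartAt EX x).open_source.mem_nhds (mem_chart_source EX x))
  have h2 : ContMDiffAt (𝓘(ℝ, EX).prod 𝓘(ℝ, E)) (𝓘(ℝ, EX).prod 𝓘(ℝ, E)) ∞
      (fun a : X × E => (chartAt EX x a.1, a.2)) (x, e) :=
    (ContMDiffAt.comp (I' := 𝓘(ℝ, EX)) (x, e) h1 contMDiffAt_fst).prodMk contMDiffAt_snd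
  refine (ContMDiffAt.comp (x, e) h h2).congr_of_eventuallyEq ?_
  have h3 : ∀ᶠ a : X × E in 𝓝 (x, e), a.1 ∈ (chartAt EX x).source :=
    continuousAt_fst.preimage_mem_nhds
      ((chartAt EX x).open_source.mem_nhds (mem_chart_source EX x))
  filter_upwards [h3] with a ha
  simp [(chartAt EX x).left_inv ha]

namespace SmoothFamilyOn

theorem continuousOn {f : X → E → F} {K : Set X} {D : Set E} (h : SmoothFamilyOn EX f K D) :
    ContinuousOn (fun a : X × E => f a.1 a.2) (K ×ˢ D) := fun a ha =>
  (h a.1 ha.1 a.2 ha.2).continuousAt.continuousWithinAt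

theorem contDiffAt {f : X → E → F} {K : Set X} {D : Set E} (h : SmoothFamilyOn EX f K D)
    {x : X} {e : E} (hx : x ∈ K) (he : e ∈ D) : ContDiffAt ℝ ∞ (f x) e := by
  rw [← contMDiffAt_iff_contDiffAt]
  exact ContMDiffAt.comp (g := fun a : X × E => f a.1 a.2) e (h x hx e he)
    (contMDiffAt_const.prodMk contMDiffAt_id)

theorem hasFDerivAt {f : X → E → F} {K : Set X} {D : Set E} (h : SmoothFamilyOn EX f K D)
    {x : X} {e : E} (hx : x ∈ K) (he : e ∈ D) : HasFDerivAt (f x) (fderiv ℝ (f x) e) e :=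
  ((h.contDiffAt hx he).differentiableAt (by simp)).hasFDerivAt

theorem mono {f : X → E → F} {K : Set X} {D D' : Set E} (h : SmoothFamilyOn EX f K D)
    (hD : D' ⊆ D) : SmoothFamilyOn EX f K D' := fun x hx e he => h x hx e (hD he)

/-- Composition of a smooth family with a smooth family of maps between the domains. -/
theorem comp_left {E' : Type*} [NormedAddCommGroup E'] [NormedSpace ℝ E'] {f : X → E → F}
    {h : X → E' → E} {K : Set X} {D : Set E} {D' : Set E'} (hf : SmoothFamilyOn EX f K D)
    (hh : SmoothFamilyOn EX h K D') (hm : ∀ x ∈ K, ∀ e ∈ D', h x e ∈ D) :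
    SmoothFamilyOn EX (fun x e => f x (h x e)) K D' := fun x hx e he =>
  ContMDiffAt.comp (g := fun a : X × E => f a.1 a.2) (x, e) (hf x hx _ (hm x hx e he))
    (contMDiffAt_fst.prodMk (hh x hx e he))

theorem postcomp {F' : Type*} [NormedAddCommGroup F'] [NormedSpace ℝ F'] {f : X → E → F}
    {K : Set X} {D : Set E} (hf : SmoothFamilyOn EX f K D) {φ : F → F'}
    (hφ : ∀ x ∈ K, ∀ e ∈ D, ContDiffAt ℝ ∞ φ (f x e)) :
    SmoothFamilyOn EX (fun x e => φ (f x e)) K D := fun x hx e he =>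
  ContMDiffAt.comp (g := φ) (I' := 𝓘(ℝ, F)) (x, e) (hφ x hx e he).contMDiffAt (hf x hx e he)

theorem prodMk {F' : Type*} [NormedAddCommGroup F'] [NormedSpace ℝ F'] {f : X → E → F}
    {f' : X → E → F'} {K : Set X} {D : Set E} (hf : SmoothFamilyOn EX f K D)
    (hf' : SmoothFamilyOn EX f' K D) : SmoothFamilyOn EX (fun x e => (f x e, f' x e)) K D :=
  fun x hx e he => (hf x hx e he).prodMk_space (hf' x hx e he)

theorem pi {ι : Type*} [Fintype ι] {F' : ι → Type*} [∀ i, NormedAddCommGroup (F' i)]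
    [∀ i, NormedSpace ℝ (F' i)] {f : X → E → ∀ i, F' i} {K : Set X} {D : Set E}
    (hf : ∀ i, SmoothFamilyOn EX (fun x e => f x e i) K D) : SmoothFamilyOn EX f K D :=
  fun x hx e he => contMDiffAt_pi_space.2 fun i => hf i x hx e he

theorem of_contDiff {φ : E → F} (hφ : ContDiff ℝ ∞ φ) (K : Set X) (D : Set E) :
    SmoothFamilyOn EX (fun (_ : X) e => φ e) K D := fun x _ e _ =>
  ContMDiffAt.comp (g := φ) (I' := 𝓘(ℝ, E)) (x, e) hφ.contMDiff.contMDiffAt contMDiffAt_snd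

theorem fderiv [IsManifold 𝓘(ℝ, EX) ∞ X] {f : X → E → F} {K : Set X} {D : Set E}
    (h : SmoothFamilyOn EX f K D) : SmoothFamilyOn EX (fun x e => fderiv ℝ (f x) e) K D := by
  intro x hx e he
  refine contMDiffAt_of_contDiffAt_chart (f := fun x e => _root_.fderiv ℝ (f x) e) ?_
  have h1 := contDiffAt_chart_of_contMDiffAt x (mem_chart_target EX x)
    ((chartAt EX x).left_inv (mem_chart_source EX x) ▸ h x hx e he)
  have h2 : ContDiffAt ℝ ∞ (Function.uncurry fun (a : EX × E) (y : E) =>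
      f ((chartAt EX x).symm a.1) y) ((chartAt EX x x, e), e) :=
    ContDiffAt.comp (g := fun a : EX × E => f ((chartAt EX x).symm a.1) a.2)
      ((chartAt EX x x, e), e) h1
      ((contDiffAt_fst.comp _ contDiffAt_fst).prodMk contDiffAt_snd)
  exact ContDiffAt.fderiv (f := fun (a : EX × E) (y : E) => f ((chartAt EX x).symm a.1) y)
    (g := Prod.snd) (n := ∞) h2 contDiffAt_snd (by simp)

section Integral

variable [MeasurableSpace X] [BorelSpace X] [T2Space X] {μ : Measure X}
  [IsFiniteMeasureOnCompacts μ]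

theorem integrableOn {f : X → E → F} {K : Set X} {D : Set E} (h : SmoothFamilyOn EX f K D)
    (hK : IsCompact K) {e : E} (he : e ∈ D) : IntegrableOn (fun x => f x e) K μ :=
  ContinuousOn.integrableOn_compact hK <|
    h.continuousOn.comp (f := fun x : X => (x, e)) (by fun_prop) fun _ hx => ⟨hx, he⟩

/-- Differentiation under the integral sign over a compact set of parameters. -/
theorem hasFDerivAt_integral [FiniteDimensional ℝ E] [IsManifold 𝓘(ℝ, EX) ∞ X]
    {f : X → E → F} {K : Set X} {D : Set E}
    (h : SmoothFamilyOn EX f K D) (hK : IsCompact K) (hD : IsOpen D) {e : E} (he : e ∈ D) :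
    HasFDerivAt (fun e => ∫ x in K, f x e ∂μ) (∫ x in K, _root_.fderiv ℝ (f x) e ∂μ) e := by
  obtain ⟨δ, hδ, hball⟩ := Metric.nhds_basis_closedBall.mem_iff.1 (hD.mem_nhds he)
  have hcpt : IsCompact (K ×ˢ Metric.closedBall e δ) :=
    hK.prod (by have := FiniteDimensional.proper ℝ E; exact isCompact_closedBall e δ)
  obtain ⟨C, hC⟩ := hcpt.exists_bound_of_continuousOn
    (h.fderiv.continuousOn.mono (Set.prod_mono_right hball))
  refine hasFDerivAt_integral_of_dominated_of_fderiv_le (𝕜 := ℝ)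
    (F' := fun e x => _root_.fderiv ℝ (f x) e) (bound := fun _ => C)
    (Metric.closedBall_mem_nhds e hδ) ?_ ?_ ?_ ?_ ?_ ?_
  · filter_upwards [hD.mem_nhds he] with y hy
    exact (h.integrableOn hK hy).aestronglyMeasurable
  · exact h.integrableOn hK he
  · exact (h.fderiv.integrableOn hK he).aestronglyMeasurable
  · filter_upwards [ae_restrict_mem hK.measurableSet] with x hx y hy
    exact hC (x, y) ⟨hx, hy⟩
  · exact integrableOn_const hK.measure_lt_top.ne
  · filter_upwards [ae_restrict_mem hK.measurableSet] with x hx y hy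
    exact h.hasFDerivAt hx (hball hy)

theorem contDiffOn_integral [FiniteDimensional ℝ E] [IsManifold 𝓘(ℝ, EX) ∞ X] [CompleteSpace F]
    {f : X → E → F} {K : Set X} {D : Set E}
    (h : SmoothFamilyOn EX f K D) (hK : IsCompact K) (hD : IsOpen D) :
    ContDiffOn ℝ ∞ (fun e => ∫ x in K, f x e ∂μ) D := by
  refine contDiffOn_infty.2 fun n => ?_
  induction n generalizing f with
  | zero =>
    exact contDiffOn_zero.2 fun e he =>
      (h.hasFDerivAt_integral hK hD he).continuousAt.continuousWithinAt
  | succ n ih =>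
    rw [Nat.cast_add, Nat.cast_one, contDiffOn_succ_iff_fderiv_apply hD.uniqueDiffOn]
    refine ⟨fun e he => (h.hasFDerivAt_integral hK hD he).differentiableAt.differentiableWithinAt,
      by simp, fun y => ?_⟩
    have h1 : SmoothFamilyOn EX (fun x e => _root_.fderiv ℝ (f x) e y) K D :=
      h.fderiv.postcomp (φ := fun L : E →L[ℝ] F => L y) fun x _ e _ =>
        (ContinuousLinearMap.apply ℝ F y).contDiff.contDiffAt
    refine (ih h1).congr fun e he => ?_
    rw [fderivWithin_of_isOpen hD he, (h.hasFDerivAt_integral hK hD he).fderiv]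
    exact ContinuousLinearMap.integral_apply (h.fderiv.integrableOn hK he) y

end Integral

/-- The integral of a smooth family over a compact interval of a real parameter is smooth. -/
theorem intervalIntegral [IsManifold 𝓘(ℝ, EX) ∞ X] [FiniteDimensional ℝ E]
    [FiniteDimensional ℝ EX] [CompleteSpace F]
    {f : X → E × ℝ → F} {K : Set X} {D : Set E} (hD : IsOpen D)
    (h : SmoothFamilyOn EX f Set.univ (D ×ˢ Set.Icc 0 1)) :
    SmoothFamilyOn EX (fun x e => ∫ s in (0 : ℝ)..1, f x (e, s)) K D := by
  intro x _ e he
  refine contMDiffAt_of_contDiffAt_chart (f := fun x e => ∫ s in (0 : ℝ)..1, f x (e, s)) ?_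
  have h1 : SmoothFamilyOn ℝ (fun (s : ℝ) (a : EX × E) => f ((chartAt EX x).symm a.1) (a.2, s))
      (Set.Icc 0 1) ((chartAt EX x).target ×ˢ D) := by
    intro s hs a ha
    have h2 := contDiffAt_chart_of_contMDiffAt x ha.1
      (h ((chartAt EX x).symm a.1) trivial (a.2, s) ⟨ha.2, hs⟩)
    rw [contMDiffAt_prod_self_iff]
    exact ContDiffAt.comp
      (g := fun a : EX × (E × ℝ) => f ((chartAt EX x).symm a.1) a.2) (s, a) h2
      (f := fun b : ℝ × (EX × E) => (b.2.1, (b.2.2, b.1))) (by fun_prop)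
  have h3 := h1.contDiffOn_integral (μ := volume) isCompact_Icc
    ((chartAt EX x).open_target.prod hD)
  have h4 := h3.contDiffAt (((chartAt EX x).open_target.prod hD).mem_nhds
    (Set.mk_mem_prod (mem_chart_target EX x) he))
  simpa only [intervalIntegral.integral_of_le zero_le_one, integral_Icc_eq_integral_Ioc] using h4

end SmoothFamilyOn

end Family

/-! ### Maps preserving the system commute with the Hamiltonian flows -/

/-- The coordinates `(p, w)` on the quotient of the phase space by the translations of the
torus. -/
abbrev BaseSpace (m ke kh kf : ℕ) : Type := (Fin m → ℝ) × TransverseSpace ke kh kf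

theorem hasFDerivAt_hamiltonian (α : BlockVector ke kh kf) (w : TransverseSpace ke kh kf) :
    HasFDerivAt (fun w => transverseForm (infFlow α w) w)
      ((2 : ℝ) • transverseForm (infFlow α w)) w := by
  have h := transverseForm.hasFDerivAt_of_bilinear (infFlow α).hasFDerivAt (hasFDerivAt_id w)
  refine h.congr_fderiv (ContinuousLinearMap.ext fun v => ?_)
  change transverseForm (infFlow α w) v + transverseForm (infFlow α v) w = 2 * _
  rw [transverseForm_infFlow_comm α v w]
  exact (two_mul _).symm

/-- A map preserving the system preserves its Hamiltonian vector fields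
`∑ ηᵢ ∂/∂qᵢ + X_α`. -/
theorem PreservesSystem.mfderiv_apply {U : Set (PhaseSpace m ke kh kf)} (hU : IsOpen U)
    {f : PhaseSpace m ke kh kf → PhaseSpace m ke kh kf} (hf : PreservesSystem U f)
    {z : PhaseSpace m ke kh kf} (hz : z ∈ U)
    (hd : MDifferentiableAt (phaseModel m ke kh kf) (phaseModel m ke kh kf) f z)
    (η : Fin m → ℝ) (α : BlockVector ke kh kf) :
    mfderiv (phaseModel m ke kh kf) (phaseModel m ke kh kf) f z
      ((0, η, infFlow α z.2.2) : PhaseVector m ke kh kf) =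
      ((0, η, infFlow α (f z).2.2) : PhaseVector m ke kh kf) := by
  have hD := hd.hasMFDerivAt
  obtain ⟨D, hDdef⟩ : ∃ D : PhaseVector m ke kh kf →L[ℝ] PhaseVector m ke kh kf,
    D = mfderiv (phaseModel m ke kh kf) (phaseModel m ke kh kf) f z := ⟨_, rfl⟩
  have hω : ∀ u v, symplecticForm (D u) (D v) = symplecticForm u v := fun u v => by
    rw [hDdef]; exact (hf z hz).2 u v
  rw [← hDdef] at hD
  suffices h : D (0, η, infFlow α z.2.2) = (0, η, infFlow α (f z).2.2) by
    rw [hDdef] at h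
    exact h
  have hev : ∀ᶠ y in 𝓝 z, momentMap (f y) = momentMap y :=
    Filter.eventually_of_mem (hU.mem_nhds hz) fun y hy => (hf y hy).1
  have h1 : ∀ v, (D v).1 = v.1 := by
    have a1 : HasMFDerivAt (phaseModel m ke kh kf) 𝓘(ℝ, Fin m → ℝ)
        (fun y : PhaseSpace m ke kh kf => y.1) z
        (ContinuousLinearMap.fst ℝ (Fin m → ℝ) _) := hasMFDerivAt_fst z
    have a2 : HasMFDerivAt (phaseModel m ke kh kf) 𝓘(ℝ, Fin m → ℝ)
        (fun y : PhaseSpace m ke kh kf => (f y).1) z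
        ((ContinuousLinearMap.fst ℝ (Fin m → ℝ)
          ((Fin m → ℝ) × TransverseSpace ke kh kf)).comp D) :=
      (hasMFDerivAt_fst (f z)).comp z hD
    have a3 := hasMFDerivAt_unique a2 (a1.congr_of_eventuallyEq (by
      filter_upwards [hev] with y hy using (Prod.ext_iff.1 hy).1))
    exact fun v => congrArg (fun L : PhaseVector m ke kh kf →L[ℝ] (Fin m → ℝ) => L v) a3
  have h2 : ∀ v, transverseForm (infFlow α (f z).2.2) (D v).2.2 =
      transverseForm (infFlow α z.2.2) v.2.2 := by
    have a0 : ∀ y : PhaseSpace m ke kh kf, HasMFDerivAt (phaseModel m ke kh kf) 𝓘(ℝ, ℝ)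
        (fun y : PhaseSpace m ke kh kf => transverseForm (infFlow α y.2.2) y.2.2) y
        (((2 : ℝ) • transverseForm (infFlow α y.2.2)).comp
          ((ContinuousLinearMap.snd ℝ (Fin m → ℝ) (TransverseSpace ke kh kf)).comp
          (ContinuousLinearMap.snd ℝ (Fin m → ℝ)
            ((Fin m → ℝ) × TransverseSpace ke kh kf)))) := fun y =>
      HasMFDerivAt.comp (I' := 𝓘(ℝ, TransverseSpace ke kh kf))
        (g := fun w => transverseForm (infFlow α w) w)
        (f := fun y : PhaseSpace m ke kh kf => y.2.2) y
        (hasFDerivAt_hamiltonian α y.2.2).hasMFDerivAt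
        ((hasMFDerivAt_snd y.2).comp y (hasMFDerivAt_snd y))
    have a3 := hasMFDerivAt_unique ((a0 (f z)).comp z hD) ((a0 z).congr_of_eventuallyEq (by
      filter_upwards [hev] with y hy
      exact transverseForm_infFlow_self_congr α (Prod.ext_iff.1 hy).2))
    intro v
    have a4 : (2 : ℝ) * transverseForm (infFlow α (f z).2.2) (D v).2.2 =
      2 * transverseForm (infFlow α z.2.2) v.2.2 :=
      congrArg (fun L : PhaseVector m ke kh kf →L[ℝ] ℝ => L v) a3
    linarith
  -- The derivative is symplectic, hence injective, hence surjective.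
  have hinj : Function.Injective D := by
    refine (injective_iff_map_eq_zero D).2 fun u hu => symplecticForm_nondegenerate fun v => ?_
    rw [← hω, hu]
    simp [symplecticForm]
  have hsurj : Function.Surjective D := LinearMap.injective_iff_surjective.1 hinj
  have h3 : ∀ u v w : PhaseVector m ke kh kf,
      symplecticForm (u - v) w = symplecticForm u w - symplecticForm v w := by
    intro u v w
    rw [symplecticForm_eq, symplecticForm_eq, symplecticForm_eq, Prod.snd_sub, Prod.snd_sub,
      map_sub, sub_apply, add_sub_add_comm, ← Finset.sum_sub_distrib]
    congr 1
    refine Finset.sum_congr rfl fun i _ => ?_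
    simp only [Prod.fst_sub, Pi.sub_apply]
    ring
  refine sub_eq_zero.1 (symplecticForm_nondegenerate fun v => ?_)
  obtain ⟨v, rfl⟩ := hsurj v
  rw [h3, hω, symplecticForm_eq, symplecticForm_eq]
  simp only [h1, h2]
  simp

theorem exists_ball_subset {U : Set (PhaseSpace m ke kh kf)} (hU : IsOpen U)
    (hLU : centralTorus m ke kh kf ⊆ U) :
    ∃ r > 0, ∀ e ∈ Metric.ball (0 : BaseSpace m ke kh kf) r, ∀ q : Torus m,
      ((e.1, q, e.2) : PhaseSpace m ke kh kf) ∈ U := by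
  have hc : Continuous (fun a : BaseSpace m ke kh kf × Torus m =>
    ((a.1.1, a.2, a.1.2) : PhaseSpace m ke kh kf)) := by fun_prop
  obtain ⟨u, v, hu, -, h0, hv, huv⟩ := generalized_tube_lemma (isCompact_singleton (x := 0))
    isCompact_univ (hU.preimage hc) (by
      rintro ⟨e, q⟩ ⟨he, -⟩
      rw [Set.mem_singleton_iff] at he
      subst he
      exact hLU ⟨rfl, rfl⟩)
  obtain ⟨r, hr, hb⟩ := Metric.isOpen_iff.1 hu 0 (h0 rfl)
  exact ⟨r, hr, fun e he q => @huv (e, q) ⟨hb he, hv trivial⟩⟩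

/-! ### Reduction by the translations of the torus -/

/-- The transverse component of a map along the slice `q = 0`. -/
def transversePart (f : PhaseSpace m ke kh kf → PhaseSpace m ke kh kf)
    (e : BaseSpace m ke kh kf) : TransverseSpace ke kh kf := (f (e.1, 0, e.2)).2.2

/-- The torus component of a map along the slice `q = 0`. -/
def torusPart (f : PhaseSpace m ke kh kf → PhaseSpace m ke kh kf)
    (e : BaseSpace m ke kh kf) : Torus m := (f (e.1, 0, e.2)).2.1

/-- A map preserving the system commutes with the translations of the torus. -/
theorem PreservesSystem.apply_eq {U : Set (PhaseSpace m ke kh kf)} (hU : IsOpen U)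
    {f : PhaseSpace m ke kh kf → PhaseSpace m ke kh kf} (hf : PreservesSystem U f)
    (hd : ∀ z ∈ U, MDifferentiableAt (phaseModel m ke kh kf) (phaseModel m ke kh kf) f z)
    {e : BaseSpace m ke kh kf} (he : ∀ q, ((e.1, q, e.2) : PhaseSpace m ke kh kf) ∈ U)
    (q : Torus m) : f (e.1, q, e.2) = (e.1, q + torusPart f e, transversePart f e) := by
  obtain ⟨v, rfl⟩ := Torus.proj_surjective m q
  have hline : ∀ s : ℝ, HasMFDerivAt 𝓘(ℝ, ℝ) (phaseModel m ke kh kf)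
      (fun s : ℝ => f (e.1, Torus.proj m (s • v), e.2)) s
      (ContinuousLinearMap.toSpanSingleton ℝ ((0, v, 0) : PhaseVector m ke kh kf)) := by
    intro s
    have h1 : HasFDerivAt (fun s : ℝ => ((e.1, s • v, e.2) : PhaseVector m ke kh kf))
        (ContinuousLinearMap.toSpanSingleton ℝ ((0, v, 0) : PhaseVector m ke kh kf)) s := by
      have := (hasDerivAt_const s e.1).prodMk
        (((hasDerivAt_id s).smul_const v).prodMk (hasDerivAt_const s e.2))
      rw [one_smul] at this
      exact this.hasFDerivAt
    have h2 := HasMFDerivAt.comp s (hasMFDerivAt_cover (e.1, s • v, e.2)) h1.hasMFDerivAt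
    have h3 := HasMFDerivAt.comp s (hd (e.1, Torus.proj m (s • v), e.2) (he _)).hasMFDerivAt h2
    have h4 := hf.mfderiv_apply hU (he (Torus.proj m (s • v)))
      (hd (e.1, Torus.proj m (s • v), e.2) (he _)) v 0
    rw [show infFlow (0 : BlockVector ke kh kf) = 0 by simp [infFlow], zero_apply,
      zero_apply] at h4
    have h5 : ∀ D : PhaseVector m ke kh kf →L[ℝ] PhaseVector m ke kh kf,
        D (0, v, 0) = (0, v, 0) → D.comp ((ContinuousLinearMap.id ℝ _).comp
        (ContinuousLinearMap.toSpanSingleton ℝ ((0, v, 0) : PhaseVector m ke kh kf))) =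
        ContinuousLinearMap.toSpanSingleton ℝ ((0, v, 0) : PhaseVector m ke kh kf) := by
      intro D hD
      ext1
      simpa using hD
    exact (h5 _ h4) ▸ h3
  refine Prod.ext ?_ (Prod.ext ?_ ?_)
  · exact (Prod.ext_iff.1 (hf _ (he (Torus.proj m v))).1).1
  · have h1 := Torus.eq_add_proj_of_hasMFDerivAt
      (γ := fun s : ℝ => (f (e.1, Torus.proj m (s • v), e.2)).2.1) (v := v) (fun s => by
        have h2 := ((hasMFDerivAt_fst (I := 𝓘(ℝ, Fin m → ℝ))
          (I' := 𝓘(ℝ, TransverseSpace ke kh kf)) _).comp _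
          (hasMFDerivAt_snd (f (e.1, Torus.proj m (s • v), e.2)))).comp s (hline s)
        refine h2.congr_mfderiv ?_
        ext1
        rfl) 1
    simp only [one_smul, zero_smul, Torus.proj_zero] at h1
    rw [h1, add_comm]
    rfl
  · have h1 : ∀ s : ℝ, HasDerivAt (fun s : ℝ => (f (e.1, Torus.proj m (s • v), e.2)).2.2) 0 s := by
      intro s
      have h2 := ((hasMFDerivAt_snd (I := 𝓘(ℝ, Fin m → ℝ))
          (I' := 𝓘(ℝ, TransverseSpace ke kh kf)) _).comp _
          (hasMFDerivAt_snd (f (e.1, Torus.proj m (s • v), e.2)))).comp s (hline s)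
      have h3 : HasFDerivAt (fun s : ℝ => (f (e.1, Torus.proj m (s • v), e.2)).2.2)
        (((ContinuousLinearMap.snd ℝ (Fin m → ℝ) (TransverseSpace ke kh kf)).comp
          (ContinuousLinearMap.snd ℝ (Fin m → ℝ)
            ((Fin m → ℝ) × TransverseSpace ke kh kf))).comp
          (ContinuousLinearMap.toSpanSingleton ℝ ((0, v, 0) : PhaseVector m ke kh kf))) s :=
        h2.hasFDerivAt
      simpa using h3.hasDerivAt
    have h4 := is_const_of_deriv_eq_zero (fun s => (h1 s).differentiableAt)
      (fun s => (h1 s).deriv) 1 0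
    simp only [one_smul, zero_smul, Torus.proj_zero] at h4
    exact h4

theorem PreservesSystem.quadraticMap_transversePart {U : Set (PhaseSpace m ke kh kf)}
    {f : PhaseSpace m ke kh kf → PhaseSpace m ke kh kf} (hf : PreservesSystem U f)
    {e : BaseSpace m ke kh kf} (he : ((e.1, 0, e.2) : PhaseSpace m ke kh kf) ∈ U) :
    quadraticMap (transversePart f e) = quadraticMap e.2 :=
  (Prod.ext_iff.1 (hf _ he).1).2

/-- The transverse component of a map preserving the system is infinitesimally equivariant
under the flows of the quadratic Hamiltonians. -/
theorem PreservesSystem.fderiv_transversePart {U : Set (PhaseSpace m ke kh kf)} (hU : IsOpen U)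
    {f : PhaseSpace m ke kh kf → PhaseSpace m ke kh kf} (hf : PreservesSystem U f)
    {e : BaseSpace m ke kh kf} (he : ((e.1, 0, e.2) : PhaseSpace m ke kh kf) ∈ U)
    (hd : MDifferentiableAt (phaseModel m ke kh kf) (phaseModel m ke kh kf) f (e.1, 0, e.2))
    (α : BlockVector ke kh kf) :
    fderiv ℝ (transversePart f) e (0, infFlow α e.2) = infFlow α (transversePart f e) := by
  have h1 : HasFDerivAt (fun e : BaseSpace m ke kh kf => ((e.1, 0, e.2) : PhaseVector m ke kh kf))
      ((ContinuousLinearMap.fst ℝ _ _).prod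
        ((0 : BaseSpace m ke kh kf →L[ℝ] (Fin m → ℝ)).prod (ContinuousLinearMap.snd ℝ _ _))) e :=
    hasFDerivAt_fst.prodMk ((hasFDerivAt_const (0 : Fin m → ℝ) e).prodMk hasFDerivAt_snd)
  have h2 := HasMFDerivAt.comp e (hasMFDerivAt_cover (e.1, 0, e.2)) h1.hasMFDerivAt
  have h3 := HasMFDerivAt.comp e hd.hasMFDerivAt h2
  have h4 := ((hasMFDerivAt_snd (I := 𝓘(ℝ, Fin m → ℝ))
          (I' := 𝓘(ℝ, TransverseSpace ke kh kf)) _).comp _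
          (hasMFDerivAt_snd (f (e.1, 0, e.2)))).comp e h3
  obtain ⟨D, hDdef⟩ : ∃ D : PhaseVector m ke kh kf →L[ℝ] PhaseVector m ke kh kf,
    D = mfderiv (phaseModel m ke kh kf) (phaseModel m ke kh kf) f (e.1, 0, e.2) := ⟨_, rfl⟩
  have h5 := hf.mfderiv_apply hU he hd 0 α
  have h6 : HasFDerivAt (transversePart f)
      (((ContinuousLinearMap.snd ℝ (Fin m → ℝ) (TransverseSpace ke kh kf)).comp
          (ContinuousLinearMap.snd ℝ (Fin m → ℝ)
            ((Fin m → ℝ) × TransverseSpace ke kh kf))).comp (D.comp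
          ((ContinuousLinearMap.id ℝ (PhaseVector m ke kh kf)).comp
            ((ContinuousLinearMap.fst ℝ _ _).prod
        ((0 : BaseSpace m ke kh kf →L[ℝ] (Fin m → ℝ)).prod
          (ContinuousLinearMap.snd ℝ _ _)))))) e := by
    rw [hDdef]
    exact h4.hasFDerivAt
  have h7 : D (0, 0, infFlow α e.2) = (0, 0, infFlow α (transversePart f e)) := by
    rw [hDdef]
    exact h5
  rw [h6.fderiv]
  simp only [ContinuousLinearMap.comp_apply, ContinuousLinearMap.prod_apply,
    ContinuousLinearMap.id_apply, ContinuousLinearMap.coe_fst', ContinuousLinearMap.coe_snd',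
    zero_apply, h7]

theorem transversePart_eq_zero {f : PhaseSpace m ke kh kf → PhaseSpace m ke kh kf}
    {p : Fin m → ℝ}
    (h : ∀ α : BlockVector ke kh kf, fderiv ℝ (transversePart f) (p, 0)
      (0, infFlow α (0 : TransverseSpace ke kh kf)) = infFlow α (transversePart f (p, 0))) :
    transversePart f (p, 0) = 0 := by
  refine eq_zero_of_infFlow_eq_zero fun α => ?_
  rw [← h α, map_zero]
  exact map_zero _

section Action

variable {EG : Type*} [NormedAddCommGroup EG] [NormedSpace ℝ EG]
  {G : Type*} [TopologicalSpace G] [ChartedSpace EG G] [Group G]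
  {U : Set (PhaseSpace m ke kh kf)} {ρ : G → PhaseSpace m ke kh kf → PhaseSpace m ke kh kf}

theorem IsSystemAction.contMDiffAt (hρ : IsSystemAction (EG := EG) U ρ) (hU : IsOpen U) (g : G)
    {z : PhaseSpace m ke kh kf} (hz : z ∈ U) :
    ContMDiffAt ((𝓘(ℝ, EG)).prod (phaseModel m ke kh kf)) (phaseModel m ke kh kf) ∞
      (fun a : G × PhaseSpace m ke kh kf => ρ a.1 a.2) (g, z) :=
  hρ.smooth.contMDiffAt ((isOpen_univ.prod hU).mem_nhds ⟨trivial, hz⟩)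

theorem IsSystemAction.mdifferentiableAt (hρ : IsSystemAction (EG := EG) U ρ) (hU : IsOpen U)
    (g : G) {z : PhaseSpace m ke kh kf} (hz : z ∈ U) :
    MDifferentiableAt (phaseModel m ke kh kf) (phaseModel m ke kh kf) (ρ g) z :=
  (ContMDiffAt.comp (g := fun a : G × PhaseSpace m ke kh kf => ρ a.1 a.2) z
    (hρ.contMDiffAt hU g hz) (contMDiffAt_const.prodMk contMDiffAt_id)).mdifferentiableAt
    (by simp)

theorem IsSystemAction.contMDiffAt_slice (hρ : IsSystemAction (EG := EG) U ρ) (hU : IsOpen U)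
    (g : G) {e : BaseSpace m ke kh kf} (he : ((e.1, 0, e.2) : PhaseSpace m ke kh kf) ∈ U) :
    ContMDiffAt ((𝓘(ℝ, EG)).prod 𝓘(ℝ, BaseSpace m ke kh kf)) (phaseModel m ke kh kf) ∞
      (fun a : G × BaseSpace m ke kh kf => ρ a.1 (a.2.1, 0, a.2.2)) (g, e) := by
  have h1 : ContMDiffAt ((𝓘(ℝ, EG)).prod 𝓘(ℝ, BaseSpace m ke kh kf)) (phaseModel m ke kh kf) ∞
      (fun a : G × BaseSpace m ke kh kf =>
        ((a.2.1, 0, a.2.2) : PhaseSpace m ke kh kf)) (g, e) :=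
    ContMDiffAt.comp (I' := 𝓘(ℝ, PhaseVector m ke kh kf)) (g, e)
      (contMDiff_cover.contMDiffAt (x := (e.1, 0, e.2)))
      (ContMDiffAt.comp (I' := 𝓘(ℝ, BaseSpace m ke kh kf)) (g, e)
        (g := fun e : BaseSpace m ke kh kf => ((e.1, 0, e.2) : PhaseVector m ke kh kf))
        (ContDiff.contMDiff (by fun_prop)).contMDiffAt contMDiffAt_snd)
  exact ContMDiffAt.comp (g := fun a : G × PhaseSpace m ke kh kf => ρ a.1 a.2) (g, e)
    (hρ.contMDiffAt hU g he) (contMDiffAt_fst.prodMk h1)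

theorem IsSystemAction.smoothFamilyOn_transversePart (hρ : IsSystemAction (EG := EG) U ρ)
    (hU : IsOpen U) {D : Set (BaseSpace m ke kh kf)}
    (hD : ∀ e ∈ D, ((e.1, 0, e.2) : PhaseSpace m ke kh kf) ∈ U) :
    SmoothFamilyOn EG (fun g => transversePart (ρ g)) Set.univ D := fun g _ e he =>
  ContMDiffAt.comp (I' := phaseModel m ke kh kf)
    (g := fun z : PhaseSpace m ke kh kf => z.2.2) (g, e)
    ((contMDiff_snd.comp contMDiff_snd).contMDiffAt) (hρ.contMDiffAt_slice hU g (hD e he))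

theorem IsSystemAction.contMDiffAt_torusPart (hρ : IsSystemAction (EG := EG) U ρ)
    (hU : IsOpen U) (g : G) {e : BaseSpace m ke kh kf}
    (he : ((e.1, 0, e.2) : PhaseSpace m ke kh kf) ∈ U) :
    ContMDiffAt ((𝓘(ℝ, EG)).prod 𝓘(ℝ, BaseSpace m ke kh kf)) 𝓘(ℝ, Fin m → ℝ) ∞
      (fun a : G × BaseSpace m ke kh kf => torusPart (ρ a.1) a.2) (g, e) :=
  ContMDiffAt.comp (I' := phaseModel m ke kh kf)
    (g := fun z : PhaseSpace m ke kh kf => z.2.1) (g, e)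
    ((contMDiff_fst.comp contMDiff_snd).contMDiffAt) (hρ.contMDiffAt_slice hU g he)

end Action

/-! ### Leading coordinates and their multipliers -/

/-- The leading complex coordinate of each block: `x + i y` for an elliptic block, `x` for a
hyperbolic block, `x₀ + i x₁` for a focus-focus block. -/
def lead : TransverseSpace ke kh kf →L[ℝ] BlockVector ke kh kf :=
  LinearMap.toContinuousLinearMap
    { toFun := fun w k => match k with
        | .inl i => ⟨(w (.inl i)).1, (w (.inl i)).2⟩
        | .inr (.inl i) => ⟨(w (.inr (.inl i))).1, 0⟩
        | .inr (.inr i) => ⟨(w (.inr (.inr (i, 0)))).1, (w (.inr (.inr (i, 1)))).1⟩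
      map_add' := fun v w => by funext k; rcases k with i | i | i <;> simp [Complex.ext_iff]
      map_smul' := fun r w => by funext k; rcases k with i | i | i <;> simp [Complex.ext_iff] }

@[simp] theorem lead_inl (w : TransverseSpace ke kh kf) (i : Fin ke) :
    lead w (.inl i) = ⟨(w (.inl i)).1, (w (.inl i)).2⟩ := rfl

@[simp] theorem lead_inr_inl (w : TransverseSpace ke kh kf) (i : Fin kh) :
    lead w (.inr (.inl i)) = ⟨(w (.inr (.inl i))).1, 0⟩ := rfl

@[simp] theorem lead_inr_inr (w : TransverseSpace ke kh kf) (i : Fin kf) :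
    lead w (.inr (.inr i)) = ⟨(w (.inr (.inr (i, 0)))).1, (w (.inr (.inr (i, 1)))).1⟩ := rfl

theorem lead_act {a b : BlockVector ke kh kf} (ha : ∀ i, (a (.inr (.inl i))).im = 0)
    (w : TransverseSpace ke kh kf) : lead (act a b w) = a * lead w := by
  funext k
  rcases k with i | i | i
  · simp [act, Complex.ext_iff]; ring
  · simp [act, Complex.ext_iff, ha]
  · simp [act, Complex.ext_iff]; ring

theorem lead_flow (α : BlockVector ke kh kf) (w : TransverseSpace ke kh kf) :
    lead (flow α w) = fun k => Complex.exp (effective α k) * lead w k := by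
  rw [flow_apply, lead_act fun i => (exp_mk_zero_im _).1]
  rfl

theorem lead_infFlow (α : BlockVector ke kh kf) (w : TransverseSpace ke kh kf) :
    lead (infFlow α w) = fun k => effective α k * lead w k := by
  rw [infFlow_apply, lead_act fun i => rfl]
  rfl

/-- The points with nonzero leading coordinates are dense. -/
theorem dense_lead_ne_zero :
    Dense {e : BaseSpace m ke kh kf | ∀ k, lead e.2 k ≠ 0} := by
  have h1 : Dense {w : TransverseSpace ke kh kf | ∀ j, (w j).1 ≠ 0} := by
    have h2 : Dense {a : ℝ × ℝ | a.1 ≠ 0} := by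
      have := (dense_compl_singleton (0 : ℝ)).prod (dense_univ (X := ℝ))
      refine this.mono fun a ha => ha.1
    have h3 := dense_pi (s := fun _ : PairIndex ke kh kf => {a : ℝ × ℝ | a.1 ≠ 0}) Set.univ
      fun _ _ => h2
    exact h3.mono fun w (hw : w ∈ Set.pi Set.univ _) j => hw j trivial
  refine ((dense_univ (X := Fin m → ℝ)).prod h1).mono fun e he k => ?_
  rcases k with i | i | i
  · exact fun h => he.2 (.inl i) (congrArg Complex.re h)
  · exact fun h => he.2 (.inr (.inl i)) (congrArg Complex.re h)
  · exact fun h => he.2 (.inr (.inr (i, 0))) (congrArg Complex.re h)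

/-- Continuous maps on an open set agree if they agree where the leading coordinates do not
vanish. -/
theorem eqOn_of_lead_ne_zero {Y : Type*} [TopologicalSpace Y] [T2Space Y]
    {D : Set (BaseSpace m ke kh kf)} (hD : IsOpen D) {f g : BaseSpace m ke kh kf → Y}
    (hf : ContinuousOn f D) (hg : ContinuousOn g D)
    (h : ∀ e ∈ D, (∀ k, lead e.2 k ≠ 0) → f e = g e) : Set.EqOn f g D := by
  have h1 : Set.EqOn f g (D ∩ {e | ∀ k, lead e.2 k ≠ 0}) := fun e he => h e he.1 he.2
  exact h1.of_subset_closure hf hg Set.inter_subset_left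
    (dense_lead_ne_zero.open_subset_closure_inter hD)

/-- A map infinitesimally equivariant under the flows is equivariant along every flow line in
its domain. -/
theorem apply_flow_of_infinitesimal {W : BaseSpace m ke kh kf → TransverseSpace ke kh kf}
    {D : Set (BaseSpace m ke kh kf)} {e : BaseSpace m ke kh kf} {α : BlockVector ke kh kf}
    (hd : ∀ e ∈ D, DifferentiableAt ℝ W e)
    (hW : ∀ e ∈ D, ∀ α, fderiv ℝ W e (0, infFlow α e.2) = infFlow α (W e))
    (he : ∀ t ∈ Set.Icc (0 : ℝ) 1, (e.1, flow (t • α) e.2) ∈ D) :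
    W (e.1, flow α e.2) = flow α (W e) := by
  have hflow : ∀ (w : TransverseSpace ke kh kf) (β : BlockVector ke kh kf) (t : ℝ),
      HasDerivAt (fun t : ℝ => flow (t • β) w) (infFlow β (flow (t • β) w)) t := by
    intro w β t
    have h1 := (hasFDerivAt_flow ((hasDerivAt_id t).smul_const β).hasFDerivAt
      (hasFDerivAt_const w t)).hasDerivAt
    refine h1.congr_deriv ?_
    simp only [ContinuousLinearMap.comp_apply, zero_add, one_smul,
      ContinuousLinearMap.toSpanSingleton_apply]
    exact flow_infFlow (t • β) β w
  -- Transported back along the flow, the image of the flow line is constant.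
  have hc : ∀ t ∈ Set.Icc (0 : ℝ) 1,
      HasDerivAt (fun t : ℝ => flow (-(t • α)) (W (e.1, flow (t • α) e.2))) 0 t := by
    intro t ht
    have h1 : HasDerivAt (fun t : ℝ => W (e.1, flow (t • α) e.2))
        (infFlow α (W (e.1, flow (t • α) e.2))) t := by
      rw [← hW _ (he t ht) α]
      exact (hd _ (he t ht)).hasFDerivAt.comp_hasDerivAt t
        ((hasDerivAt_const t e.1).prodMk (hflow e.2 α t))
    have h2 := (hasFDerivAt_flow (((hasDerivAt_id t).smul_const α).neg).hasFDerivAt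
      h1.hasFDerivAt).hasDerivAt
    refine h2.congr_deriv ?_
    simp only [ContinuousLinearMap.comp_apply, add_apply, one_smul,
      ContinuousLinearMap.toSpanSingleton_apply]
    change flow _ (infFlow α _ + infFlow (-α) _) = 0
    rw [← infFlow_add, add_neg_cancel]
    simp [infFlow]
  have h3 := constant_of_has_deriv_right_zero (a := (0 : ℝ)) (b := 1)
    (fun t ht => (hc t ht).continuousAt.continuousWithinAt)
    (fun t ht => (hc t ⟨ht.1, ht.2.le⟩).hasDerivWithinAt) 1 ⟨zero_le_one, le_rfl⟩
  simp only [one_smul, zero_smul, neg_zero, flow_zero] at h3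
  rw [← h3, ← flow_add, add_neg_cancel, flow_zero]

/-- Multiplication of the coordinates `(x_j, y_j)` by `s`. -/
def scaleAt (j : PairIndex ke kh kf) (a : BaseSpace m ke kh kf × ℝ) : BaseSpace m ke kh kf :=
  (a.1.1, fun l => if l = j then a.2 • a.1.2 l else a.1.2 l)

theorem contDiff_scaleAt (j : PairIndex ke kh kf) :
    ContDiff ℝ ∞ (scaleAt j : BaseSpace m ke kh kf × ℝ → BaseSpace m ke kh kf) := by
  refine ContDiff.prodMk (by fun_prop) (contDiff_pi.2 fun l => ?_)
  by_cases h : l = j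
  · simp only [h, if_true]
    fun_prop
  · simp only [h, if_false]
    fun_prop

theorem scaleAt_mem_ball {j : PairIndex ke kh kf} {e : BaseSpace m ke kh kf} {r s : ℝ}
    (he : e ∈ Metric.ball 0 r) (hs : s ∈ Set.Icc (0 : ℝ) 1) :
    scaleAt j (e, s) ∈ Metric.ball 0 r := by
  rw [mem_ball_zero_iff] at he ⊢
  refine lt_of_le_of_lt ?_ he
  refine max_le (le_max_left _ _) ((pi_norm_le_iff_of_nonneg (norm_nonneg _)).2 fun l => ?_)
  have h1 : ‖e.2 l‖ ≤ ‖e‖ := (norm_le_pi_norm _ l).trans (norm_snd_le e)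
  simp only [scaleAt]
  split_ifs
  · rw [norm_smul, Real.norm_of_nonneg hs.1]
    exact (mul_le_of_le_one_left (norm_nonneg _) hs.2).trans h1
  · exact h1

theorem scaleAt_one (j : PairIndex ke kh kf) (e : BaseSpace m ke kh kf) :
    scaleAt j (e, 1) = e := by
  simp [scaleAt]

theorem hasDerivAt_scaleAt (j : PairIndex ke kh kf) (e : BaseSpace m ke kh kf) (s : ℝ) :
    HasDerivAt (fun s => scaleAt j (e, s)) (0, Pi.single j (e.2 j)) s := by
  refine (hasDerivAt_const s e.1).prodMk (hasDerivAt_pi.2 fun l => ?_)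
  by_cases h : l = j
  · subst h
    simpa using (hasDerivAt_id s).smul_const (e.2 l)
  · simpa [h] using hasDerivAt_const s (e.2 l)

section Family

variable {EG : Type*} [NormedAddCommGroup EG] [NormedSpace ℝ EG] [FiniteDimensional ℝ EG]
  {G : Type*} [TopologicalSpace G] [ChartedSpace EG G] [IsManifold 𝓘(ℝ, EG) ∞ G]

/-- Division by a leading coordinate `c` depending on the pair `j` only. If the Euler field
`R = x_j ∂/∂x_j + y_j ∂/∂y_j` satisfies `c(W) + R (c(W)) = 2 κ(DW) c`, then
`d/ds (s c(W)(s w_j)) = 2 s κ(DW)(s w_j) c`, and an integration shows that `c(W)` is a smooth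
multiple of `c`. -/
theorem exists_multiplier_of_euler {W : G → BaseSpace m ke kh kf → TransverseSpace ke kh kf}
    {r : ℝ} (hW : SmoothFamilyOn EG W Set.univ (Metric.ball 0 r)) (j : PairIndex ke kh kf)
    (c : TransverseSpace ke kh kf →L[ℝ] ℂ)
    (hc : ∀ (e : BaseSpace m ke kh kf) (s : ℝ), c (scaleAt j (e, s)).2 = s * c e.2)
    {κ : (BaseSpace m ke kh kf →L[ℝ] TransverseSpace ke kh kf) → ℂ} (hκ : ContDiff ℝ ∞ κ)
    (h : ∀ g, ∀ e ∈ Metric.ball (0 : BaseSpace m ke kh kf) r,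
      c (W g e) + c (fderiv ℝ (W g) e (0, Pi.single j (e.2 j))) =
        2 * κ (fderiv ℝ (W g) e) * c e.2) :
    ∃ u : G → BaseSpace m ke kh kf → ℂ, SmoothFamilyOn EG u Set.univ (Metric.ball 0 r) ∧
      (∀ g, ∀ e ∈ Metric.ball 0 r, c (W g e) = u g e * c e.2) ∧
      ∀ g e, u g e = ∫ s in (0 : ℝ)..1, 2 * (s : ℂ) * κ (fderiv ℝ (W g) (scaleAt j (e, s))) := by
  have hsm : SmoothFamilyOn EG (fun g (a : BaseSpace m ke kh kf × ℝ) =>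
      2 * (a.2 : ℂ) * κ (fderiv ℝ (W g) (scaleAt j a))) Set.univ
      (Metric.ball 0 r ×ˢ Set.Icc 0 1) := by
    have h1 := hW.fderiv.comp_left (SmoothFamilyOn.of_contDiff (EX := EG) (X := G)
      (contDiff_scaleAt j) Set.univ (Metric.ball 0 r ×ˢ Set.Icc 0 1))
      (fun g _ a ha => scaleAt_mem_ball ha.1 ha.2)
    have h2 := (h1.postcomp (φ := κ) fun g _ a _ => hκ.contDiffAt).prodMk
      (SmoothFamilyOn.of_contDiff (EX := EG) (X := G)
        (φ := fun a : BaseSpace m ke kh kf × ℝ => 2 * (a.2 : ℂ))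
        (contDiff_const.mul (Complex.ofRealCLM.contDiff.comp contDiff_snd)) Set.univ
        (Metric.ball 0 r ×ˢ Set.Icc 0 1))
    exact h2.postcomp (φ := fun b : ℂ × ℂ => b.2 * b.1) fun g _ a _ =>
      (contDiff_snd.mul contDiff_fst).contDiffAt
  refine ⟨_, hsm.intervalIntegral Metric.isOpen_ball, fun g e he => ?_, fun g e => rfl⟩
  have hder : ∀ s ∈ Set.uIcc (0 : ℝ) 1, HasDerivAt
      (fun s : ℝ => (s : ℂ) * c (W g (scaleAt j (e, s))))
      (2 * (s : ℂ) * κ (fderiv ℝ (W g) (scaleAt j (e, s))) * c e.2) s := by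
    intro s hs
    rw [Set.uIcc_of_le zero_le_one] at hs
    have hmem := scaleAt_mem_ball (j := j) he hs
    have h1 : HasDerivAt (fun s => c (W g (scaleAt j (e, s))))
        (c (fderiv ℝ (W g) (scaleAt j (e, s)) (0, Pi.single j (e.2 j)))) s :=
      c.hasFDerivAt.comp_hasDerivAt s ((hW.hasFDerivAt trivial hmem).comp_hasDerivAt s
        (hasDerivAt_scaleAt j e s))
    have h2 := (Complex.ofRealCLM.hasDerivAt (x := s)).mul h1
    refine h2.congr_deriv ?_
    have h3 := h g _ hmem
    rw [hc] at h3
    have h4 : ((0, Pi.single j ((scaleAt j (e, s)).2 j)) : BaseSpace m ke kh kf) =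
        s • (0, Pi.single j (e.2 j)) := by
      simp [scaleAt, Pi.single_smul]
    rw [h4, map_smul, map_smul, Complex.real_smul] at h3
    simp only [Complex.ofRealCLM_apply, Complex.ofReal_one, one_mul]
    rw [h3]
    ring
  have hcont : ContinuousOn (fun s : ℝ => 2 * (s : ℂ) * κ (fderiv ℝ (W g) (scaleAt j (e, s))))
      (Set.uIcc 0 1) := by
    rw [Set.uIcc_of_le zero_le_one]
    exact hsm.continuousOn.comp (f := fun s : ℝ => (g, (e, s))) (by fun_prop)
      fun s hs => ⟨trivial, he, hs⟩
  have hint := intervalIntegral.integral_eq_sub_of_hasDerivAt hder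
    (hcont.mul continuousOn_const).intervalIntegrable
  rw [intervalIntegral.integral_mul_const, scaleAt_one] at hint
  rw [hint]
  simp

variable {W : G → BaseSpace m ke kh kf → TransverseSpace ke kh kf} {r : ℝ}

/-- In an elliptic block with `z = x + i y`, equivariance under rotations makes the radial
derivative of `c(W)` equal to `2 z ∂c(W)/∂z - c(W)`; so `κ` is the Wirtinger derivative `∂/∂z`. -/
theorem exists_multiplier_elliptic (hW : SmoothFamilyOn EG W Set.univ (Metric.ball 0 r))
    (hE : ∀ g, ∀ e ∈ Metric.ball (0 : BaseSpace m ke kh kf) r, ∀ α,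
      fderiv ℝ (W g) e (0, infFlow α e.2) = infFlow α (W g e)) (i : Fin ke) :
    ∃ u : G → BaseSpace m ke kh kf → ℂ, SmoothFamilyOn EG u Set.univ (Metric.ball 0 r) ∧
      ∀ g, ∀ e ∈ Metric.ball 0 r, lead (W g e) (.inl i) = u g e * lead e.2 (.inl i) := by
  set j : PairIndex ke kh kf := .inl i with hj
  set c : TransverseSpace ke kh kf →L[ℝ] ℂ := (ContinuousLinearMap.proj (.inl i)).comp lead
    with hcdef
  have hc : ∀ w, c w = ⟨(w j).1, (w j).2⟩ := fun w => rfl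
  obtain ⟨u, hu, hu', -⟩ := exists_multiplier_of_euler hW j c
    (fun e s => by simp [hc, scaleAt, Complex.ext_iff])
    (κ := fun L => (1 / 2 : ℂ) * (c (L (0, Pi.single j (1, 0))) -
      Complex.I * c (L (0, Pi.single j (0, 1))))) (by fun_prop) (by
      intro g e he
      have h1 := congrArg c (hE g e he (Pi.single (.inl i) Complex.I))
      have h2 : infFlow (Pi.single (.inl i) Complex.I) e.2 =
          (-(e.2 j).2) • (Pi.single j (1, 0) : TransverseSpace ke kh kf) +
            (e.2 j).1 • (Pi.single j (0, 1) : TransverseSpace ke kh kf) := by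
        rw [infFlow_apply]
        funext l
        rcases l with l | l | ⟨l, k⟩
        · by_cases hl : l = i
          · subst hl; simp [act, hj]
          · simp [act, hj, hl]
        · simp [act, hj]
        · fin_cases k <;> simp [act, hj]
      have h3 : c (infFlow (Pi.single (.inl i) Complex.I) (W g e)) = Complex.I * c (W g e) := by
        change lead (infFlow (Pi.single (.inl i) Complex.I) (W g e)) (.inl i) = _
        rw [lead_infFlow]
        simp [hcdef, Complex.ext_iff]
      have h4 : (Pi.single j (e.2 j) : TransverseSpace ke kh kf) =
          (e.2 j).1 • (Pi.single j (1, 0) : TransverseSpace ke kh kf) +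
            (e.2 j).2 • (Pi.single j (0, 1) : TransverseSpace ke kh kf) := by
        rw [← Pi.single_smul, ← Pi.single_smul, ← Pi.single_add]
        simp
      have h5 : ∀ (a b : ℝ) (v w : TransverseSpace ke kh kf),
          ((0, a • v + b • w) : BaseSpace m ke kh kf) = a • (0, v) + b • (0, w) := by
        intros; simp
      rw [h3, h2, h5] at h1
      rw [h4, h5]
      simp only [map_add, map_smul, Complex.real_smul] at h1 ⊢
      have h6 : c e.2 = (e.2 j).1 + (e.2 j).2 * Complex.I := by
        rw [hc]; simp [Complex.ext_iff]
      rw [h6]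
      have h7 := congrArg (fun x => -Complex.I * x) h1
      simp only [← mul_assoc, neg_mul, Complex.I_mul_I, neg_neg, one_mul] at h7
      rw [← h7]
      push_cast
      ring_nf
      simp only [Complex.I_sq]
      ring)
  exact ⟨u, hu, hu'⟩

/-- In a hyperbolic block, equivariance under `x ∂/∂x - y ∂/∂y` makes the radial derivative of
`c(W)` equal to `2 x ∂c(W)/∂x - c(W)`; so `κ` is `∂/∂x`. -/
theorem exists_multiplier_hyperbolic (hW : SmoothFamilyOn EG W Set.univ (Metric.ball 0 r))
    (hE : ∀ g, ∀ e ∈ Metric.ball (0 : BaseSpace m ke kh kf) r, ∀ α,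
      fderiv ℝ (W g) e (0, infFlow α e.2) = infFlow α (W g e)) (i : Fin kh) :
    ∃ u : G → BaseSpace m ke kh kf → ℂ, SmoothFamilyOn EG u Set.univ (Metric.ball 0 r) ∧
      (∀ g, ∀ e ∈ Metric.ball 0 r,
        lead (W g e) (.inr (.inl i)) = u g e * lead e.2 (.inr (.inl i))) ∧
      ∀ g e, (u g e).im = 0 := by
  set j : PairIndex ke kh kf := .inr (.inl i) with hj
  set c : TransverseSpace ke kh kf →L[ℝ] ℂ := (ContinuousLinearMap.proj (.inr (.inl i))).comp lead
    with hcdef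
  have hc : ∀ w, c w = ((w j).1 : ℂ) := fun w => rfl
  obtain ⟨u, hu, hu', hu''⟩ := exists_multiplier_of_euler hW j c
    (fun e s => by simp [hc, scaleAt])
    (κ := fun L => c (L (0, Pi.single j (1, 0)))) (by fun_prop) (by
      intro g e he
      have h1 := congrArg c (hE g e he (Pi.single (.inr (.inl i)) 1))
      have h2 : infFlow (Pi.single (.inr (.inl i)) 1) e.2 =
          (e.2 j).1 • (Pi.single j (1, 0) : TransverseSpace ke kh kf) +
            (-(e.2 j).2) • (Pi.single j (0, 1) : TransverseSpace ke kh kf) := by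
        rw [infFlow_apply]
        funext l
        rcases l with l | l | ⟨l, k⟩
        · simp [act, hj]
        · by_cases hl : l = i
          · subst hl; simp [act, hj]
          · simp [act, hj, hl]
        · fin_cases k <;> simp [act, hj]
      have h3 : c (infFlow (Pi.single (.inr (.inl i)) 1) (W g e)) = c (W g e) := by
        change lead (infFlow (Pi.single (.inr (.inl i)) 1) (W g e)) (.inr (.inl i)) = _
        rw [lead_infFlow]
        simp [hcdef, Complex.ext_iff]
      have h4 : (Pi.single j (e.2 j) : TransverseSpace ke kh kf) =
          (e.2 j).1 • (Pi.single j (1, 0) : TransverseSpace ke kh kf) +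
            (e.2 j).2 • (Pi.single j (0, 1) : TransverseSpace ke kh kf) := by
        rw [← Pi.single_smul, ← Pi.single_smul, ← Pi.single_add]
        simp
      have h5 : ∀ (a b : ℝ) (v w : TransverseSpace ke kh kf),
          ((0, a • v + b • w) : BaseSpace m ke kh kf) = a • (0, v) + b • (0, w) := by
        intros; simp
      rw [h3, h2, h5] at h1
      rw [h4, h5, ← h1, hc e.2]
      simp only [map_add, map_smul, Complex.real_smul]
      push_cast
      ring)
  refine ⟨u, hu, hu', fun g e => ?_⟩
  rw [hu'']
  simp only [hc]
  norm_cast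
  rw [intervalIntegral.integral_ofReal]
  exact Complex.ofReal_im _

end Family

/-! ### Multipliers in the focus-focus blocks -/

/-- The point of the slice `z₁ = ε` of a focus-focus block with the same values of the moment
map and the same coordinates in the other blocks. For `z₁ ≠ 0` it lies on the same orbit of the
flow. -/
def sliceAt (i : Fin kf) (ε : ℝ) (e : BaseSpace m ke kh kf) : BaseSpace m ke kh kf :=
  (e.1, fun j => match j with
    | .inl l => e.2 (.inl l)
    | .inr (.inl l) => e.2 (.inr (.inl l))
    | .inr (.inr (l, 0)) => if l = i then (ε, quadraticMap e.2 (.inr (.inr (i, 1))) / ε)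
        else e.2 (.inr (.inr (l, 0)))
    | .inr (.inr (l, 1)) => if l = i then (0, quadraticMap e.2 (.inr (.inr (i, 0))) / ε)
        else e.2 (.inr (.inr (l, 1))))

theorem contDiff_sliceAt (i : Fin kf) (ε : ℝ) :
    ContDiff ℝ ∞ (sliceAt i ε : BaseSpace m ke kh kf → BaseSpace m ke kh kf) := by
  refine contDiff_fst.prodMk (contDiff_pi.2 fun j => ?_)
  rcases j with l | l | ⟨l, k⟩
  · fun_prop
  · fun_prop
  · by_cases h : l = i
    · fin_cases k
      · simp only [h, if_true, quadraticMap]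
        fun_prop
      · simp only [h, if_true, quadraticMap]
        fun_prop
    · fin_cases k
      · simp only [h, if_false]
        fun_prop
      · simp only [h, if_false]
        fun_prop

theorem abs_pair_lt {e : BaseSpace m ke kh kf} {r : ℝ} (he : e ∈ Metric.ball 0 r)
    (j : PairIndex ke kh kf) : |(e.2 j).1| < r ∧ |(e.2 j).2| < r := by
  rw [mem_ball_zero_iff] at he
  have h1 : ‖e.2 j‖ < r := ((norm_le_pi_norm _ j).trans (norm_snd_le e)).trans_lt he
  exact ⟨(norm_fst_le (e.2 j)).trans_lt h1, (norm_snd_le (e.2 j)).trans_lt h1⟩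

theorem sliceAt_mem_ball {i : Fin kf} {r : ℝ} (hr : 0 < r) {e : BaseSpace m ke kh kf}
    (he : e ∈ Metric.ball 0 (r / 4)) : sliceAt i (r / 2) e ∈ Metric.ball 0 r := by
  have hq : ∀ a b c d : ℝ, |a| < r / 4 → |b| < r / 4 → |c| < r / 4 → |d| < r / 4 →
      |(a * b + c * d) / (r / 2)| < r := by
    intro a b c d ha hb hc hd
    rw [abs_div, abs_of_pos (half_pos hr), div_lt_iff₀ (half_pos hr)]
    have h1 : |a * b| ≤ r / 4 * (r / 4) := by
      rw [abs_mul]; exact mul_le_mul ha.le hb.le (abs_nonneg _) (by positivity)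
    have h2 : |c * d| ≤ r / 4 * (r / 4) := by
      rw [abs_mul]; exact mul_le_mul hc.le hd.le (abs_nonneg _) (by positivity)
    nlinarith [abs_add_le (a * b) (c * d)]
  have hsmall : ∀ j, ‖e.2 j‖ < r := fun j => by
    have := abs_pair_lt he j
    rw [Prod.norm_def, max_lt_iff, Real.norm_eq_abs, Real.norm_eq_abs]
    exact ⟨by linarith [this.1], by linarith [this.2]⟩
  have h := fun j => abs_pair_lt he j
  rw [mem_ball_zero_iff] at he ⊢
  refine max_lt ((norm_fst_le e).trans_lt (by linarith)) ((pi_norm_lt_iff hr).2 fun j => ?_)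
  rcases j with l | l | ⟨l, k⟩
  · exact hsmall _
  · exact hsmall _
  · fin_cases k
    · simp only [sliceAt, Fin.zero_eta]
      split_ifs
      · rw [Prod.norm_def, max_lt_iff, Real.norm_eq_abs, Real.norm_eq_abs]
        refine ⟨by rw [abs_of_pos (half_pos hr)]; linarith, ?_⟩
        exact hq _ _ _ _ (h _).1 (h _).2 (h _).1 (h _).2
      · exact hsmall _
    · simp only [sliceAt, Fin.mk_one]
      split_ifs
      · rw [Prod.norm_def, max_lt_iff, Real.norm_eq_abs, Real.norm_eq_abs]
        refine ⟨by simpa using hr, ?_⟩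
        simp only [quadraticMap, sub_eq_add_neg, ← mul_neg]
        exact hq _ _ _ _ (h _).1 (h _).2 (h _).1 (by rw [abs_neg]; exact (h _).2)
      · exact hsmall _

/-- The time after which the flow reaches the slice `z₁ = ε`. -/
def sliceTime (i : Fin kf) (ε : ℝ) (e : BaseSpace m ke kh kf) : BlockVector ke kh kf :=
  Pi.single (.inr (.inr i)) (Complex.log (ε / lead e.2 (.inr (.inr i))))

theorem flow_sliceTime (i : Fin kf) {ε : ℝ} (hε : 0 < ε) {e : BaseSpace m ke kh kf}
    (he : lead e.2 (.inr (.inr i)) ≠ 0) :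
    flow (sliceTime i ε e) e.2 = (sliceAt i ε e).2 := by
  have hε' : (ε : ℂ) ≠ 0 := by exact_mod_cast hε.ne'
  have ha : Complex.exp (Complex.log (ε / lead e.2 (.inr (.inr i)))) *
      lead e.2 (.inr (.inr i)) = ε := by
    rw [Complex.exp_log (div_ne_zero hε' he), div_mul_cancel₀ _ he]
  have hb : Complex.exp (-(starRingEnd ℂ) (Complex.log (ε / lead e.2 (.inr (.inr i))))) =
      (starRingEnd ℂ) (lead e.2 (.inr (.inr i))) / ε := by
    rw [Complex.exp_neg, Complex.exp_conj, Complex.exp_log (div_ne_zero hε' he), map_div₀,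
      inv_div, Complex.conj_ofReal]
  have ha1 := congrArg Complex.re ha
  have ha2 := congrArg Complex.im ha
  have hb1 := congrArg Complex.re hb
  have hb2 := congrArg Complex.im hb
  simp only [Complex.mul_re, Complex.mul_im, Complex.ofReal_re, Complex.ofReal_im,
    Complex.div_ofReal_re, Complex.div_ofReal_im, Complex.conj_re, Complex.conj_im]
    at ha1 ha2 hb1 hb2
  rw [flow_apply]
  funext j
  rcases j with l | l | ⟨l, k⟩
  · simp [act, sliceAt, sliceTime, Complex.exp_re, Complex.exp_im]
  · simp [act, sliceAt, sliceTime, Complex.exp_re]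
  · by_cases hl : l = i
    · subst hl
      fin_cases k
      · refine Prod.ext ?_ ?_
        · simpa [act, sliceAt, sliceTime] using ha1
        · simp only [act, sliceAt, sliceTime, Fin.zero_eta, if_true, effective_inr_inr,
            Pi.single_eq_same, hb1, hb2, quadraticMap]
          simp only [lead_inr_inr]
          ring
      · refine Prod.ext ?_ ?_
        · simp only [act, sliceAt, sliceTime, Fin.mk_one, if_true, effective_inr_inr,
            Pi.single_eq_same]
          simp only [lead_inr_inr] at ha2 ⊢
          linarith
        · simp only [act, sliceAt, sliceTime, Fin.mk_one, if_true, effective_inr_inr,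
            Pi.single_eq_same, hb1, hb2, quadraticMap]
          simp only [lead_inr_inr]
          ring
    · fin_cases k <;> simp [act, sliceAt, sliceTime, hl]

/-- The flow line leading to the slice increases `|z₁|` up to `ε` and decreases `|z₂|`. -/
theorem flow_sliceTime_mem_ball (i : Fin kf) {r : ℝ} (hr : 0 < r) {e : BaseSpace m ke kh kf}
    (hball : e ∈ Metric.ball 0 (r / 4)) (he : lead e.2 (.inr (.inr i)) ≠ 0) {t : ℝ}
    (ht : t ∈ Set.Icc (0 : ℝ) 1) :
    ((e.1, flow (t • sliceTime i (r / 2) e) e.2) : BaseSpace m ke kh kf) ∈ Metric.ball 0 r := by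
  have hsmall : ∀ j, ‖e.2 j‖ < r := fun j => by
    have := abs_pair_lt hball j
    rw [Prod.norm_def, max_lt_iff, Real.norm_eq_abs, Real.norm_eq_abs]
    exact ⟨by linarith [this.1], by linarith [this.2]⟩
  have h := fun j => abs_pair_lt hball j
  set z := lead e.2 (.inr (.inr i)) with hz
  set ν := Complex.log (((r / 2 : ℝ) : ℂ) / z) with hν
  set z₂ : ℂ := ⟨(e.2 (.inr (.inr (i, 0)))).2, (e.2 (.inr (.inr (i, 1)))).2⟩ with hz₂
  have hz0 : 0 < ‖z‖ := norm_pos_iff.2 he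
  have hzr : ‖z‖ < r / 2 := by
    have h1 := Complex.norm_le_abs_re_add_abs_im z
    have h2 : |z.re| < r / 4 := (h (.inr (.inr (i, 0)))).1
    have h3 : |z.im| < r / 4 := (h (.inr (.inr (i, 1)))).1
    linarith
  have hz₂r : ‖z₂‖ < r / 2 := by
    have h1 := Complex.norm_le_abs_re_add_abs_im z₂
    have h2 : |z₂.re| < r / 4 := (h (.inr (.inr (i, 0)))).2
    have h3 : |z₂.im| < r / 4 := (h (.inr (.inr (i, 1)))).2
    linarith
  have hre : ν.re = Real.log ((r / 2) / ‖z‖) := by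
    rw [hν, Complex.log_re, norm_div, Complex.norm_real, Real.norm_of_nonneg (half_pos hr).le]
  have hre0 : 0 ≤ ν.re := by
    rw [hre]; exact Real.log_nonneg ((one_le_div hz0).2 hzr.le)
  have hA : ‖Complex.exp (t * ν) * z‖ ≤ r / 2 := by
    rw [norm_mul, Complex.norm_exp, Complex.re_ofReal_mul]
    calc Real.exp (t * ν.re) * ‖z‖ ≤ Real.exp ν.re * ‖z‖ := by
          gcongr; exact mul_le_of_le_one_left hre0 ht.2
      _ = r / 2 := by
          rw [hre, Real.exp_log (div_pos (half_pos hr) hz0), div_mul_cancel₀ _ hz0.ne']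
  have hB : ‖Complex.exp (-(starRingEnd ℂ) (t * ν)) * z₂‖ < r / 2 := by
    rw [norm_mul, Complex.norm_exp, Complex.neg_re, Complex.conj_re, Complex.re_ofReal_mul]
    refine lt_of_le_of_lt (mul_le_of_le_one_left (norm_nonneg _) ?_) hz₂r
    exact Real.exp_le_one_iff.2 (neg_nonpos.2 (mul_nonneg ht.1 hre0))
  rw [mem_ball_zero_iff] at hball ⊢
  refine max_lt ((norm_fst_le e).trans_lt (by linarith)) ((pi_norm_lt_iff hr).2 fun j => ?_)
  have hα : ∀ k, effective (t • sliceTime i (r / 2) e) k =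
      if k = .inr (.inr i) then (t : ℂ) * ν else 0 := by
    intro k
    rcases k with l | l | l
    · simp [sliceTime, Complex.ext_iff]
    · simp [sliceTime, Complex.ext_iff]
    · by_cases hl : l = i
      · subst hl; simp [sliceTime, hν, hz]
      · simp [sliceTime, hl]
  have h1 : ∀ k, flow (t • sliceTime i (r / 2) e) e.2 (.inr (.inr (i, k))) =
      (if k = 0 then ((Complex.exp (t * ν) * z).re,
        (Complex.exp (-(starRingEnd ℂ) (t * ν)) * z₂).re)
      else ((Complex.exp (t * ν) * z).im, (Complex.exp (-(starRingEnd ℂ) (t * ν)) * z₂).im)) := by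
    intro k
    rw [flow_apply]
    simp only [hα]
    fin_cases k
    · simp [act, hz, hz₂]
    · simp only [act, Fin.mk_one, Fin.isValue, if_true, hz, hz₂, lead_inr_inr, Complex.mul_im]
      simp [add_comm]
  rcases j with l | l | ⟨l, k⟩
  · rw [flow_apply]
    simp only [hα]
    simpa [act] using hsmall (.inl l)
  · rw [flow_apply]
    simp only [hα]
    simpa [act] using hsmall (.inr (.inl l))
  · by_cases hl : l = i
    · subst hl
      change ‖flow _ e.2 _‖ < r
      rw [h1, Prod.norm_def, max_lt_iff, Real.norm_eq_abs, Real.norm_eq_abs]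
      split_ifs
      · exact ⟨(Complex.abs_re_le_norm _).trans_lt (by linarith),
          (Complex.abs_re_le_norm _).trans_lt (by linarith)⟩
      · exact ⟨(Complex.abs_im_le_norm _).trans_lt (by linarith),
          (Complex.abs_im_le_norm _).trans_lt (by linarith)⟩
    · rw [flow_apply]
      simp only [hα]
      fin_cases k
      · simpa [act, hl] using hsmall (.inr (.inr (l, 0)))
      · simpa [act, hl] using hsmall (.inr (.inr (l, 1)))

section Family

variable {EG : Type*} [NormedAddCommGroup EG] [NormedSpace ℝ EG]
  {G : Type*} [TopologicalSpace G] [ChartedSpace EG G]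
  {W : G → BaseSpace m ke kh kf → TransverseSpace ke kh kf} {r : ℝ}

/-- In a focus-focus block the multiplier is read off on a slice, to which all points with
`z₁ ≠ 0` flow. -/
theorem exists_multiplier_focus (hr : 0 < r)
    (hW : SmoothFamilyOn EG W Set.univ (Metric.ball 0 r))
    (hE : ∀ g, ∀ e ∈ Metric.ball (0 : BaseSpace m ke kh kf) r, ∀ α,
      fderiv ℝ (W g) e (0, infFlow α e.2) = infFlow α (W g e)) (i : Fin kf) :
    ∃ u : G → BaseSpace m ke kh kf → ℂ, SmoothFamilyOn EG u Set.univ (Metric.ball 0 (r / 4)) ∧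
      ∀ g, ∀ e ∈ Metric.ball 0 (r / 4),
        lead (W g e) (.inr (.inr i)) = u g e * lead e.2 (.inr (.inr i)) := by
  have hε : ((r / 2 : ℝ) : ℂ) ≠ 0 := by exact_mod_cast (half_pos hr).ne'
  have hu : SmoothFamilyOn EG
      (fun g e => lead (W g (sliceAt i (r / 2) e)) (.inr (.inr i)) / ((r / 2 : ℝ) : ℂ)) Set.univ
      (Metric.ball 0 (r / 4)) :=
    (hW.comp_left (SmoothFamilyOn.of_contDiff (EX := EG) (X := G) (contDiff_sliceAt i (r / 2))
      Set.univ (Metric.ball 0 (r / 4))) fun g _ e he => sliceAt_mem_ball hr he).postcomp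
      (φ := fun w => lead w (.inr (.inr i)) / ((r / 2 : ℝ) : ℂ)) fun g _ e _ =>
        (((ContinuousLinearMap.proj (.inr (.inr i))).comp lead).contDiff.div_const _).contDiffAt
  refine ⟨_, hu, fun g => ?_⟩
  have hsub : Metric.ball (0 : BaseSpace m ke kh kf) (r / 4) ⊆ Metric.ball 0 r :=
    Metric.ball_subset_ball (by linarith)
  refine eqOn_of_lead_ne_zero Metric.isOpen_ball ?_ ?_ fun e he hne => ?_
  · have h1 : ContinuousOn (W g) (Metric.ball 0 (r / 4)) := fun e he =>
      (hW.contDiffAt trivial (hsub he)).continuousAt.continuousWithinAt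
    exact ((ContinuousLinearMap.proj (R := ℝ) (φ := fun _ : Block ke kh kf => ℂ)
      (.inr (.inr i))).comp lead).continuous.comp_continuousOn h1
  · refine ContinuousOn.mul (fun e he =>
      (hu.contDiffAt trivial he).continuousAt.continuousWithinAt) ?_
    exact (((ContinuousLinearMap.proj (R := ℝ) (φ := fun _ : Block ke kh kf => ℂ)
      (.inr (.inr i))).comp lead).continuous.comp continuous_snd).continuousOn
  · have h1 := apply_flow_of_infinitesimal (W := W g) (D := Metric.ball 0 r)
      (α := sliceTime i (r / 2) e)
      (fun e he => (hW.hasFDerivAt trivial he).differentiableAt) (hE g)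
      (fun t ht => flow_sliceTime_mem_ball i hr he (hne _) ht)
    rw [flow_sliceTime i (half_pos hr) (hne _)] at h1
    have h2 := congrFun (congrArg lead h1) (.inr (.inr i))
    simp only [lead_flow, effective_inr_inr, sliceTime, Pi.single_eq_same] at h2
    rw [Complex.exp_log (div_ne_zero hε (hne _))] at h2
    change _ = lead (W g (e.1, (sliceAt i (r / 2) e).2)) (.inr (.inr i)) / _ * _
    rw [h2]
    have := hne (.inr (.inr i))
    field_simp

/-- The leading coordinates of an equivariant family are smooth multiples of the leading
coordinates. -/
theorem exists_multiplier [FiniteDimensional ℝ EG] [IsManifold 𝓘(ℝ, EG) ∞ G] (hr : 0 < r)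
    (hW : SmoothFamilyOn EG W Set.univ (Metric.ball 0 r))
    (hE : ∀ g, ∀ e ∈ Metric.ball (0 : BaseSpace m ke kh kf) r, ∀ α,
      fderiv ℝ (W g) e (0, infFlow α e.2) = infFlow α (W g e)) :
    ∃ u : G → BaseSpace m ke kh kf → BlockVector ke kh kf,
      SmoothFamilyOn EG u Set.univ (Metric.ball 0 (r / 4)) ∧
      (∀ g, ∀ e ∈ Metric.ball 0 (r / 4), lead (W g e) = u g e * lead e.2) ∧
      ∀ g e i, (u g e (.inr (.inl i))).im = 0 := by
  have hsub : Metric.ball (0 : BaseSpace m ke kh kf) (r / 4) ⊆ Metric.ball 0 r :=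
    Metric.ball_subset_ball (by linarith)
  choose u₁ h₁ h₁' using exists_multiplier_elliptic hW hE
  choose u₂ h₂ h₂' h₂'' using exists_multiplier_hyperbolic hW hE
  choose u₃ h₃ h₃' using exists_multiplier_focus hr hW hE
  refine ⟨fun g e k => match k with
    | .inl i => u₁ i g e
    | .inr (.inl i) => u₂ i g e
    | .inr (.inr i) => u₃ i g e, SmoothFamilyOn.pi fun k => ?_, fun g e he => ?_,
    fun g e i => h₂'' i g e⟩
  · rcases k with i | i | i
    · exact (h₁ i).mono hsub
    · exact (h₂ i).mono hsub
    · exact h₃ i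
  · funext k
    rcases k with i | i | i
    · exact h₁' i g e (hsub he)
    · exact h₂' i g e (hsub he)
    · exact h₃' i g e he

end Family

/-! ### The cocycle of an action -/

section Action

variable {EG : Type*} [NormedAddCommGroup EG] [NormedSpace ℝ EG]
  {G : Type*} [TopologicalSpace G] [ChartedSpace EG G] [Group G]
  {U : Set (PhaseSpace m ke kh kf)} {ρ : G → PhaseSpace m ke kh kf → PhaseSpace m ke kh kf}

/-- An action preserving the system on the polydisc of radius `r`, written as
`(p, q, w) ↦ (p, q + t + a₁(p, w), u • flow (a₂(p, w)) w)`: here `t` and `u` are homomorphisms to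
the torus and to the unit complex multipliers, and `a` is a smooth cocycle near the origin. -/
structure IsFlowForm (EG : Type*) [NormedAddCommGroup EG] [NormedSpace ℝ EG]
    {G : Type*} [TopologicalSpace G] [ChartedSpace EG G] [Group G]
    (U : Set (PhaseSpace m ke kh kf)) (ρ : G → PhaseSpace m ke kh kf → PhaseSpace m ke kh kf)
    (r : ℝ) (t : G → Torus m) (u : G → BlockVector ke kh kf)
    (a : G → BaseSpace m ke kh kf → (Fin m → ℝ) × BlockVector ke kh kf) : Prop where
  mem : ∀ e ∈ Metric.ball (0 : BaseSpace m ke kh kf) r, ∀ q,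
    ((e.1, q, e.2) : PhaseSpace m ke kh kf) ∈ U
  smooth : SmoothFamilyOn EG a Set.univ (Metric.ball 0 r)
  zero : ∀ g, a g 0 = 0
  apply_eq : ∀ g, ∀ e ∈ Metric.ball 0 r, ∀ q, ρ g (e.1, q, e.2) =
    (e.1, q + (t g + Torus.proj m (a g e).1), act (u g) (u g) (flow (a g e).2 e.2))
  cocycle : ∀ᶠ e in 𝓝 0, ∀ g h, a (g * h) e =
    a g (e.1, act (u h) (u h) (flow (a h e).2 e.2)) + a h e
  maps : ∀ s > 0, ∀ᶠ e in 𝓝 (0 : BaseSpace m ke kh kf), ∀ h,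
    (e.1, act (u h) (u h) (flow (a h e).2 e.2)) ∈ Metric.ball (0 : BaseSpace m ke kh kf) s
  smooth_t : ContMDiff 𝓘(ℝ, EG) 𝓘(ℝ, Fin m → ℝ) ∞ t
  smooth_u : ContMDiff 𝓘(ℝ, EG) 𝓘(ℝ, BlockVector ke kh kf) ∞ u
  t_one : t 1 = 0
  t_mul : ∀ g h, t (g * h) = t g + t h
  u_one : u 1 = 1
  u_mul : ∀ g h, u (g * h) = u g * u h
  norm_u : ∀ g k, ‖u g k‖ = 1
  u_real : ∀ g i, (u g (.inr (.inl i))).im = 0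

/-- A continuous homomorphism from a compact group to the nonzero complex numbers takes values
in the unit circle. -/
theorem norm_eq_one_of_hom [CompactSpace G] {v : G → ℂ} (hc : Continuous v) (h1 : v 1 = 1)
    (hm : ∀ g h, v (g * h) = v g * v h) (g : G) : ‖v g‖ = 1 := by
  obtain ⟨C, hC⟩ := isCompact_univ.exists_bound_of_continuousOn (f := v) hc.continuousOn
  have hpow : ∀ g (n : ℕ), v (g ^ n) = v g ^ n := by
    intro g n
    induction n with
    | zero => simp [h1]
    | succ n ih => rw [pow_succ, hm, ih, pow_succ]
  have hle : ∀ g, ‖v g‖ ≤ 1 := by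
    intro g
    by_contra! hlt
    obtain ⟨n, hn⟩ := pow_unbounded_of_one_lt C hlt
    have := hC (g ^ n) trivial
    rw [hpow, norm_pow] at this
    linarith
  refine le_antisymm (hle g) ?_
  have h2 : ‖v g‖ * ‖v g⁻¹‖ = 1 := by rw [← norm_mul, ← hm, mul_inv_cancel, h1, norm_one]
  nlinarith [hle g⁻¹, norm_nonneg (v g)]

/-- A map whose leading coordinates are multiplied by `u₀ exp α` and which preserves the
quadratic Hamiltonians is `act u₀ u₀ ∘ flow α` where the leading coordinates do not vanish. -/
theorem eq_act_flow_of_lead {w w' : TransverseSpace ke kh kf} {u₀ α : BlockVector ke kh kf}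
    (hu₀ : ∀ k, ‖u₀ k‖ = 1) (hreal : ∀ i, (u₀ (.inr (.inl i))).im = 0)
    (hα : ∀ i, (α (.inr (.inl i))).im = 0) (hw : ∀ k, lead w k ≠ 0)
    (hlead : ∀ k, lead w' k = u₀ k * Complex.exp (α k) * lead w k)
    (hq : quadraticMap w' = quadraticMap w) : w' = act u₀ u₀ (flow α w) := by
  -- Preservation of `x² + y²` forces the elliptic times to be imaginary.
  have heff : effective α = α := by
    funext k
    rcases k with i | i | i
    · have h1 : ‖lead w' (.inl i)‖ = ‖lead w (.inl i)‖ := by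
        have h2 := congrFun hq (.inl i)
        simp only [quadraticMap] at h2
        rw [← sq_eq_sq₀ (norm_nonneg _) (norm_nonneg _), ← Complex.normSq_eq_norm_sq,
          ← Complex.normSq_eq_norm_sq, Complex.normSq_apply, Complex.normSq_apply]
        simp only [lead_inl]
        linarith
      rw [hlead, norm_mul, norm_mul, hu₀, one_mul, Complex.norm_exp] at h1
      have h3 : Real.exp (α (.inl i)).re = 1 :=
        mul_right_cancel₀ (norm_ne_zero_iff.2 (hw (.inl i))) (h1.trans (one_mul _).symm)
      rw [Real.exp_eq_one_iff] at h3
      exact Complex.ext h3.symm rfl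
    · exact Complex.ext rfl (hα i).symm
    · rfl
  have hsys : quadraticMap (act u₀ u₀ (flow α w)) = quadraticMap w := by
    rw [(isSystemMultiplier_of_norm hu₀ hreal).quadraticMap_act, quadraticMap_flow]
  have hlead' : ∀ k, lead w' k = lead (act u₀ u₀ (flow α w)) k := by
    intro k
    rw [lead_act hreal, lead_flow, heff, Pi.mul_apply, hlead, mul_assoc]
  have hne : ∀ k, lead w' k ≠ 0 := fun k => by
    rw [hlead]
    exact mul_ne_zero (mul_ne_zero (norm_ne_zero_iff.1 (by rw [hu₀]; exact one_ne_zero))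
      (Complex.exp_ne_zero _)) (hw k)
  -- The remaining coordinates are determined by the leading ones and the Hamiltonians.
  have hq' := hq.trans hsys.symm
  generalize act u₀ u₀ (flow α w) = v at hlead' hq'
  funext j
  rcases j with i | i | ⟨i, k⟩
  · exact Prod.ext (congrArg Complex.re (hlead' (.inl i))) (congrArg Complex.im (hlead' (.inl i)))
  · have h1 : (w' (.inr (.inl i))).1 = (v (.inr (.inl i))).1 :=
      congrArg Complex.re (hlead' (.inr (.inl i)))
    have h2 := congrFun hq' (.inr (.inl i))
    simp only [quadraticMap] at h2
    rw [← h1] at h2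
    have h3 : (w' (.inr (.inl i))).1 ≠ 0 := fun h =>
      hne (.inr (.inl i)) (by simp [h, Complex.ext_iff])
    exact Prod.ext h1 (mul_left_cancel₀ h3 h2)
  · have h1 : (w' (.inr (.inr (i, 0)))).1 = (v (.inr (.inr (i, 0)))).1 :=
      congrArg Complex.re (hlead' (.inr (.inr i)))
    have h2 : (w' (.inr (.inr (i, 1)))).1 = (v (.inr (.inr (i, 1)))).1 :=
      congrArg Complex.im (hlead' (.inr (.inr i)))
    have h3 := congrFun hq' (.inr (.inr (i, 0)))
    have h4 := congrFun hq' (.inr (.inr (i, 1)))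
    simp only [quadraticMap] at h3 h4
    rw [← h1, ← h2] at h3 h4
    have h5 : (w' (.inr (.inr (i, 0)))).1 * (w' (.inr (.inr (i, 0)))).1 +
        (w' (.inr (.inr (i, 1)))).1 * (w' (.inr (.inr (i, 1)))).1 ≠ 0 := by
      have := Complex.normSq_pos.2 (hne (.inr (.inr i)))
      rw [Complex.normSq_apply] at this
      exact this.ne'
    fin_cases k
    · refine Prod.ext h1 (mul_left_cancel₀ h5 ?_)
      simp only [Fin.zero_eta]
      linear_combination (w' (.inr (.inr (i, 0)))).1 * h4 - (w' (.inr (.inr (i, 1)))).1 * h3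
    · refine Prod.ext h2 (mul_left_cancel₀ h5 ?_)
      simp only [Fin.mk_one]
      linear_combination (w' (.inr (.inr (i, 0)))).1 * h3 + (w' (.inr (.inr (i, 1)))).1 * h4

variable [FiniteDimensional ℝ EG] [LieGroup 𝓘(ℝ, EG) ∞ G] [CompactSpace G]

/-- Every action of a compact Lie group preserving the system is of flow form near the
central torus. -/
theorem IsSystemAction.exists_isFlowForm (hU : IsOpen U) (hLU : centralTorus m ke kh kf ⊆ U)
    (hρ : IsSystemAction (EG := EG) U ρ) :
    ∃ r > 0, ∃ t u a, IsFlowForm EG U ρ r t u a := by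
  obtain ⟨r₀, hr₀, hmem⟩ := exists_ball_subset hU hLU
  set W : G → BaseSpace m ke kh kf → TransverseSpace ke kh kf :=
    fun g => transversePart (ρ g) with hWdef
  have hWs : SmoothFamilyOn EG W Set.univ (Metric.ball 0 r₀) :=
    hρ.smoothFamilyOn_transversePart hU fun e he => hmem e he 0
  have hE : ∀ g, ∀ e ∈ Metric.ball (0 : BaseSpace m ke kh kf) r₀, ∀ α,
      fderiv ℝ (W g) e (0, infFlow α e.2) = infFlow α (W g e) := fun g e he α =>
    (hρ.preserves g).fderiv_transversePart hU (hmem e he 0)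
      (hρ.mdifferentiableAt hU g (hmem e he 0)) α
  have happly : ∀ g, ∀ e ∈ Metric.ball (0 : BaseSpace m ke kh kf) r₀, ∀ q,
      ρ g (e.1, q, e.2) = (e.1, q + torusPart (ρ g) e, W g e) := fun g e he q =>
    (hρ.preserves g).apply_eq hU (fun z hz => hρ.mdifferentiableAt hU g hz) (hmem e he) q
  have hW0 : ∀ g, W g 0 = 0 := fun g =>
    transversePart_eq_zero (hE g 0 (Metric.mem_ball_self hr₀))
  obtain ⟨u, hus, hu, hureal⟩ := exists_multiplier hr₀ hWs hE
  have hsub : Metric.ball (0 : BaseSpace m ke kh kf) (r₀ / 4) ⊆ Metric.ball 0 r₀ :=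
    Metric.ball_subset_ball (by linarith)
  have hr₄ : 0 < r₀ / 4 := by positivity
  have h0mem : (0 : BaseSpace m ke kh kf) ∈ Metric.ball 0 (r₀ / 4) := Metric.mem_ball_self hr₄
  -- Composition laws of the components, as long as the points stay in the polydisc.
  have hmul : ∀ g h, ∀ e ∈ Metric.ball (0 : BaseSpace m ke kh kf) r₀,
      (e.1, W h e) ∈ Metric.ball (0 : BaseSpace m ke kh kf) r₀ →
      torusPart (ρ (g * h)) e = torusPart (ρ g) (e.1, W h e) + torusPart (ρ h) e ∧
      W (g * h) e = W g (e.1, W h e) := by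
    intro g h e he he'
    have h1 := hρ.mul_act g h _ (hmem e he 0)
    rw [happly h e he, happly (g * h) e he, happly g (e.1, W h e) he'] at h1
    have h2 := Prod.ext_iff.1 (Prod.ext_iff.1 h1).2
    refine ⟨?_, h2.2⟩
    have h3 : 0 + torusPart (ρ (g * h)) e = 0 + torusPart (ρ h) e +
      torusPart (ρ g) (e.1, W h e) := h2.1
    rw [zero_add, zero_add] at h3
    rw [h3, add_comm]
  have hone : ∀ e ∈ Metric.ball (0 : BaseSpace m ke kh kf) r₀,
      torusPart (ρ (1 : G)) e = 0 ∧ W 1 e = e.2 := by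
    intro e he
    have h1 := hρ.one_act _ (hmem e he 0)
    exact ⟨congrArg (fun z : PhaseSpace m ke kh kf => z.2.1) h1,
      congrArg (fun z : PhaseSpace m ke kh kf => z.2.2) h1⟩
  -- By compactness, a single neighborhood of the origin works for all group elements.
  have hcW : ∀ g, ContinuousAt (fun a : BaseSpace m ke kh kf × G => W a.2 a.1) (0, g) := fun g =>
    ContinuousAt.comp (g := fun a : G × BaseSpace m ke kh kf => W a.1 a.2)
      (f := fun a : BaseSpace m ke kh kf × G => (a.2, a.1))
      (hWs g trivial 0 (hsub h0mem)).continuousAt (by fun_prop)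
  have hev : ∀ s > 0, ∀ᶠ e in 𝓝 (0 : BaseSpace m ke kh kf), ∀ g : G,
      (e.1, W g e) ∈ Metric.ball (0 : BaseSpace m ke kh kf) s := by
    intro s hs
    have h1 := isCompact_univ.eventually_forall_of_forall_eventually
      (x₀ := (0 : BaseSpace m ke kh kf)) (K := (Set.univ : Set G))
      (P := fun e g => (e.1, W g e) ∈ Metric.ball (0 : BaseSpace m ke kh kf) s) (by
        intro g _
        have h2 : ContinuousAt (fun a : BaseSpace m ke kh kf × G => (a.1.1, W a.2 a.1)) (0, g) :=
          ContinuousAt.prodMk (by fun_prop) (hcW g)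
        refine h2.preimage_mem_nhds ?_
        simp only [hW0]
        exact Metric.ball_mem_nhds _ hs)
    filter_upwards [h1] with e he g using he g trivial
  obtain ⟨r₁, hr₁, hr₁'⟩ := Metric.eventually_nhds_iff_ball.1
    ((hev _ hr₄).and (Metric.ball_mem_nhds _ hr₄))
  have huc : ∀ g, ContinuousOn (u g) (Metric.ball 0 (r₀ / 4)) := fun g e he =>
    (hus.contDiffAt trivial he).continuousAt.continuousWithinAt
  have hucocycle : ∀ g h, ∀ e ∈ Metric.ball (0 : BaseSpace m ke kh kf) r₁,
      u (g * h) e = u g (e.1, W h e) * u h e := by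
    intro g h
    refine eqOn_of_lead_ne_zero Metric.isOpen_ball
      ((huc _).mono fun e he => (hr₁' e he).2) ?_ fun e he hne => ?_
    · refine ContinuousOn.mul ?_ ((huc _).mono fun e he => (hr₁' e he).2)
      refine (huc g).comp (f := fun e : BaseSpace m ke kh kf => (e.1, W h e)) ?_
        fun e he => (hr₁' e he).1 h
      exact continuousOn_fst.prodMk fun e he =>
        (hWs.contDiffAt trivial (hsub (hr₁' e he).2)).continuousAt.continuousWithinAt
    · obtain ⟨h1, h2⟩ := hr₁' e he
      have h3 := congrArg lead (hmul g h e (hsub h2) (hsub (h1 h))).2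
      rw [hu _ _ h2, hu _ _ (h1 h), hu _ _ h2] at h3
      funext k
      have h4 := congrFun h3 k
      simp only [Pi.mul_apply] at h4 ⊢
      rw [← mul_assoc] at h4
      exact mul_right_cancel₀ (hne k) h4
  set v : G → BlockVector ke kh kf := fun g => u g 0 with hv
  set t : G → Torus m := fun g => torusPart (ρ g) 0 with ht
  have hbase0 : ∀ g, (((0 : BaseSpace m ke kh kf).1, W g 0) : BaseSpace m ke kh kf) = 0 :=
    fun g => by rw [hW0]; rfl
  have hvmul : ∀ g h, v (g * h) = v g * v h := fun g h => by
    have := hucocycle g h 0 (Metric.mem_ball_self hr₁)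
    rwa [hbase0] at this
  have hvone : v 1 = 1 := by
    have h1 : Set.EqOn (u 1) 1 (Metric.ball 0 (r₀ / 4)) := by
      refine eqOn_of_lead_ne_zero Metric.isOpen_ball (huc 1) continuousOn_const fun e he hne => ?_
      have h2 := hu 1 e he
      rw [(hone e (hsub he)).2] at h2
      funext k
      have h3 := congrFun h2 k
      exact mul_right_cancel₀ (hne k) (by simpa using h3.symm)
    exact h1 h0mem
  have hvsmooth : ContMDiff 𝓘(ℝ, EG) 𝓘(ℝ, BlockVector ke kh kf) ∞ v := fun g =>
    ContMDiffAt.comp (g := fun a : G × BaseSpace m ke kh kf => u a.1 a.2) g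
      (hus g trivial 0 h0mem) (contMDiffAt_id.prodMk contMDiffAt_const)
  have hvnorm : ∀ g k, ‖v g k‖ = 1 := fun g k =>
    norm_eq_one_of_hom (v := fun g => v g k) ((continuous_apply k).comp hvsmooth.continuous)
      (congrFun hvone k) (fun g h => congrFun (hvmul g h) k) g
  have hvne : ∀ g k, v g k ≠ 0 := fun g k =>
    norm_ne_zero_iff.1 (by rw [hvnorm]; exact one_ne_zero)
  have htmul : ∀ g h, t (g * h) = t g + t h := fun g h => by
    have := (hmul g h 0 (hsub h0mem) (by rw [hbase0]; exact hsub h0mem)).1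
    rwa [hbase0] at this
  have htone : t 1 = 0 := (hone 0 (hsub h0mem)).1
  have htsmooth : ContMDiff 𝓘(ℝ, EG) 𝓘(ℝ, Fin m → ℝ) ∞ t := fun g =>
    ContMDiffAt.comp (g := fun a : G × BaseSpace m ke kh kf => torusPart (ρ a.1) a.2) g
      (hρ.contMDiffAt_torusPart hU g (hmem 0 (hsub h0mem) 0))
      (contMDiffAt_id.prodMk contMDiffAt_const)
  -- The torus components relative to `t`, as a smooth family.
  have hτ : ∀ g, ∀ e ∈ Metric.ball (0 : BaseSpace m ke kh kf) r₀,
      ContMDiffAt ((𝓘(ℝ, EG)).prod 𝓘(ℝ, BaseSpace m ke kh kf)) 𝓘(ℝ, Fin m → ℝ) ∞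
        (fun a : G × BaseSpace m ke kh kf => torusPart (ρ a.1) a.2 + -t a.1) (g, e) := by
    intro g e he
    exact ContMDiffAt.comp (g := fun q : Torus m × Torus m => q.1 + q.2) (g, e)
      Torus.contMDiff_add.contMDiffAt
      ((hρ.contMDiffAt_torusPart hU g (hmem e he 0)).prodMk
        (ContMDiffAt.comp (g := fun q : Torus m => -q) (I' := 𝓘(ℝ, Fin m → ℝ)) (g, e)
          Torus.contMDiff_neg.contMDiffAt
          (ContMDiffAt.comp (I' := 𝓘(ℝ, EG)) (g, e) htsmooth.contMDiffAt contMDiffAt_fst)))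
  -- The bound `1 / 8` makes the lifts of three elements of `N` small compared with the periods;
  -- likewise multipliers with positive real part have logarithms with imaginary part in
  -- `(-π / 2, π / 2)`. This makes the cocycle equation hold for the chosen lifts and logarithms.
  set N : Set (Torus m) := {q | q ∈ (Torus.section_ (0 : Fin m → ℝ)).source ∧
    ‖Torus.section_ (0 : Fin m → ℝ) q‖ < 1 / 8} with hN
  have hN0 : N ∈ 𝓝 (0 : Torus m) := by
    have h1 : (Torus.section_ (0 : Fin m → ℝ)).source ∈ 𝓝 (0 : Torus m) :=
      (Torus.section_ 0).open_source.mem_nhds (Torus.mem_section_source 0)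
    have h2 : ContinuousAt (Torus.section_ (0 : Fin m → ℝ)) (0 : Torus m) :=
      (Torus.section_ 0).continuousAt (Torus.mem_section_source 0)
    have h3 : Torus.section_ (0 : Fin m → ℝ) (0 : Torus m) = 0 := Torus.section_proj 0
    have h4 := h2.norm.eventually_lt_const (u := 1 / 8) (by
      change ‖Torus.section_ (0 : Fin m → ℝ) (0 : Torus m)‖ < 1 / 8
      rw [h3]; norm_num)
    filter_upwards [h1, h4] with q hq hq' using ⟨hq, hq'⟩
  have hev₂ : ∀ᶠ e in 𝓝 (0 : BaseSpace m ke kh kf), ∀ g ∈ (Set.univ : Set G),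
      torusPart (ρ g) e + -t g ∈ N ∧ ∀ k, 0 < (u g e k / v g k).re := by
    refine isCompact_univ.eventually_forall_of_forall_eventually
      (P := fun e g => torusPart (ρ g) e + -t g ∈ N ∧ ∀ k, 0 < (u g e k / v g k).re)
      fun g _ => Filter.Eventually.and ?_ ?_
    · have h1 : ContinuousAt (fun a : BaseSpace m ke kh kf × G =>
          torusPart (ρ a.2) a.1 + -t a.2) (0, g) :=
        ContinuousAt.comp (g := fun a : G × BaseSpace m ke kh kf => torusPart (ρ a.1) a.2 + -t a.1)
          (f := fun a : BaseSpace m ke kh kf × G => (a.2, a.1))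
          (hτ g 0 (hsub h0mem)).continuousAt (by fun_prop)
      refine h1.preimage_mem_nhds ?_
      simp only [ht, add_neg_cancel]
      exact hN0
    · refine Filter.eventually_all.2 fun k => ?_
      have h1 : ContinuousAt (fun a : BaseSpace m ke kh kf × G => u a.2 a.1) (0, g) :=
        ContinuousAt.comp (g := fun a : G × BaseSpace m ke kh kf => u a.1 a.2)
          (f := fun a : BaseSpace m ke kh kf × G => (a.2, a.1))
          (hus g trivial 0 h0mem).continuousAt (by fun_prop)
      have h2 : ContinuousAt (fun a : BaseSpace m ke kh kf × G => v a.2) (0, g) :=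
        hvsmooth.continuous.continuousAt.comp continuousAt_snd
      have h3 : ContinuousAt (fun a : BaseSpace m ke kh kf × G =>
          (u a.2 a.1 k / v a.2 k).re) (0, g) :=
        Complex.continuous_re.continuousAt.comp
          ((continuousAt_pi.1 h1 k).div (continuousAt_pi.1 h2 k) (hvne g k))
      refine h3.eventually_const_lt ?_
      change 0 < (v g k / v g k).re
      rw [div_self (hvne g k)]
      norm_num
  obtain ⟨r₂, hr₂, hr₂'⟩ := Metric.eventually_nhds_iff_ball.1
    (hev₂.and (Metric.ball_mem_nhds (0 : BaseSpace m ke kh kf) hr₁))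
  have hb₂ : ∀ e ∈ Metric.ball (0 : BaseSpace m ke kh kf) r₂,
      e ∈ Metric.ball (0 : BaseSpace m ke kh kf) (r₀ / 4) := fun e he =>
    (hr₁' e (hr₂' e he).2).2
  set a : G → BaseSpace m ke kh kf → (Fin m → ℝ) × BlockVector ke kh kf := fun g e =>
    (Torus.section_ 0 (torusPart (ρ g) e + -t g), fun k => Complex.log (u g e k / v g k)) with ha
  have haproj : ∀ g, ∀ e ∈ Metric.ball (0 : BaseSpace m ke kh kf) r₂,
      t g + Torus.proj m (a g e).1 = torusPart (ρ g) e := fun g e he => by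
    simp only [ha]
    rw [Torus.proj_section ((hr₂' e he).1 g trivial).1.1]
    abel
  have haexp : ∀ g, ∀ e ∈ Metric.ball (0 : BaseSpace m ke kh kf) r₂, ∀ k,
      v g k * Complex.exp ((a g e).2 k) = u g e k := fun g e he k => by
    have h1 : u g e k / v g k ≠ 0 := fun h => by
      have := ((hr₂' e he).1 g trivial).2 k
      rw [h] at this
      simp at this
    simp only [ha]
    rw [Complex.exp_log h1, mul_div_cancel₀ _ (hvne g k)]
  have hsa : SmoothFamilyOn EG a Set.univ (Metric.ball 0 r₂) := by
    refine SmoothFamilyOn.prodMk (f := fun g e => (a g e).1) (f' := fun g e => (a g e).2) ?_ ?_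
    · intro g _ e he
      exact ContMDiffAt.comp (g := Torus.section_ (0 : Fin m → ℝ)) (g, e)
        (Torus.contMDiffAt_section ((hr₂' e he).1 g trivial).1.1) (hτ g e (hsub (hb₂ e he)))
    · have h1 : SmoothFamilyOn EG u Set.univ (Metric.ball 0 r₂) := hus.mono hb₂
      have h2 : SmoothFamilyOn EG (fun g (_ : BaseSpace m ke kh kf) => v g) Set.univ
          (Metric.ball 0 r₂) := fun g _ e _ =>
        ContMDiffAt.comp (I' := 𝓘(ℝ, EG)) (g, e) hvsmooth.contMDiffAt contMDiffAt_fst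
      refine (h1.prodMk h2).postcomp
        (φ := fun b : BlockVector ke kh kf × BlockVector ke kh kf =>
          fun k => Complex.log (b.1 k / b.2 k)) fun g _ e he => contDiffAt_pi.2 fun k => ?_
      have h3 : ContDiffAt ℝ ∞ (fun b : BlockVector ke kh kf × BlockVector ke kh kf =>
          b.1 k / b.2 k) (u g e, v g) := by
        simp only [div_eq_mul_inv]
        refine ContDiffAt.mul (by fun_prop) (ContDiffAt.inv (by fun_prop) (hvne g k))
      exact ((Complex.contDiffAt_log (n := ∞)
        (Or.inl (((hr₂' e he).1 g trivial).2 k))).restrict_scalars ℝ).comp (u g e, v g) h3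
  have hWact : ∀ g, ∀ e ∈ Metric.ball (0 : BaseSpace m ke kh kf) r₂,
      W g e = act (v g) (v g) (flow (a g e).2 e.2) := by
    intro g
    have hreal : ∀ i, (v g (.inr (.inl i))).im = 0 := fun i => hureal g 0 i
    have hca : ContinuousOn (fun e => act (v g) (v g) (flow (a g e).2 e.2))
        (Metric.ball 0 r₂) := by
      have h1 : ContinuousOn (fun e => (a g e).2) (Metric.ball 0 r₂) := fun e he =>
        (hsa.contDiffAt trivial he).continuousAt.snd.continuousWithinAt
      have h2 : ContinuousOn (fun e : BaseSpace m ke kh kf => flow (a g e).2 e.2)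
          (Metric.ball 0 r₂) :=
        contDiff_flow.continuous.comp_continuousOn
          (f := fun e : BaseSpace m ke kh kf => ((a g e).2, e.2)) (h1.prodMk continuousOn_snd)
      have h3 := (actL (v g, v g)).continuous.comp_continuousOn h2
      exact h3
    refine eqOn_of_lead_ne_zero Metric.isOpen_ball (fun e he =>
      (hWs.contDiffAt trivial (hsub (hb₂ e he))).continuousAt.continuousWithinAt) hca
      fun e he hne => ?_
    refine eq_act_flow_of_lead (hvnorm g) hreal (fun i => ?_) hne (fun k => ?_)
      ((hρ.preserves g).quadraticMap_transversePart (hmem e (hsub (hb₂ e he)) 0))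
    · simp only [ha, Complex.log_im]
      refine Complex.arg_eq_zero_iff.2 ⟨(((hr₂' e he).1 g trivial).2 _).le, ?_⟩
      rw [Complex.div_im, hureal g e i, hreal i]
      simp
    · rw [hu g e (hb₂ e he), haexp g e he k, Pi.mul_apply]
  refine ⟨r₂, hr₂, t, v, a, ⟨fun e he q => hmem e (hsub (hb₂ e he)) q, hsa, fun g => ?_,
    fun g e he q => ?_, ?_, fun s hs => ?_, htsmooth, hvsmooth, htone, htmul, hvone, hvmul, hvnorm,
    fun g i => hureal g 0 i⟩⟩
  · refine Prod.ext ?_ ?_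
    · simp only [ha, ht, add_neg_cancel]
      exact Torus.section_proj 0
    · funext k
      change Complex.log (v g k / v g k) = 0
      rw [div_self (hvne g k), Complex.log_one]
  · rw [happly g e (hsub (hb₂ e he)), haproj g e he, hWact g e he]
  · filter_upwards [Metric.ball_mem_nhds _ hr₂, hev r₂ hr₂] with e he he' g h
    rw [← hWact h e he]
    obtain ⟨hm1, hm2⟩ := hmul g h e (hsub (hb₂ e he)) (hsub (hb₂ _ (he' h)))
    -- Both sides are lifts of the same element and are small, so they agree.
    refine Prod.ext (Torus.eq_of_proj_eq ?_ ?_) ?_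
    · have h1 := haproj (g * h) e he
      rw [hm1, ← haproj g _ (he' h), ← haproj h e he, htmul] at h1
      have h2 : Torus.proj m (a (g * h) e).1 = Torus.proj m (a g (e.1, W h e)).1 +
          Torus.proj m (a h e).1 := by
        refine add_left_cancel (a := t g + t h) (h1.trans ?_)
        abel
      rw [h2]
      rfl
    · have h1 : ‖(a (g * h) e).1‖ < 1 / 8 := ((hr₂' e he).1 (g * h) trivial).1.2
      have h2 : ‖(a g (e.1, W h e)).1‖ < 1 / 8 := ((hr₂' _ (he' h)).1 g trivial).1.2
      have h3 : ‖(a h e).1‖ < 1 / 8 := ((hr₂' e he).1 h trivial).1.2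
      have h4 := norm_sub_le (a (g * h) e).1 ((a g (e.1, W h e)).1 + (a h e).1)
      have h5 := norm_add_le (a g (e.1, W h e)).1 (a h e).1
      refine h4.trans_lt ?_
      linarith
    · funext k
      have him : ∀ g, ∀ e ∈ Metric.ball (0 : BaseSpace m ke kh kf) r₂,
          |((a g e).2 k).im| < Real.pi / 2 := fun g e he => by
        simp only [ha, Complex.log_im]
        exact Complex.abs_arg_lt_pi_div_two_iff.2 (Or.inl (((hr₂' e he).1 g trivial).2 k))
      have h1 := abs_lt.1 (him (g * h) e he)
      have h2 := abs_lt.1 (him g _ (he' h))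
      have h3 := abs_lt.1 (him h e he)
      have hpi := Real.pi_pos
      refine Complex.exp_inj_of_neg_pi_lt_of_le_pi (by linarith) (by linarith) ?_ ?_ ?_
      · change -Real.pi < ((a g (e.1, W h e)).2 k + (a h e).2 k).im
        rw [Complex.add_im]; linarith
      · change ((a g (e.1, W h e)).2 k + (a h e).2 k).im ≤ Real.pi
        rw [Complex.add_im]; linarith
      · change _ = Complex.exp ((a g (e.1, W h e)).2 k + (a h e).2 k)
        have h4 := congrFun (hucocycle g h e (hr₂' e he).2) k
        rw [Pi.mul_apply, ← haexp (g * h) e he, ← haexp g _ (he' h), ← haexp h e he, hvmul,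
          Pi.mul_apply] at h4
        rw [Complex.exp_add]
        refine mul_left_cancel₀ (mul_ne_zero (hvne g k) (hvne h k)) (h4.trans ?_)
        ring
  · filter_upwards [Metric.ball_mem_nhds _ hr₂, hev s hs] with e he he' h
    rw [← hWact h e he]
    exact he' h

end Action

/-! ### The linear action -/

theorem flow_act_comm {u : BlockVector ke kh kf} (hu : ∀ i, (u (.inr (.inl i))).im = 0)
    (α : BlockVector ke kh kf) (w : TransverseSpace ke kh kf) :
    flow α (act u u w) = act u u (flow α w) := by
  rw [flow_apply, flow_apply, act_act fun i => ⟨hu i, hu i⟩, act_act fun i => exp_mk_zero_im _,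
    mul_comm u, mul_comm u]

/-- Unit multipliers preserve the Euclidean norm. -/
theorem sum_sq_act {u : BlockVector ke kh kf} (hu : ∀ k, ‖u k‖ = 1)
    (hr : ∀ i, (u (.inr (.inl i))).im = 0) (w : TransverseSpace ke kh kf) :
    ∑ j, ((act u u w j).1 ^ 2 + (act u u w j).2 ^ 2) = ∑ j, ((w j).1 ^ 2 + (w j).2 ^ 2) := by
  have h1 : ∀ k, (u k).re * (u k).re + (u k).im * (u k).im = 1 := fun k => by
    rw [← Complex.normSq_apply, Complex.normSq_eq_norm_sq, hu k, one_pow]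
  simp only [Fintype.sum_sum_type, Fintype.sum_prod_type, Fin.sum_univ_two]
  refine congrArg₂ (· + ·) (Finset.sum_congr rfl fun i _ => ?_)
    (congrArg₂ (· + ·) (Finset.sum_congr rfl fun i _ => ?_)
      (Finset.sum_congr rfl fun i _ => ?_))
  · simp only [act]
    linear_combination ((w (.inl i)).1 ^ 2 + (w (.inl i)).2 ^ 2) * h1 (.inl i)
  · simp only [act]
    have h2 := h1 (.inr (.inl i))
    rw [hr i] at h2
    linear_combination ((w (.inr (.inl i))).1 ^ 2 + (w (.inr (.inl i))).2 ^ 2) * h2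
  · simp only [act]
    linear_combination (((w (.inr (.inr (i, 0)))).1 ^ 2 + (w (.inr (.inr (i, 0)))).2 ^ 2) +
      ((w (.inr (.inr (i, 1)))).1 ^ 2 + (w (.inr (.inr (i, 1)))).2 ^ 2)) * h1 (.inr (.inr i))

/-- The linear map `(p, q, w) ↦ (p, q + t, u • w)`. -/
def linearMap (t : Torus m) (u : BlockVector ke kh kf) (z : PhaseSpace m ke kh kf) :
    PhaseSpace m ke kh kf := (z.1, z.2.1 + t, act u u z.2.2)

/-- The derivative of `linearMap`. -/
def linearMapDeriv (u : BlockVector ke kh kf) :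
    PhaseVector m ke kh kf →L[ℝ] PhaseVector m ke kh kf :=
  (ContinuousLinearMap.fst ℝ _ _).prod
    (((ContinuousLinearMap.fst ℝ _ _).comp (ContinuousLinearMap.snd ℝ _ _)).prod
      ((actL (u, u)).comp ((ContinuousLinearMap.snd ℝ _ _).comp (ContinuousLinearMap.snd ℝ _ _))))

theorem linearMapDeriv_apply (u : BlockVector ke kh kf) (v : PhaseVector m ke kh kf) :
    linearMapDeriv u v = (v.1, v.2.1, act u u v.2.2) := rfl

theorem symplecticForm_linearMapDeriv {u : BlockVector ke kh kf} (hu : IsSystemMultiplier u u)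
    (v w : PhaseVector m ke kh kf) :
    symplecticForm (linearMapDeriv u v) (linearMapDeriv u w) = symplecticForm v w := by
  rw [symplecticForm_eq, symplecticForm_eq, linearMapDeriv_apply, linearMapDeriv_apply,
    hu.transverseForm_act]

theorem hasFDerivAt_linearMapDeriv_add (u : BlockVector ke kh kf) (τ : Fin m → ℝ)
    (x : PhaseVector m ke kh kf) :
    HasFDerivAt (fun y : PhaseVector m ke kh kf => linearMapDeriv u y + (0, τ, 0))
      (linearMapDeriv u) x :=
  (linearMapDeriv u).hasFDerivAt.add_const _

theorem linearMap_cover (u : BlockVector ke kh kf) (τ : Fin m → ℝ)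
    (y : PhaseVector m ke kh kf) :
    linearMap (Torus.proj m τ) u (cover y) = cover (linearMapDeriv u y + (0, τ, 0)) := by
  simp [linearMap, cover, linearMapDeriv_apply, Torus.proj_add]

theorem preservesSystem_linearMap {u : BlockVector ke kh kf} (hu : IsSystemMultiplier u u)
    (t : Torus m) (U : Set (PhaseSpace m ke kh kf)) : PreservesSystem U (linearMap t u) := by
  intro z _
  obtain ⟨x, rfl⟩ := cover_surjective z
  obtain ⟨τ, rfl⟩ := Torus.proj_surjective m t
  refine ⟨Prod.ext rfl (hu.quadraticMap_act _), fun v w => ?_⟩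
  rw [(hasMFDerivAt_of_lift (hasFDerivAt_linearMapDeriv_add u τ x)
    (Filter.Eventually.of_forall (linearMap_cover u τ))).mfderiv]
  exact symplecticForm_linearMapDeriv hu v w

section Action

variable {EG : Type*} [NormedAddCommGroup EG] [NormedSpace ℝ EG]
  {G : Type*} [TopologicalSpace G] [ChartedSpace EG G] [Group G]

theorem isLinearAction_linearMap {t : G → Torus m} {u : G → BlockVector ke kh kf}
    (ht : ContMDiff 𝓘(ℝ, EG) 𝓘(ℝ, Fin m → ℝ) ∞ t)
    (hu : ContMDiff 𝓘(ℝ, EG) 𝓘(ℝ, BlockVector ke kh kf) ∞ u)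
    (ht1 : t 1 = 0) (htm : ∀ g h, t (g * h) = t g + t h)
    (hu1 : u 1 = 1) (hum : ∀ g h, u (g * h) = u g * u h)
    (hsys : ∀ g, IsSystemMultiplier (u g) (u g)) (hr : ∀ g i, (u g (.inr (.inl i))).im = 0) :
    IsLinearAction (EG := EG) fun g => linearMap (t g) (u g) := by
  refine ⟨⟨fun g => Set.mapsTo_univ _ _, fun z _ => ?_, fun g h z _ => ?_, ?_,
    fun g => preservesSystem_linearMap (hsys g) _ _⟩, fun g => ⟨t g, (actL (u g, u g) : _ →ₗ[ℝ] _),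
    fun p q w => rfl⟩⟩
  · simp only [linearMap, ht1, hu1, add_zero, act_one]
  · simp only [linearMap, htm, hum, act_act fun i => ⟨hr h i, hr h i⟩]
    rw [add_assoc, add_comm (t h)]
  · refine ContMDiff.contMDiffOn ?_
    have hz : ContMDiff ((𝓘(ℝ, EG)).prod (phaseModel m ke kh kf)) (phaseModel m ke kh kf) ∞
        (fun a : G × PhaseSpace m ke kh kf => a.2) := contMDiff_snd
    have hq : ContMDiff ((𝓘(ℝ, EG)).prod (phaseModel m ke kh kf)) 𝓘(ℝ, Fin m → ℝ) ∞
        (fun a : G × PhaseSpace m ke kh kf => a.2.2.1) :=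
      contMDiff_fst.comp (contMDiff_snd.comp hz)
    have hw : ContMDiff ((𝓘(ℝ, EG)).prod (phaseModel m ke kh kf))
        𝓘(ℝ, TransverseSpace ke kh kf) ∞ (fun a : G × PhaseSpace m ke kh kf => a.2.2.2) :=
      contMDiff_snd.comp (contMDiff_snd.comp hz)
    have hug : ContMDiff ((𝓘(ℝ, EG)).prod (phaseModel m ke kh kf))
        𝓘(ℝ, BlockVector ke kh kf) ∞ (fun a : G × PhaseSpace m ke kh kf => u a.1) :=
      hu.comp contMDiff_fst
    refine (contMDiff_fst.comp hz).prodMk (ContMDiff.prodMk ?_ ?_)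
    · exact ContMDiff.comp (g := fun q : Torus m × Torus m => q.1 + q.2) Torus.contMDiff_add
        (hq.prodMk (ht.comp contMDiff_fst))
    · have h1 : ContDiff ℝ ∞ (fun b : BlockVector ke kh kf × TransverseSpace ke kh kf =>
          act b.1 b.1 b.2) :=
        (actL.contDiff.comp (contDiff_fst.prodMk contDiff_fst)).clm_apply contDiff_snd
      exact ContMDiff.comp
        (g := fun b : BlockVector ke kh kf × TransverseSpace ke kh kf => act b.1 b.1 b.2)
        h1.contMDiff (hug.prodMk_space hw)

end Action

/-! ### Flows with variable times -/

/-- The joint flow of the momenta and the quadratic Hamiltonians, with times depending on the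
point. -/
def timeMap (c : BaseSpace m ke kh kf → (Fin m → ℝ) × BlockVector ke kh kf)
    (z : PhaseSpace m ke kh kf) : PhaseSpace m ke kh kf :=
  (z.1, z.2.1 + Torus.proj m (c (z.1, z.2.2)).1, flow (c (z.1, z.2.2)).2 z.2.2)

/-- The lift of `timeMap` to the universal covering. -/
def timeMapLift (c : BaseSpace m ke kh kf → (Fin m → ℝ) × BlockVector ke kh kf)
    (x : PhaseVector m ke kh kf) : PhaseVector m ke kh kf :=
  (x.1, x.2.1 + (c (x.1, x.2.2)).1, flow (c (x.1, x.2.2)).2 x.2.2)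

theorem timeMap_cover (c : BaseSpace m ke kh kf → (Fin m → ℝ) × BlockVector ke kh kf)
    (x : PhaseVector m ke kh kf) : timeMap c (cover x) = cover (timeMapLift c x) := rfl

/-- The `2`-form `± ∑ dcₖ ∧ dFₖ` at a point with transverse coordinates `w`, evaluated at
`(u, v)`, as a linear functional of the differential of the times `c`. -/
def defect (w : TransverseSpace ke kh kf) (u v : PhaseVector m ke kh kf) :
    (BaseSpace m ke kh kf →L[ℝ] (Fin m → ℝ) × BlockVector ke kh kf) →L[ℝ] ℝ :=
  LinearMap.toContinuousLinearMap
    { toFun := fun L => ∑ i, (u.1 i * (L (v.1, v.2.2)).1 i - v.1 i * (L (u.1, u.2.2)).1 i) +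
        (transverseForm (actL (generator (L (u.1, u.2.2)).2) w) v.2.2 +
          transverseForm u.2.2 (actL (generator (L (v.1, v.2.2)).2) w))
      map_add' := fun L M => by
        simp only [add_apply, Prod.fst_add, Prod.snd_add, map_add, Pi.add_apply, mul_add,
          Finset.sum_add_distrib, Finset.sum_sub_distrib]
        ring
      map_smul' := fun r L => by
        simp only [smul_apply, Prod.smul_fst, Prod.smul_snd, map_smul, Pi.smul_apply, smul_eq_mul,
          RingHom.id_apply, Finset.sum_sub_distrib, mul_add, mul_sub, Finset.mul_sum,
          mul_left_comm r] }

theorem defect_apply (w : TransverseSpace ke kh kf) (u v : PhaseVector m ke kh kf)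
    (L : BaseSpace m ke kh kf →L[ℝ] (Fin m → ℝ) × BlockVector ke kh kf) :
    defect w u v L = ∑ i, (u.1 i * (L (v.1, v.2.2)).1 i - v.1 i * (L (u.1, u.2.2)).1 i) +
        (transverseForm (infFlow (L (u.1, u.2.2)).2 w) v.2.2 +
          transverseForm u.2.2 (infFlow (L (v.1, v.2.2)).2 w)) := rfl

/-- The flow with variable times changes the symplectic form by a `2`-form which is linear in the
differential of the times, because the Hamiltonians Poisson commute. -/
theorem exists_hasFDerivAt_timeMapLift
    {c : BaseSpace m ke kh kf → (Fin m → ℝ) × BlockVector ke kh kf}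
    {c' : BaseSpace m ke kh kf →L[ℝ] (Fin m → ℝ) × BlockVector ke kh kf}
    {x : PhaseVector m ke kh kf} (hc : HasFDerivAt c c' (x.1, x.2.2)) :
    ∃ L : PhaseVector m ke kh kf →L[ℝ] PhaseVector m ke kh kf,
      HasFDerivAt (timeMapLift c) L x ∧ ∀ u v,
        symplecticForm (L u) (L v) = symplecticForm u v + defect x.2.2 u v c' := by
  have h0 : HasFDerivAt (fun y : PhaseVector m ke kh kf => ((y.1, y.2.2) : BaseSpace m ke kh kf))
      ((ContinuousLinearMap.fst ℝ _ _).prod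
        ((ContinuousLinearMap.snd ℝ _ _).comp (ContinuousLinearMap.snd ℝ _ _))) x :=
    hasFDerivAt_fst.prodMk (hasFDerivAt_snd.comp x hasFDerivAt_snd)
  have h1 := hc.comp x h0
  have h2 := (hasFDerivAt_fst (𝕜 := ℝ) (p := x)).prodMk
    ((((hasFDerivAt_fst (𝕜 := ℝ) (p := x.2)).comp x hasFDerivAt_snd).add h1.fst).prodMk
      (hasFDerivAt_flow h1.snd ((hasFDerivAt_snd (𝕜 := ℝ) (p := x.2)).comp x hasFDerivAt_snd)))
  refine ⟨_, h2, fun u v => ?_⟩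
  change symplecticForm
    (u.1, u.2.1 + (c' (u.1, u.2.2)).1, flow (c (x.1, x.2.2)).2
      (u.2.2 + infFlow (c' (u.1, u.2.2)).2 x.2.2))
    (v.1, v.2.1 + (c' (v.1, v.2.2)).1, flow (c (x.1, x.2.2)).2
      (v.2.2 + infFlow (c' (v.1, v.2.2)).2 x.2.2)) = _
  rw [symplecticForm_eq, symplecticForm_eq, transverseForm_flow, defect_apply]
  simp only [map_add, add_apply, transverseForm_infFlow_infFlow, Pi.add_apply, mul_add,
    Finset.sum_sub_distrib, Finset.sum_add_distrib]
  ring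

section Action

variable {EG : Type*} [NormedAddCommGroup EG] [NormedSpace ℝ EG]
  {G : Type*} [TopologicalSpace G] [ChartedSpace EG G] [Group G]
  {U : Set (PhaseSpace m ke kh kf)} {ρ : G → PhaseSpace m ke kh kf → PhaseSpace m ke kh kf}
  {r : ℝ} {t : G → Torus m} {u : G → BlockVector ke kh kf}
  {a : G → BaseSpace m ke kh kf → (Fin m → ℝ) × BlockVector ke kh kf}

theorem IsFlowForm.isSystemMultiplier (F : IsFlowForm EG U ρ r t u a) (g : G) :
    IsSystemMultiplier (u g) (u g) :=
  isSystemMultiplier_of_norm (F.norm_u g) (F.u_real g)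

/-- Since the action is symplectic, the times of its flow form satisfy `∑ daₖ ∧ dFₖ = 0`. -/
theorem IsFlowForm.defect_eq_zero (F : IsFlowForm EG U ρ r t u a)
    (hρ : ∀ g, PreservesSystem U (ρ g)) (g : G) {e : BaseSpace m ke kh kf}
    (he : e ∈ Metric.ball 0 r) (v v' : PhaseVector m ke kh kf) :
    defect e.2 v v' (fderiv ℝ (a g) e) = 0 := by
  set x : PhaseVector m ke kh kf := (e.1, 0, e.2) with hx
  obtain ⟨L, hL, hL'⟩ := exists_hasFDerivAt_timeMapLift (x := x)
    (F.smooth.hasFDerivAt (Set.mem_univ g) he)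
  obtain ⟨τ, hτ⟩ := Torus.proj_surjective m (t g)
  have h1 := (hasFDerivAt_linearMapDeriv_add (u g) τ (timeMapLift (a g) x)).comp x hL
  have hc : Continuous fun y : PhaseVector m ke kh kf => ((y.1, y.2.2) : BaseSpace m ke kh kf) := by
    fun_prop
  have h2 : ∀ᶠ y in 𝓝 x, ρ g (cover y) =
      cover (linearMapDeriv (u g) (timeMapLift (a g) y) + (0, τ, 0)) := by
    filter_upwards [(Metric.isOpen_ball.preimage hc).mem_nhds (x := x) he] with y hy
    rw [← linearMap_cover, hτ, ← timeMap_cover]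
    have h3 := F.apply_eq g (y.1, y.2.2) hy (Torus.proj m y.2.1)
    refine h3.trans ?_
    simp only [linearMap, timeMap, cover]
    rw [add_assoc, add_comm (t g)]
  have h3 := (hρ g (cover x) (F.mem e he _)).2 v v'
  rw [(hasMFDerivAt_of_lift h1 h2).mfderiv] at h3
  have h4 : symplecticForm (linearMapDeriv (u g) (L v)) (linearMapDeriv (u g) (L v')) =
    symplecticForm v v' := h3
  rw [symplecticForm_linearMapDeriv (F.isSystemMultiplier g), hL'] at h4
  linarith

end Action

/-! ### Averaging the times -/

section Average

open MeasureTheory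

theorem exists_rightInvariant_probability (G : Type*) [TopologicalSpace G] [Group G]
    [IsTopologicalGroup G] [CompactSpace G] [MeasurableSpace G] [BorelSpace G] :
    ∃ μ : Measure G, IsProbabilityMeasure μ ∧ μ.IsMulRightInvariant := by
  set ν : Measure G := Measure.haarMeasure ⊤ with hν
  have h1 : ν Set.univ = 1 := by
    have := Measure.haarMeasure_self (K₀ := (⊤ : TopologicalSpace.PositiveCompacts G))
    simpa using this
  refine ⟨ν.inv, ⟨?_⟩, inferInstance⟩
  rw [Measure.inv_apply, Set.inv_univ, h1]

variable {EG : Type*} [NormedAddCommGroup EG] [NormedSpace ℝ EG]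
  {G : Type*} [TopologicalSpace G] [ChartedSpace EG G] [Group G]
  [LieGroup 𝓘(ℝ, EG) ∞ G] [T2Space G] [CompactSpace G]
  {U : Set (PhaseSpace m ke kh kf)} {ρ : G → PhaseSpace m ke kh kf → PhaseSpace m ke kh kf}
  {r : ℝ} {t : G → Torus m} {u : G → BlockVector ke kh kf}
  {a : G → BaseSpace m ke kh kf → (Fin m → ℝ) × BlockVector ke kh kf}

/-- The Haar average of the times is a smooth primitive of the cocycle, and the flow with these
times is still symplectic. -/
theorem IsFlowForm.exists_average (F : IsFlowForm EG U ρ r t u a) (hr : 0 < r)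
    (hρ : ∀ g, PreservesSystem U (ρ g)) :
    ∃ c : BaseSpace m ke kh kf → (Fin m → ℝ) × BlockVector ke kh kf,
      ContDiffOn ℝ ∞ c (Metric.ball 0 r) ∧ c 0 = 0 ∧
      (∀ e ∈ Metric.ball (0 : BaseSpace m ke kh kf) r, ∀ v v',
        defect e.2 v v' (fderiv ℝ c e) = 0) ∧
      ∀ᶠ e in 𝓝 (0 : BaseSpace m ke kh kf), ∀ h,
        c (e.1, act (u h) (u h) (flow (a h e).2 e.2)) + a h e = c e := by
  have := topologicalGroup_of_lieGroup 𝓘(ℝ, EG) ∞ (G := G)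
  borelize G
  obtain ⟨μ, hμ, hμr⟩ := exists_rightInvariant_probability G
  have hint : ∀ e ∈ Metric.ball (0 : BaseSpace m ke kh kf) r, Integrable (fun g => a g e) μ := by
    intro e he
    rw [← integrableOn_univ]
    exact F.smooth.integrableOn isCompact_univ he
  refine ⟨fun e => ∫ g in Set.univ, a g e ∂μ,
    F.smooth.contDiffOn_integral isCompact_univ Metric.isOpen_ball, ?_, fun e he v v' => ?_, ?_⟩
  · simp [F.zero]
  · rw [(F.smooth.hasFDerivAt_integral isCompact_univ Metric.isOpen_ball he).fderiv,
      ← ContinuousLinearMap.integral_comp_comm _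
        (F.smooth.fderiv.integrableOn isCompact_univ he)]
    simp only [F.defect_eq_zero hρ _ he, integral_zero]
  -- Right invariance of the measure turns the cocycle equation into the equation for `c`.
  · filter_upwards [F.cocycle, F.maps r hr, Metric.ball_mem_nhds _ hr] with e hco hmaps he h
    simp only [Measure.restrict_univ]
    rw [← integral_mul_right_eq_self (fun g => a g e) h]
    simp only [hco]
    rw [integral_add (hint _ (hmaps h)) (integrable_const _), integral_const]
    simp

end Average

/-! ### The linearizing diffeomorphism -/

/-- The map induced by `timeMap c` on the coordinates `(p, w)`. -/
def baseTimeMap (c : BaseSpace m ke kh kf → (Fin m → ℝ) × BlockVector ke kh kf)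
    (e : BaseSpace m ke kh kf) : BaseSpace m ke kh kf := (e.1, flow (c e).2 e.2)

/-- The product of Euclidean balls of radius `ε` in the coordinates `(p, w)`. -/
def baseTube (m ke kh kf : ℕ) (ε : ℝ) : Set (BaseSpace m ke kh kf) :=
  {e | ∑ i, e.1 i ^ 2 < ε ^ 2 ∧ ∑ j, ((e.2 j).1 ^ 2 + (e.2 j).2 ^ 2) < ε ^ 2}

theorem isOpen_baseTube (ε : ℝ) : IsOpen (baseTube m ke kh kf ε) := by
  have h1 : Continuous fun e : BaseSpace m ke kh kf => ∑ i, e.1 i ^ 2 := by fun_prop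
  have h2 : Continuous fun e : BaseSpace m ke kh kf =>
    ∑ j, ((e.2 j).1 ^ 2 + (e.2 j).2 ^ 2) := by fun_prop
  exact (isOpen_lt h1 continuous_const).inter (isOpen_lt h2 continuous_const)

theorem baseTube_subset_ball {ε : ℝ} (hε : 0 < ε) :
    baseTube m ke kh kf ε ⊆ Metric.ball 0 ε := by
  intro e he
  rw [mem_ball_zero_iff]
  refine max_lt ((pi_norm_lt_iff hε).2 fun i => ?_) ((pi_norm_lt_iff hε).2 fun j => ?_)
  · refine abs_lt_of_sq_lt_sq (lt_of_le_of_lt ?_ he.1) hε.le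
    exact Finset.single_le_sum (f := fun i => e.1 i ^ 2) (fun i _ => sq_nonneg _)
      (Finset.mem_univ i)
  · have h1 : (e.2 j).1 ^ 2 + (e.2 j).2 ^ 2 < ε ^ 2 := lt_of_le_of_lt
      (Finset.single_le_sum (f := fun j => (e.2 j).1 ^ 2 + (e.2 j).2 ^ 2)
        (fun j _ => by positivity) (Finset.mem_univ j)) he.2
    refine max_lt (abs_lt_of_sq_lt_sq ?_ hε.le) (abs_lt_of_sq_lt_sq ?_ hε.le)
    · nlinarith [sq_nonneg (e.2 j).2]
    · nlinarith [sq_nonneg (e.2 j).1]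

theorem zero_mem_baseTube {ε : ℝ} (hε : 0 < ε) :
    (0 : BaseSpace m ke kh kf) ∈ baseTube m ke kh kf ε := by
  constructor <;> simp [hε]

/-- The flow with smooth variable times vanishing at the origin is a local diffeomorphism in the
coordinates `(p, w)`. -/
theorem exists_openPartialHomeomorph_baseTimeMap
    {c : BaseSpace m ke kh kf → (Fin m → ℝ) × BlockVector ke kh kf} {D : Set (BaseSpace m ke kh kf)}
    (hD : D ∈ 𝓝 0) (hDo : IsOpen D) (hc : ContDiffOn ℝ ∞ c D) (hc0 : c 0 = 0) :
    ∃ P : OpenPartialHomeomorph (BaseSpace m ke kh kf) (BaseSpace m ke kh kf),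
      (P : BaseSpace m ke kh kf → BaseSpace m ke kh kf) = baseTimeMap c ∧ 0 ∈ P.source ∧
      ∃ s > 0, ∀ y ∈ P.target, P.symm y ∈ Metric.ball 0 s → ContDiffAt ℝ ∞ P.symm y := by
  have h0 : (0 : BaseSpace m ke kh kf) ∈ D := mem_of_mem_nhds hD
  have hcd : ∀ e ∈ D, ContDiffAt ℝ ∞ (baseTimeMap c) e := fun e he =>
    contDiffAt_fst.prodMk (contDiff_flow.contDiffAt.comp e
      ((hc.contDiffAt (hDo.mem_nhds he)).snd.prodMk contDiffAt_snd))
  have hder : HasFDerivAt (baseTimeMap c)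
      ((ContinuousLinearEquiv.refl ℝ (BaseSpace m ke kh kf) : _ →L[ℝ] _)) 0 := by
    have h1 := ((hc.contDiffAt hD).differentiableAt (by simp)).hasFDerivAt
    have h2 := (hasFDerivAt_fst (𝕜 := ℝ) (p := (0 : BaseSpace m ke kh kf))).prodMk
      (hasFDerivAt_flow h1.snd (hasFDerivAt_snd (𝕜 := ℝ) (p := (0 : BaseSpace m ke kh kf))))
    refine h2.congr_fderiv (ContinuousLinearMap.ext fun v => ?_)
    change (v.1, flow (c 0).2 (v.2 + infFlow _ (0 : TransverseSpace ke kh kf))) = v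
    rw [hc0, map_zero, add_zero]
    exact Prod.ext rfl (flow_zero v.2)
  set P := (hcd 0 h0).toOpenPartialHomeomorph (baseTimeMap c) hder (by simp) with hP
  have hPc : (P : BaseSpace m ke kh kf → BaseSpace m ke kh kf) = baseTimeMap c := rfl
  have hfd : ContinuousAt (fderiv ℝ (baseTimeMap c)) 0 :=
    ((hcd 0 h0).fderiv_right (m := 0) (by simp)).continuousAt
  have hinv : ∀ᶠ e in 𝓝 (0 : BaseSpace m ke kh kf),
      fderiv ℝ (baseTimeMap c) e ∈ Set.range
        ((↑) : (BaseSpace m ke kh kf ≃L[ℝ] BaseSpace m ke kh kf) → _ →L[ℝ] _) := by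
    refine hfd.preimage_mem_nhds ?_
    rw [hder.fderiv]
    exact ContinuousLinearEquiv.nhds _
  obtain ⟨s, hs, hs'⟩ := Metric.eventually_nhds_iff_ball.1 (hinv.and hD)
  refine ⟨P, hPc, (hcd 0 h0).mem_toOpenPartialHomeomorph_source hder (by simp), s, hs,
    fun y hy hys => ?_⟩
  obtain ⟨⟨L, hL⟩, hyD⟩ := hs' _ hys
  refine P.contDiffAt_symm (f₀' := L) hy ?_ (hPc ▸ hcd _ hyD)
  rw [hPc, hL]
  exact ((hcd _ hyD).differentiableAt (by simp)).hasFDerivAt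

theorem continuousOn_add_proj {f : PhaseSpace m ke kh kf → Fin m → ℝ}
    {D : Set (PhaseSpace m ke kh kf)} (hf : ContinuousOn f D) :
    ContinuousOn (fun z => z.2.1 + Torus.proj m (f z)) D := by
  have h1 : Continuous fun q : Torus m × Torus m => q.1 + q.2 := Torus.contMDiff_add.continuous
  have h2 : Continuous fun z : PhaseSpace m ke kh kf => z.2.1 := by fun_prop
  exact h1.comp_continuousOn
    (h2.continuousOn.prodMk (Torus.continuous_proj.comp_continuousOn hf))

/-- The diffeomorphism between open subsets of the phase space given by `timeMap c`, where
`baseTimeMap c` is a homeomorphism `P` and `c` is continuous. -/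
def timeHomeomorph {c : BaseSpace m ke kh kf → (Fin m → ℝ) × BlockVector ke kh kf}
    (P : OpenPartialHomeomorph (BaseSpace m ke kh kf) (BaseSpace m ke kh kf))
    (hP : (P : BaseSpace m ke kh kf → BaseSpace m ke kh kf) = baseTimeMap c)
    (hc : ContinuousOn c P.source) :
    OpenPartialHomeomorph (PhaseSpace m ke kh kf) (PhaseSpace m ke kh kf) where
  toFun := timeMap c
  invFun z := ((P.symm (z.1, z.2.2)).1,
    z.2.1 + Torus.proj m (-(c (P.symm (z.1, z.2.2))).1), (P.symm (z.1, z.2.2)).2)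
  source := {z | (z.1, z.2.2) ∈ P.source}
  target := {z | (z.1, z.2.2) ∈ P.target}
  map_source' z hz := by
    have := P.map_source hz
    rw [hP] at this
    exact this
  map_target' z hz := P.map_target hz
  left_inv' z hz := by
    have h1 : P.symm (z.1, flow (c (z.1, z.2.2)).2 z.2.2) = (z.1, z.2.2) := by
      have := P.left_inv hz
      rw [hP] at this
      exact this
    simp only [timeMap, h1, Torus.proj_neg, add_neg_cancel_right]
  right_inv' z hz := by
    have h1 : baseTimeMap c (P.symm (z.1, z.2.2)) = (z.1, z.2.2) := by
      rw [← hP]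
      exact P.right_inv hz
    generalize P.symm (z.1, z.2.2) = e at h1 ⊢
    have h2 : e.1 = z.1 := congrArg Prod.fst h1
    have h3 : flow (c e).2 e.2 = z.2.2 := congrArg Prod.snd h1
    simp only [timeMap, Prod.mk.eta, Torus.proj_neg, neg_add_cancel_right, h3]
    rw [h2]
  open_source := P.open_source.preimage (by fun_prop)
  open_target := P.open_target.preimage (by fun_prop)
  continuousOn_toFun := by
    have hb : Continuous fun z : PhaseSpace m ke kh kf =>
      ((z.1, z.2.2) : BaseSpace m ke kh kf) := by fun_prop
    have h1 : ContinuousOn (fun z : PhaseSpace m ke kh kf => c (z.1, z.2.2))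
        {z | (z.1, z.2.2) ∈ P.source} := hc.comp hb.continuousOn fun z hz => hz
    have h2 := contDiff_flow.continuous.comp_continuousOn (h1.snd.prodMk hb.snd.continuousOn)
    exact continuous_fst.continuousOn.prodMk ((continuousOn_add_proj h1.fst).prodMk h2)
  continuousOn_invFun := by
    have hb : Continuous fun z : PhaseSpace m ke kh kf =>
      ((z.1, z.2.2) : BaseSpace m ke kh kf) := by fun_prop
    have h1 : ContinuousOn (fun z : PhaseSpace m ke kh kf => P.symm (z.1, z.2.2))
        {z | (z.1, z.2.2) ∈ P.target} := P.continuousOn_symm.comp hb.continuousOn fun z hz => hz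
    have h2 : ContinuousOn (fun z : PhaseSpace m ke kh kf => c (P.symm (z.1, z.2.2)))
        {z | (z.1, z.2.2) ∈ P.target} := hc.comp h1 fun z hz => P.map_target hz
    exact h1.fst.prodMk ((continuousOn_add_proj h2.fst.neg).prodMk h1.snd)

theorem timeMap_eqOn_centralTorus
    {c : BaseSpace m ke kh kf → (Fin m → ℝ) × BlockVector ke kh kf} (hc0 : c 0 = 0) :
    Set.EqOn (timeMap c) id (centralTorus m ke kh kf) := fun z hz => by
  have h1 : c (z.1, z.2.2) = 0 := by rw [hz.1, hz.2]; exact hc0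
  refine Prod.ext rfl (Prod.ext ?_ ?_)
  · simp [timeMap, h1, Torus.proj_zero]
  · simp [timeMap, hz.2]

theorem contMDiffAt_timeMap {c : BaseSpace m ke kh kf → (Fin m → ℝ) × BlockVector ke kh kf}
    {z : PhaseSpace m ke kh kf} (hc : ContDiffAt ℝ ∞ c (z.1, z.2.2)) :
    ContMDiffAt (phaseModel m ke kh kf) (phaseModel m ke kh kf) ∞ (timeMap c) z := by
  obtain ⟨x, rfl⟩ := cover_surjective z
  have hb : ContDiff ℝ ∞ fun y : PhaseVector m ke kh kf =>
    ((y.1, y.2.2) : BaseSpace m ke kh kf) := by fun_prop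
  have h1 : ContDiffAt ℝ ∞ (fun y : PhaseVector m ke kh kf => c (y.1, y.2.2)) x :=
    ContDiffAt.comp x (g := c) hc hb.contDiffAt
  refine contMDiffAt_of_lift (F := timeMapLift c) ?_ (Filter.Eventually.of_forall (timeMap_cover c))
  exact contDiffAt_fst.prodMk ((contDiffAt_snd.fst.add h1.fst).prodMk
    (contDiff_flow.contDiffAt.comp x (h1.snd.prodMk contDiffAt_snd.snd)))

/-- Smoothness of the inverse of `timeMap c`, where `P` is the inverse of `baseTimeMap c`. -/
theorem contMDiffAt_timeMap_symm
    {c : BaseSpace m ke kh kf → (Fin m → ℝ) × BlockVector ke kh kf}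
    {P : BaseSpace m ke kh kf → BaseSpace m ke kh kf}
    {z : PhaseSpace m ke kh kf} (hP : ContDiffAt ℝ ∞ P (z.1, z.2.2))
    (hc : ContDiffAt ℝ ∞ c (P (z.1, z.2.2))) :
    ContMDiffAt (phaseModel m ke kh kf) (phaseModel m ke kh kf) ∞
      (fun z : PhaseSpace m ke kh kf => (((P (z.1, z.2.2)).1,
        z.2.1 + Torus.proj m (-(c (P (z.1, z.2.2))).1), (P (z.1, z.2.2)).2) :
          PhaseSpace m ke kh kf)) z := by
  obtain ⟨x, rfl⟩ := cover_surjective z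
  have hb : ContDiff ℝ ∞ fun y : PhaseVector m ke kh kf =>
    ((y.1, y.2.2) : BaseSpace m ke kh kf) := by fun_prop
  have h1 : ContDiffAt ℝ ∞ (fun y : PhaseVector m ke kh kf => P (y.1, y.2.2)) x :=
    ContDiffAt.comp x (g := P) hP hb.contDiffAt
  have h2 : ContDiffAt ℝ ∞ (fun y : PhaseVector m ke kh kf => c (P (y.1, y.2.2))) x :=
    ContDiffAt.comp x (g := c) hc h1
  exact contMDiffAt_of_lift (F := fun y : PhaseVector m ke kh kf => ((P (y.1, y.2.2)).1,
    y.2.1 + -(c (P (y.1, y.2.2))).1, (P (y.1, y.2.2)).2))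
    (h1.fst.prodMk ((contDiffAt_snd.fst.add h2.fst.neg).prodMk h1.snd))
    (Filter.Eventually.of_forall fun y => by simp only [cover, Torus.proj_add])

theorem preservesSystem_timeMap
    {c : BaseSpace m ke kh kf → (Fin m → ℝ) × BlockVector ke kh kf}
    {D : Set (PhaseSpace m ke kh kf)}
    (hc : ∀ z ∈ D, ContDiffAt ℝ ∞ c (z.1, z.2.2))
    (hd : ∀ z ∈ D, ∀ v v', defect z.2.2 v v' (fderiv ℝ c (z.1, z.2.2)) = 0) :
    PreservesSystem D (timeMap c) := by
  refine fun z hz => ⟨Prod.ext rfl (quadraticMap_flow _ _), fun v v' => ?_⟩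
  obtain ⟨x, rfl⟩ := cover_surjective z
  obtain ⟨L, hL, hω⟩ := exists_hasFDerivAt_timeMapLift (x := x)
    ((hc _ hz).differentiableAt (by simp)).hasFDerivAt
  rw [(hasMFDerivAt_of_lift hL (Filter.Eventually.of_forall (timeMap_cover c))).mfderiv]
  exact (hω v v').trans (add_eq_left.2 (hd _ hz v v'))

/-- If the times `c` satisfy `c ∘ ρ g + a g = c` at `e`, then the flow with times `c` conjugates
`ρ g` to its linear part. -/
theorem baseTimeMap_act_flow {u : BlockVector ke kh kf}
    (hu : ∀ i, (u (.inr (.inl i))).im = 0)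
    {c : BaseSpace m ke kh kf → (Fin m → ℝ) × BlockVector ke kh kf}
    {e : BaseSpace m ke kh kf} {α : (Fin m → ℝ) × BlockVector ke kh kf}
    (h : c (e.1, act u u (flow α.2 e.2)) + α = c e) :
    baseTimeMap c (e.1, act u u (flow α.2 e.2)) = (e.1, act u u (flow (c e).2 e.2)) := by
  refine Prod.ext rfl ?_
  change flow (c (e.1, act u u (flow α.2 e.2))).2 (act u u (flow α.2 e.2)) = _
  rw [flow_act_comm hu, ← flow_add, ← Prod.snd_add, h]

/-- The averaged times `c`, on a domain invariant under the group which `baseTimeMap c` maps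
diffeomorphically onto a product of balls. -/
theorem IsFlowForm.exists_baseTimeMap {EG : Type*} [NormedAddCommGroup EG] [NormedSpace ℝ EG]
    {G : Type*} [TopologicalSpace G] [ChartedSpace EG G] [Group G]
    [LieGroup 𝓘(ℝ, EG) ∞ G] [T2Space G] [CompactSpace G]
    {U : Set (PhaseSpace m ke kh kf)} {ρ : G → PhaseSpace m ke kh kf → PhaseSpace m ke kh kf}
    {r : ℝ} {t : G → Torus m} {u : G → BlockVector ke kh kf}
    {a : G → BaseSpace m ke kh kf → (Fin m → ℝ) × BlockVector ke kh kf}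
    (F : IsFlowForm EG U ρ r t u a) (hr : 0 < r) (hρ : ∀ g, PreservesSystem U (ρ g)) :
    ∃ ε > 0, ∃ (c : BaseSpace m ke kh kf → (Fin m → ℝ) × BlockVector ke kh kf)
      (Q : OpenPartialHomeomorph (BaseSpace m ke kh kf) (BaseSpace m ke kh kf)),
      (Q : BaseSpace m ke kh kf → BaseSpace m ke kh kf) = baseTimeMap c ∧ c 0 = 0 ∧
      0 ∈ Q.source ∧ Q.source ⊆ Metric.ball 0 r ∧ Q.target = baseTube m ke kh kf ε ∧
      (∀ e ∈ Q.source, ContDiffAt ℝ ∞ c e) ∧ (∀ y ∈ Q.target, ContDiffAt ℝ ∞ Q.symm y) ∧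
      (∀ e ∈ Q.source, ∀ v v', defect e.2 v v' (fderiv ℝ c e) = 0) ∧
      ∀ e ∈ Q.source, ∀ g, (e.1, act (u g) (u g) (flow (a g e).2 e.2)) ∈ Q.source ∧
        c (e.1, act (u g) (u g) (flow (a g e).2 e.2)) + a g e = c e := by
  obtain ⟨c, hc, hc0, hdef, hco⟩ := F.exists_average hr hρ
  obtain ⟨P, hP, hP0, s, hs, hPs⟩ := exists_openPartialHomeomorph_baseTimeMap
    (Metric.ball_mem_nhds _ hr) Metric.isOpen_ball hc hc0
  have hP00 : P 0 = 0 := by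
    rw [hP]
    exact Prod.ext rfl (map_zero _)
  -- Choose `δ` so small that everything is defined on the polydisc of radius `δ`, even after
  -- an application of the group, and then `ε` so small that `Φ⁻¹` maps the tube into it.
  obtain ⟨s₁, hs₁, hs₁'⟩ := Metric.eventually_nhds_iff_ball.1
    (P.open_source.eventually_mem hP0)
  obtain ⟨δ, hδ, hδ'⟩ := Metric.eventually_nhds_iff_ball.1
    ((hco.and (F.maps s₁ hs₁)).and
      ((Metric.isOpen_ball.eventually_mem (Metric.mem_ball_self hs)).and
      (Metric.isOpen_ball.eventually_mem (Metric.mem_ball_self hr))))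
  have hsymm0 : P.symm 0 = 0 := by
    have := P.left_inv hP0
    rwa [hP00] at this
  have hε : ∀ᶠ y in 𝓝 (0 : BaseSpace m ke kh kf), y ∈ P.target ∧ P.symm y ∈ Metric.ball 0 δ := by
    have h0t : (0 : BaseSpace m ke kh kf) ∈ P.target := hP00 ▸ P.map_source hP0
    refine (P.open_target.eventually_mem h0t).and ((P.continuousAt_symm h0t).preimage_mem_nhds ?_)
    rw [hsymm0]
    exact Metric.ball_mem_nhds _ hδ
  obtain ⟨ε, hε0, hε'⟩ := Metric.eventually_nhds_iff_ball.1 hε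
  have htube : ∀ y ∈ baseTube m ke kh kf ε, y ∈ P.target ∧ P.symm y ∈ Metric.ball 0 δ :=
    fun y hy => hε' y (baseTube_subset_ball hε0 hy)
  set Q := (P.symm.restrOpen (baseTube m ke kh kf ε) (isOpen_baseTube ε)).symm with hQ
  have hQP : (Q : BaseSpace m ke kh kf → BaseSpace m ke kh kf) = baseTimeMap c := hP
  have hQs : ∀ e, e ∈ Q.source ↔ e ∈ P.source ∧ P e ∈ baseTube m ke kh kf ε := fun e => by
    simp [hQ, OpenPartialHomeomorph.restrOpen]
  have hQt : Q.target = baseTube m ke kh kf ε :=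
    Set.inter_eq_right.2 fun y hy => (htube y hy).1
  have hQδ : ∀ e ∈ Q.source, e ∈ Metric.ball 0 δ := fun e he => by
    have h1 := (htube _ ((hQs e).1 he).2).2
    rwa [P.left_inv ((hQs e).1 he).1] at h1
  have hQr : ∀ e ∈ Q.source, e ∈ Metric.ball 0 r := fun e he => (hδ' e (hQδ e he)).2.2
  have hcc : ∀ e ∈ Q.source, ContDiffAt ℝ ∞ c e := fun e he =>
    hc.contDiffAt (Metric.isOpen_ball.mem_nhds (hQr e he))
  have hQ0 : (0 : BaseSpace m ke kh kf) ∈ Q.source :=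
    (hQs 0).2 ⟨hP0, hP00.symm ▸ zero_mem_baseTube hε0⟩
  have hQsymm : ∀ y ∈ Q.target, ContDiffAt ℝ ∞ Q.symm y := fun y hy => by
    rw [hQt] at hy
    exact hPs y (htube y hy).1 (hδ' _ (htube y hy).2).2.1
  refine ⟨ε, hε0, c, Q, hQP, hc0, hQ0, hQr, hQt, hcc, hQsymm, fun e he => hdef e (hQr e he),
    fun e he g => ?_⟩
  obtain ⟨⟨h1, h2⟩, -, -⟩ := hδ' e (hQδ e he)
  refine ⟨(hQs _).2 ⟨hs₁' _ (h2 g), ?_⟩, h1 g⟩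
  have h3 := ((hQs e).1 he).2
  rw [hP] at h3 ⊢
  rw [baseTimeMap_act_flow (F.u_real g) (h1 g)]
  exact ⟨h3.1, (sum_sq_act (F.norm_u g) (F.u_real g) _).trans_lt h3.2⟩

end

theorem mainTheorem6 {EG : Type*} [NormedAddCommGroup EG] [NormedSpace ℝ EG]
    [FiniteDimensional ℝ EG] {G : Type*} [TopologicalSpace G] [ChartedSpace EG G] [Group G]
    [LieGroup 𝓘(ℝ, EG) ∞ G] [T2Space G] [CompactSpace G]
    (m ke kh kf : ℕ) (U : Set (PhaseSpace m ke kh kf)) (hU : IsOpen U)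
    (hLU : centralTorus m ke kh kf ⊆ U)
    (ρ : G → PhaseSpace m ke kh kf → PhaseSpace m ke kh kf)
    (hρ : IsSystemAction (EG := EG) U ρ) :
    ∃ ε > 0, ∃ Φ : OpenPartialHomeomorph (PhaseSpace m ke kh kf) (PhaseSpace m ke kh kf),
      centralTorus m ke kh kf ⊆ Φ.source ∧ Φ.source ⊆ U ∧ Φ.target = tube m ke kh kf ε ∧
      Φ '' centralTorus m ke kh kf = centralTorus m ke kh kf ∧
      ContMDiffOn (phaseModel m ke kh kf) (phaseModel m ke kh kf) ∞ Φ Φ.source ∧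
      ContMDiffOn (phaseModel m ke kh kf) (phaseModel m ke kh kf) ∞ Φ.symm Φ.target ∧
      PreservesSystem Φ.source Φ ∧
      ∃ σ : G → PhaseSpace m ke kh kf → PhaseSpace m ke kh kf,
        IsLinearAction (EG := EG) σ ∧
        ∀ g, ∀ z ∈ Φ.source, ρ g z ∈ Φ.source ∧ Φ (ρ g z) = σ g (Φ z) := by
  obtain ⟨r, hr, t, u, a, F⟩ := hρ.exists_isFlowForm hU hLU
  obtain ⟨ε, hε0, c, Q, hQP, hc0, hQ0, hQr, hQt, hcc, hQsymm, hdef, hinv⟩ :=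
    F.exists_baseTimeMap hr hρ.preserves
  have hL : Set.EqOn (timeMap c) id (centralTorus m ke kh kf) := timeMap_eqOn_centralTorus hc0
  obtain ⟨Φ, hΦ, hΦi, hΦs, hΦt⟩ : ∃ Φ : OpenPartialHomeomorph (PhaseSpace m ke kh kf)
      (PhaseSpace m ke kh kf), (Φ : PhaseSpace m ke kh kf → PhaseSpace m ke kh kf) = timeMap c ∧
      (Φ.symm : PhaseSpace m ke kh kf → PhaseSpace m ke kh kf) = (fun z =>
        ((Q.symm (z.1, z.2.2)).1, z.2.1 + Torus.proj m (-(c (Q.symm (z.1, z.2.2))).1),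
          (Q.symm (z.1, z.2.2)).2)) ∧
      (∀ z, z ∈ Φ.source ↔ (z.1, z.2.2) ∈ Q.source) ∧
      ∀ z, z ∈ Φ.target ↔ (z.1, z.2.2) ∈ Q.target :=
    ⟨timeHomeomorph Q hQP fun e he => (hcc e he).continuousAt.continuousWithinAt,
      rfl, rfl, fun _ => Iff.rfl, fun _ => Iff.rfl⟩
  refine ⟨ε, hε0, Φ, fun z hz => ?_, fun z hz => ?_, ?_, ?_, fun z hz => ?_, fun z hz => ?_,
    ?_, fun g => linearMap (t g) (u g),
    isLinearAction_linearMap F.smooth_t F.smooth_u F.t_one F.t_mul F.u_one F.u_mul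
      F.isSystemMultiplier F.u_real, fun g z hz => ?_⟩
  · rwa [hΦs, hz.1, hz.2]
  · exact F.mem (z.1, z.2.2) (hQr ((hΦs z).1 hz)) z.2.1
  · ext z
    rw [hΦt, hQt]
    rfl
  · rw [hΦ]
    exact hL.image_eq.trans (Set.image_id _)
  · rw [hΦ]
    exact (contMDiffAt_timeMap (hcc _ ((hΦs z).1 hz))).contMDiffWithinAt
  · rw [hΦi]
    have hz' := (hΦt z).1 hz
    exact (contMDiffAt_timeMap_symm (hQsymm _ hz') (hcc _ (Q.map_target hz'))).contMDiffWithinAt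
  · rw [hΦ]
    exact preservesSystem_timeMap (fun z hz => hcc _ ((hΦs z).1 hz))
      fun z hz => hdef (z.1, z.2.2) ((hΦs z).1 hz)
  · rw [hΦs] at hz ⊢
    rw [hΦ]
    set e : BaseSpace m ke kh kf := (z.1, z.2.2) with he
    obtain ⟨h1, h2⟩ := hinv e hz g
    have h3 : ρ g z = (e.1, z.2.1 + (t g + Torus.proj m (a g e).1),
      act (u g) (u g) (flow (a g e).2 e.2)) := F.apply_eq g e (hQr hz) z.2.1
    rw [h3]
    have h4 : flow (c (e.1, act (u g) (u g) (flow (a g e).2 e.2))).2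
        (act (u g) (u g) (flow (a g e).2 e.2)) = act (u g) (u g) (flow (c e).2 e.2) :=
      congrArg Prod.snd (baseTimeMap_act_flow (F.u_real g) h2)
    refine ⟨h1, Prod.ext rfl (Prod.ext ?_ h4)⟩
    change z.2.1 + (t g + Torus.proj m (a g e).1) +
      Torus.proj m (c (e.1, act (u g) (u g) (flow (a g e).2 e.2))).1 =
      z.2.1 + Torus.proj m (c e).1 + t g
    rw [← h2, Prod.fst_add, Torus.proj_add]
    abel
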